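/- Let $\Gamma$ be a group. A $\Gamma$-group is a group $G$ on which $\Gamma$ acts by automorphisms, $(\sigma,g)\mapsto{}^{\sigma}g$; morphisms are the $\Gamma$-equivariant homomorphisms. Put $$\Gamma\cdot G=\langle {}^{\sigma}g\,g^{-1}: g\in G,\sigma\in\Gamma\rangle,\qquad [G,G]_\Gamma=\langle [G,G]\cup\{{}^{\sigma}g\,g^{-1}: g\in G,\sigma\in\Gamma\}\rangle ,$$ $$G^{ab}_\Gamma=G/[G,G]_\Gamma ,\qquad T\Gamma(G)=[G,G]_\Gamma/[G,G].$$ For a functor $T$ from $\Gamma$-groups to abelian groups let $L^{\mathcal F}_nT(G)=\pi_n(T(F_*(G)))$, $n\ge 0$, where $F_*(G)$ is the free cotriple resolution of $G$: $F_n(G)=F^{n+1}(G)$, $F(G)$ is the free group on the set $\{|g| : g\in G\}$ with ${}^{\sigma}|g|=|{}^{\sigma}g|$, the faces are $\partial_i=F^i\tau F^{n-i}$ with $\tau(|g|)=g$, and the degeneracies are $s_i=F^i\delta F^{n-i}$ with $\delta(|g|)=||g||$. A $G\rtimes\Gamma$-module is relatively free if it is free as a $G$-module on a basis that is a $\Gamma$-subset,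 and relatively projective if it is a retract of a relatively free one. The equivariant integral homology of $G$ is $H^\Gamma_n(G)=H_n(P_*\otimes_{G\rtimes\Gamma}\mathbb Z)$, where $P_*\to\mathbb Z$ is a resolution of the trivial $G\rtimes\Gamma$-module $\mathbb Z$ by relatively projective modules such that the augmentation $P_0\to\mathbb Z$, and each of the maps $P_1\to\ker(P_0\to\mathbb Z)$ and $P_{n+1}\to\ker(P_n\to P_{n-1})$, $n\ge1$, has a section that is a map of $\Gamma$-sets; for instance the $\Gamma$-equivariant bar resolution. Let $H_n(G)$ be the ordinary integral homology of the group $G$, and let $\beta_n:H_n(G)\to H^\Gamma_n(G)$ be the natural homomorphism induced by the projection $P_*\otimes_G\mathbb Z\to P_*\otimes_{G\rtimes\Gamma}\mathbb Z$. Theorem. (i) For every $n\ge 0$ there is an isomorphism, natural in the $\Gamma$-group $G$, $$L^{\mathcal F}_n(G^{ab}_\Gamma)\cong H^\Gamma_{n+1}(G).$$ (ii) There are a short exact sequence, natural in $G$, $$0\to \Gamma\cdot G/([G,G]\cap\Gamma\cdot G)\to H_1(G)\xrightarrow{\beta_1}H^\Gamma_1(G)\to 0$$ and a long exact sequence, natural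 in $G$, $$\cdots\to H^\Gamma_{n+1}(G)\to L^{\mathcal F}_{n-1}T\Gamma(G)\to H_n(G)\xrightarrow{\beta_n}H^\Gamma_n(G)\to L^{\mathcal F}_{n-2}T\Gamma(G)\to\cdots$$ $$\cdots\to H_2(G)\xrightarrow{\beta_2}H^\Gamma_2(G)\to L^{\mathcal F}_0T\Gamma(G)\to H_1(G)\xrightarrow{\beta_1}H^\Gamma_1(G)\to 0 .$$ -/

import Mathlib

open CategoryTheory

universe u

/-! ## Cotriple resolutions -/

namespace CotripleResolution

/-- For a monotone `α : Fin (m + 1) → Fin n`, the map `i ↦ α (i + 1)`. -/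
def tail {m n : ℕ} (α : Fin (m + 1) →o Fin n) : Fin m →o Fin n :=
  ⟨fun i => α i.succ, fun _ _ h => α.monotone (Fin.succ_le_succ_iff.mpr h)⟩

/-- For a monotone `α : Fin m → Fin (n + 1)` that misses `0`, the map `i ↦ α i - 1`. -/
def lower {m n : ℕ} (α : Fin m →o Fin (n + 1)) (h : ∀ i, α i ≠ 0) : Fin m →o Fin n :=
  ⟨fun i => (α i).pred (h i), fun _ _ hij => Fin.pred_le_pred_iff.mpr (α.monotone hij)⟩

lemma ne_of_zero_ne {n m : ℕ} {α : Fin (m + 1) →o Fin (n + 1)} (h : α 0 ≠ 0) (i : Fin (m + 1)) :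
    α i ≠ 0 := fun hi => h (le_antisymm (hi ▸ α.monotone (Fin.zero_le i)) (Fin.zero_le _))

variable {C : Type*} [Category C] (W : Comonad C)

/-- The iterate `Wⁿ A`. -/
def pow (A : C) : ℕ → C
  | 0 => A
  | n + 1 => W.obj (pow A n)

variable {A B D : C}

/-- The counit `ε Wⁿ : Wⁿ⁺¹ A ⟶ Wⁿ A`. -/
def counit (A : C) (n : ℕ) : pow W A (n + 1) ⟶ pow W A n := W.ε.app (pow W A n)

/-- The comultiplication `δ Wⁿ : Wⁿ⁺¹ A ⟶ Wⁿ⁺² A`. -/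
def comul (A : C) (n : ℕ) : pow W A (n + 1) ⟶ pow W A (n + 2) := W.δ.app (pow W A n)

/-- The functor `W`, applied to a morphism between iterates. -/
def up {n m : ℕ} (f : pow W A n ⟶ pow W B m) : pow W A (n + 1) ⟶ pow W B (m + 1) := W.map f

lemma up_id (n : ℕ) : up W (𝟙 (pow W A n)) = 𝟙 (pow W A (n + 1)) := W.map_id _

lemma up_comp {n m l : ℕ} (f : pow W A n ⟶ pow W B m) (g : pow W B m ⟶ pow W D l) :
    up W (f ≫ g) = up W f ≫ up W g := W.map_comp _ _

lemma up_counit {n m : ℕ} (f : pow W A n ⟶ pow W B m) :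
    up W f ≫ counit W B m = counit W A n ≫ f := W.ε.naturality f

lemma up_comul {n m : ℕ} (f : pow W A n ⟶ pow W B m) :
    up W f ≫ comul W B m = comul W A n ≫ up W (up W f) := W.δ.naturality f

lemma comul_counit (n : ℕ) : comul W A n ≫ counit W A (n + 1) = 𝟙 _ := W.left_counit _

lemma comul_up_counit (n : ℕ) : comul W A n ≫ up W (counit W A n) = 𝟙 _ := W.right_counit _

lemma comul_up_comul (n : ℕ) :
    comul W A n ≫ up W (comul W A n) = comul W A n ≫ comul W A (n + 1) := W.coassoc _

/-- The morphism `Wⁿ f`. -/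
def powMap (f : A ⟶ B) : (n : ℕ) → (pow W A n ⟶ pow W B n)
  | 0 => f
  | n + 1 => up W (powMap f n)

/-- Inductive step for `opMap`, with respect to the number of factors of the source. -/
def opMapStep {n : ℕ} (rec : (m : ℕ) → (Fin m →o Fin n) → (pow W A n ⟶ pow W A m)) :
    (m : ℕ) → (Fin m →o Fin (n + 1)) → (pow W A (n + 1) ⟶ pow W A m)
  | 0, α => counit W A n ≫ rec 0 (lower α fun i => i.elim0)
  | m + 1, α =>
    if h : ∀ i, α i ≠ 0 then counit W A n ≫ rec (m + 1) (lower α h)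
    else comul W A n ≫ up W (opMapStep rec m (tail α))

/-- The morphism `Wⁿ A ⟶ Wᵐ A` induced by a monotone map `α : Fin m → Fin n`: the `j`-th factor
`W` of the source, counted from the outside, is sent by the iterated comultiplication to the
factors indexed by the fibre `α⁻¹(j)` (by the counit if this fibre is empty). For the generating
faces and degeneracies this gives `Wⁱ ε Wⁿ⁻ⁱ` and `Wⁱ δ Wⁿ⁻ⁱ`, see `opMap_succAbove_zero`,
`opMap_succAbove_succ`, `opMap_predAbove_zero` and `opMap_predAbove_succ`. -/
def opMap (A : C) : (n m : ℕ) → (Fin m →o Fin n) → (pow W A n ⟶ pow W A m)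
  | 0, 0, _ => 𝟙 _
  | 0, _ + 1, α => (α 0).elim0
  | n + 1, m, α => opMapStep W (opMap A n) m α

lemma opMap_zero (α : Fin 0 →o Fin 0) : opMap W A 0 0 α = 𝟙 _ := rfl

lemma opMap_of_ne {n m : ℕ} (α : Fin m →o Fin (n + 1)) (h : ∀ i, α i ≠ 0) :
    opMap W A (n + 1) m α = counit W A n ≫ opMap W A n m (lower α h) := by
  cases m with
  | zero => rfl
  | succ m => exact dif_pos h

lemma opMap_of_eq {n m : ℕ} (α : Fin (m + 1) →o Fin (n + 1)) (h : α 0 = 0) :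
    opMap W A (n + 1) (m + 1) α =
      comul W A n ≫ up W (opMap W A (n + 1) m (tail α)) :=
  dif_neg fun H => H 0 h

lemma opMap_id (n : ℕ) : opMap W A n n OrderHom.id = 𝟙 _ := by
  induction n with
  | zero => rfl
  | succ n ih =>
    have h : ∀ i, tail (OrderHom.id : Fin (n + 1) →o Fin (n + 1)) i ≠ 0 :=
      fun i => Fin.succ_ne_zero i
    have e : lower _ h = OrderHom.id := by ext i; simp [lower, tail]
    rw [opMap_of_eq W _ rfl, opMap_of_ne W _ h, e, ih, Category.comp_id, comul_up_counit]

lemma opMap_comp (N : ℕ) : ∀ (n m l : ℕ) (_ : n + m + l ≤ N) (α : Fin m →o Fin n)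
    (β : Fin l →o Fin m), opMap W A n l (α.comp β) = opMap W A n m α ≫ opMap W A m l β := by
  induction N with
  | zero =>
    intro n m l hN α β
    obtain rfl : n = 0 := by omega
    obtain rfl : m = 0 := by omega
    obtain rfl : l = 0 := by omega
    simp only [opMap_zero, Category.comp_id]
  | succ N ih =>
    intro n m l hN α β
    match n, m, l with
    | 0, 0, 0 => simp only [opMap_zero, Category.comp_id]
    | 0, 0, _ + 1 => exact (β 0).elim0
    | 0, _ + 1, _ => exact (α 0).elim0
    | n + 1, m, l =>
      by_cases hα : ∀ i, α i ≠ 0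
      · have hαβ : ∀ i, α.comp β i ≠ 0 := fun i => hα (β i)
        have e : lower (α.comp β) hαβ = (lower α hα).comp β := rfl
        rw [opMap_of_ne W _ hα, opMap_of_ne W _ hαβ, e, ih _ _ _ (by omega), Category.assoc]
      · match m with
        | 0 => exact absurd (fun i => i.elim0) hα
        | m + 1 =>
          have hα0 : α 0 = 0 := by
            by_contra h
            exact hα (ne_of_zero_ne h)
          by_cases hβ : ∀ i, β i ≠ 0
          · have e : α.comp β = (tail α).comp (lower β hβ) := by
              ext i
              have : ((β i).pred (hβ i)).succ = β i := Fin.succ_pred _ _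
              change (α (β i) : ℕ) = α ((β i).pred (hβ i)).succ
              rw [this]
            rw [opMap_of_eq W α hα0, opMap_of_ne W β hβ, e, ih _ _ _ (by omega), Category.assoc,
              ← Category.assoc (up W _), up_counit, Category.assoc, ← Category.assoc (comul W A n),
              comul_counit, Category.id_comp]
          · match l with
            | 0 => exact absurd (fun i => i.elim0) hβ
            | l + 1 =>
              have hβ0 : β 0 = 0 := by
                by_contra h
                exact hβ (ne_of_zero_ne h)
              have hαβ : α.comp β 0 = 0 := by simp [hβ0, hα0]
              have e : tail (α.comp β) = α.comp (tail β) := rfl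
              rw [opMap_of_eq W β hβ0, opMap_of_eq W _ hαβ, e, ih _ _ _ (by omega),
                opMap_of_eq W α hα0, up_comp, up_comp, Category.assoc, Category.assoc,
                ← Category.assoc (up W (opMap W A (n + 1) m (tail α))), up_comul,
                ← Category.assoc (comul W A n), comul_up_comul]
              simp only [Category.assoc]

lemma opMap_naturality (f : A ⟶ B) (N : ℕ) : ∀ (n m : ℕ) (_ : n + m ≤ N) (α : Fin m →o Fin n),
    opMap W A n m α ≫ powMap W f m = powMap W f n ≫ opMap W B n m α := by
  induction N with
  | zero =>
    intro n m hN α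
    obtain rfl : n = 0 := by omega
    obtain rfl : m = 0 := by omega
    rw [opMap_zero, opMap_zero, Category.id_comp, Category.comp_id]
  | succ N ih =>
    intro n m hN α
    match n, m with
    | 0, 0 => rw [opMap_zero, opMap_zero, Category.id_comp, Category.comp_id]
    | 0, _ + 1 => exact (α 0).elim0
    | n + 1, m =>
      by_cases hα : ∀ i, α i ≠ 0
      · rw [opMap_of_ne W _ hα, opMap_of_ne W _ hα, Category.assoc, ih _ _ (by omega), powMap,
          ← Category.assoc (up W _), up_counit, Category.assoc]
      · match m with
        | 0 => exact absurd (fun i => i.elim0) hα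
        | m + 1 =>
          have hα0 : α 0 = 0 := by
            by_contra h
            exact hα (ne_of_zero_ne h)
          rw [opMap_of_eq W _ hα0, opMap_of_eq W _ hα0, Category.assoc]
          have e := ih (n + 1) m (by omega) (tail α)
          rw [powMap, powMap, ← up_comp, e, up_comp, powMap, ← Category.assoc, ← Category.assoc,
            up_comul]

lemma powMap_id (n : ℕ) : powMap W (𝟙 A) n = 𝟙 _ := by
  induction n with
  | zero => rfl
  | succ n ih => rw [powMap, ih, up_id]

lemma powMap_comp (f : A ⟶ B) (g : B ⟶ D) (n : ℕ) :
    powMap W (f ≫ g) n = powMap W f n ≫ powMap W g n := by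
  induction n with
  | zero => rfl
  | succ n ih => rw [powMap, ih, up_comp]; rfl

/-- The outermost face is the counit. -/
lemma opMap_succAbove_zero (n : ℕ) :
    opMap W A (n + 1) n (Fin.succAboveOrderEmb 0).toOrderHom = counit W A n := by
  have h : ∀ i, (Fin.succAboveOrderEmb (0 : Fin (n + 1))).toOrderHom i ≠ 0 := fun i => by simp
  have e : lower _ h = OrderHom.id := by ext i; simp [lower]
  rw [opMap_of_ne W _ h, e, opMap_id, Category.comp_id]

/-- The face with index `i + 1` on `Wⁿ⁺² A` is `W` applied to the face with index `i`. -/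
lemma opMap_succAbove_succ (n : ℕ) (i : Fin (n + 1)) :
    opMap W A (n + 2) (n + 1) (Fin.succAboveOrderEmb i.succ).toOrderHom =
      up W (opMap W A (n + 1) n (Fin.succAboveOrderEmb i).toOrderHom) := by
  have h : ∀ j, tail (Fin.succAboveOrderEmb i.succ).toOrderHom j ≠ 0 := fun j => by
    simp [tail]
  have e : lower _ h = (Fin.succAboveOrderEmb i).toOrderHom := by
    ext j; simp [lower, tail]
  rw [opMap_of_eq W _ (by simp), opMap_of_ne W _ h, e, up_comp, ← Category.assoc,
    comul_up_counit, Category.id_comp]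

/-- The outermost degeneracy is the comultiplication. -/
lemma opMap_predAbove_zero (n : ℕ) :
    opMap W A (n + 1) (n + 2) ⟨Fin.predAbove 0, Fin.predAbove_right_monotone _⟩ =
      comul W A n := by
  have e : tail (⟨Fin.predAbove (0 : Fin (n + 1)), Fin.predAbove_right_monotone _⟩ :
    Fin (n + 2) →o Fin (n + 1)) = OrderHom.id := by ext j; simp [tail]
  rw [opMap_of_eq W _ (by simp), e, opMap_id, up_id, Category.comp_id]

/-- The degeneracy with index `i + 1` on `Wⁿ⁺² A` is `W` applied to the degeneracy with
index `i`. -/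
lemma opMap_predAbove_succ (n : ℕ) (i : Fin (n + 1)) :
    opMap W A (n + 2) (n + 3) ⟨Fin.predAbove i.succ, Fin.predAbove_right_monotone _⟩ =
      up W (opMap W A (n + 1) (n + 2) ⟨Fin.predAbove i, Fin.predAbove_right_monotone _⟩) := by
  have h : ∀ j, tail (⟨Fin.predAbove i.succ, Fin.predAbove_right_monotone _⟩ :
      Fin (n + 3) →o Fin (n + 2)) j ≠ 0 := fun j => by
    simp [tail, Fin.succ_predAbove_succ]
  have e : lower _ h = ⟨Fin.predAbove i, Fin.predAbove_right_monotone _⟩ := by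
    ext j; simp [lower, tail, Fin.succ_predAbove_succ]
  rw [opMap_of_eq W _ (by simp), opMap_of_ne W _ h, e, up_comp, ← Category.assoc,
    comul_up_counit, Category.id_comp]

/-- The cotriple resolution of the objects of `C`: the simplicial object with `n`-simplices
`Wⁿ⁺¹ A`, faces `∂ᵢ = Wⁱ ε Wⁿ⁻ⁱ` and degeneracies `sᵢ = Wⁱ δ Wⁿ⁻ⁱ`. -/
def resolution : C ⥤ SimplicialObject C where
  obj A :=
    { obj k := pow W A (k.unop.len + 1)
      map f := opMap W A _ _ f.unop.toOrderHom
      map_id _ := opMap_id W _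
      map_comp f g := opMap_comp W _ _ _ _ le_rfl f.unop.toOrderHom g.unop.toOrderHom }
  map f :=
    { app k := powMap W f (k.unop.len + 1)
      naturality _ _ α := opMap_naturality W f _ _ _ le_rfl α.unop.toOrderHom }
  map_id _ := by ext k; exact powMap_id W _
  map_comp f g := by ext k; exact powMap_comp W f g _

end CotripleResolution

/-- The homotopy groups of a simplicial abelian group: the homology of its Moore complex. -/
noncomputable def homotopyGroup (n : ℕ) : SimplicialObject AddCommGrpCat.{u} ⥤ AddCommGrpCat.{u} :=
  AlgebraicTopology.normalizedMooreComplex AddCommGrpCat ⋙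
    HomologicalComplex.homologyFunctor AddCommGrpCat (ComplexShape.down ℕ) n

/-- The left derived functors of `T` with respect to the cotriple `W`, i.e. `A ↦ πₙ (T W_* A)`. -/
noncomputable def cotripleDerived {C : Type*} [Category C] (W : Comonad C)
    (T : C ⥤ AddCommGrpCat.{u}) (n : ℕ) : C ⥤ AddCommGrpCat.{u} :=
  CotripleResolution.resolution W ⋙ (SimplicialObject.whiskering C AddCommGrpCat).obj T ⋙
    homotopyGroup n

/-! ## Groups with operators -/

/-- A `Γ`-group: a group on which `Γ` acts by automorphisms. -/
structure GammaGrp (Γ : Type u) [Group Γ] where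
  /-- The underlying group. -/
  carrier : Type u
  [group : Group carrier]
  [action : MulDistribMulAction Γ carrier]

namespace GammaGrp

attribute [instance] group action

variable {Γ : Type u} [Group Γ]

instance : CoeSort (GammaGrp Γ) (Type u) := ⟨carrier⟩

instance : Category (GammaGrp Γ) where
  Hom G H := G →*[Γ] H
  id G := MulDistribMulActionHom.id Γ
  comp f g := MulDistribMulActionHom.comp g f

instance : ConcreteCategory (GammaGrp Γ) fun G H => G →*[Γ] H where
  hom f := f
  ofHom f := f

/-- The homomorphism of `Γ`-groups underlying a morphism. -/
abbrev Hom.hom {G H : GammaGrp Γ} (f : G ⟶ H) : G →*[Γ] H := ConcreteCategory.hom f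

/-- The group homomorphism underlying a morphism. -/
abbrev Hom.monoidHom {G H : GammaGrp Γ} (f : G ⟶ H) : G →* H := (Hom.hom f).toMonoidHom

/-- The action of `Γ` on the free group on a `Γ`-set, with `σ • |x| = |σ • x|`. -/
abbrev freeGroupAction (X : Type u) [MulAction Γ X] : MulDistribMulAction Γ (FreeGroup X) where
  smul σ w := FreeGroup.map (σ • ·) w
  one_smul w := by
    change FreeGroup.map _ w = w
    simp
  mul_smul σ τ w := by
    change FreeGroup.map _ w = FreeGroup.map _ (FreeGroup.map _ w)
    rw [FreeGroup.map.comp]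
    congr 2
    funext x
    exact mul_smul σ τ x
  smul_mul σ := map_mul (FreeGroup.map (σ • ·))
  smul_one σ := map_one (FreeGroup.map (σ • ·))

/-- The free group on the underlying `Γ`-set of a `Γ`-group. -/
def free (G : GammaGrp Γ) : GammaGrp Γ where
  carrier := FreeGroup G
  action := freeGroupAction G

/-- The generator `|x|` of the free group on `G`. -/
def gen {G : GammaGrp Γ} (x : G) : G.free := FreeGroup.of (α := G) x

lemma hom_smul {G H : GammaGrp Γ} (f : G ⟶ H) (σ : Γ) (x : G) : f (σ • x) = σ • f x :=
  (Hom.hom f).map_smul' σ x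

lemma gen_smul {G : GammaGrp Γ} (σ : Γ) (x : G) : gen (σ • x) = σ • gen x :=
  FreeGroup.map.of.symm

lemma free_hom_ext {G H : GammaGrp Γ} {f g : G.free ⟶ H} (h : ∀ x : G, f (gen x) = g (gen x)) :
    f = g :=
  MulDistribMulActionHom.ext fun w =>
    DFunLike.congr_fun (FreeGroup.ext_hom (Hom.monoidHom f) (Hom.monoidHom g) h) w

/-- The morphism of `Γ`-groups out of a free one that extends a map of `Γ`-sets. -/
def freeLift {G H : GammaGrp Γ} (f : G → H) (hf : ∀ (σ : Γ) x, f (σ • x) = σ • f x) :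
    G.free ⟶ H :=
  { toMonoidHom := FreeGroup.lift f
    map_smul' := fun σ w => by
      change FreeGroup.lift f (FreeGroup.map (σ • ·) w) = σ • FreeGroup.lift f w
      have : (FreeGroup.lift f).comp (FreeGroup.map (σ • ·)) =
          (MulDistribMulAction.toMonoidHom H σ).comp (FreeGroup.lift f) := by
        ext x
        simp [hf]
      exact DFunLike.congr_fun this w }

lemma freeLift_gen {G H : GammaGrp Γ} (f : G → H) (hf : ∀ (σ : Γ) x, f (σ • x) = σ • f x)
    (x : G) : freeLift f hf (gen x) = f x := FreeGroup.lift_apply_of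

/-- The free group on the underlying `Γ`-set, as an endofunctor of the category of `Γ`-groups. -/
def freeFunctor (Γ : Type u) [Group Γ] : GammaGrp Γ ⥤ GammaGrp Γ where
  obj := free
  map f := freeLift (fun x => gen (f x)) fun σ x => by rw [hom_smul, gen_smul]
  map_id G := free_hom_ext fun x => by rw [freeLift_gen]; rfl
  map_comp f g := free_hom_ext fun x => by
    rw [freeLift_gen, ConcreteCategory.comp_apply, ConcreteCategory.comp_apply, freeLift_gen,
      freeLift_gen]

lemma freeFunctor_map_gen {G H : GammaGrp Γ} (f : G ⟶ H) (x : G) :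
    (freeFunctor Γ).map f (gen x) = gen (f x) :=
  freeLift_gen (fun x => gen (f x)) (fun σ x => by rw [hom_smul, gen_smul]) x

/-- The counit `|g| ↦ g` of the free cotriple. -/
def freeCounit (G : GammaGrp Γ) : G.free ⟶ G := freeLift (fun x => x) fun _ _ => rfl

lemma freeCounit_gen {G : GammaGrp Γ} (x : G) : freeCounit G (gen x) = x := freeLift_gen _ _ x

/-- The comultiplication `|g| ↦ ||g||` of the free cotriple. -/
def freeComul (G : GammaGrp Γ) : G.free ⟶ G.free.free :=
  freeLift (fun x => gen (gen x)) fun σ x => by rw [gen_smul, gen_smul]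

lemma freeComul_gen {G : GammaGrp Γ} (x : G) : freeComul G (gen x) = gen (gen x) :=
  freeLift_gen _ _ x

/-- The free cotriple on the category of `Γ`-groups. -/
def freeCotriple (Γ : Type u) [Group Γ] : Comonad (GammaGrp Γ) where
  toFunctor := freeFunctor Γ
  ε :=
    { app := freeCounit
      naturality G H f := free_hom_ext fun x => by
        change freeCounit H ((freeFunctor Γ).map f (gen x)) = f (freeCounit G (gen x))
        rw [freeFunctor_map_gen, freeCounit_gen, freeCounit_gen] }
  δ :=
    { app := freeComul
      naturality G H f := free_hom_ext fun x => by
        change freeComul H ((freeFunctor Γ).map f (gen x)) =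
          (freeFunctor Γ).map ((freeFunctor Γ).map f) (freeComul G (gen x))
        rw [freeFunctor_map_gen, freeComul_gen, freeComul_gen]
        refine Eq.trans ?_ (freeFunctor_map_gen ((freeFunctor Γ).map f) (gen x)).symm
        exact congrArg gen (freeFunctor_map_gen f x).symm }
  coassoc G := free_hom_ext fun x => by
    change (freeFunctor Γ).map (freeComul G) (freeComul G (gen x)) =
      freeComul G.free (freeComul G (gen x))
    rw [freeComul_gen, freeFunctor_map_gen, freeComul_gen, freeComul_gen]
  left_counit G := free_hom_ext fun x => by
    change freeCounit G.free (freeComul G (gen x)) = gen x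
    rw [freeComul_gen, freeCounit_gen]
  right_counit G := free_hom_ext fun x => by
    change (freeFunctor Γ).map (freeCounit G) (freeComul G (gen x)) = gen x
    rw [freeComul_gen, freeFunctor_map_gen, freeCounit_gen]

/-! ## `Γ`-commutators -/

section Commutators

open scoped commutatorElement

variable (G : GammaGrp Γ)

/-- The subgroup `Γ · G` generated by the elements `σ • g * g⁻¹`. -/
def gammaDiff : Subgroup G := Subgroup.closure {x | ∃ (σ : Γ) (g : G), x = σ • g * g⁻¹}

/-- The `Γ`-commutator subgroup `[G, G]_Γ`, generated by `[G, G]` and the elements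
`σ • g * g⁻¹`. -/
def gammaCommutator : Subgroup G :=
  Subgroup.closure ((commutator G : Set G) ∪ {x | ∃ (σ : Γ) (g : G), x = σ • g * g⁻¹})

lemma commutator_le_gammaCommutator : commutator G ≤ gammaCommutator G :=
  fun _ hx => Subgroup.subset_closure (Or.inl hx)

instance gammaCommutator_normal : (gammaCommutator G).Normal where
  conj_mem n hn g := by
    have h : g * n * g⁻¹ * n⁻¹ ∈ gammaCommutator G :=
      commutator_le_gammaCommutator G (Subgroup.commutator_mem_commutator (Subgroup.mem_top _) (Subgroup.mem_top _))
    simpa using mul_mem h hn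

variable {G}

lemma map_gammaDiff {H : GammaGrp Γ} (f : G ⟶ H) {x : G} (hx : x ∈ gammaDiff G) :
    f x ∈ gammaDiff H := by
  have : gammaDiff G ≤ (gammaDiff H).comap (Hom.monoidHom f) := by
    refine (Subgroup.closure_le _).2 ?_
    rintro _ ⟨σ, g, rfl⟩
    refine Subgroup.subset_closure ⟨σ, f g, ?_⟩
    change f _ = _
    rw [map_mul, map_inv, hom_smul]
  exact this hx

lemma map_commutator {H : GammaGrp Γ} (f : G ⟶ H) {x : G} (hx : x ∈ commutator G) :
    f x ∈ commutator H := by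
  have h : f x ∈ (commutator G).map (Hom.monoidHom f) := ⟨x, hx, rfl⟩
  rw [map_commutator_eq] at h
  exact Subgroup.commutator_mono le_top le_top h

lemma map_gammaCommutator {H : GammaGrp Γ} (f : G ⟶ H) {x : G} (hx : x ∈ gammaCommutator G) :
    f x ∈ gammaCommutator H := by
  have : gammaCommutator G ≤ (gammaCommutator H).comap (Hom.monoidHom f) := by
    refine (Subgroup.closure_le _).2 (Set.union_subset ?_ ?_)
    · exact fun y hy => commutator_le_gammaCommutator H (map_commutator f hy)
    · rintro _ ⟨σ, g, rfl⟩
      refine Subgroup.subset_closure (Or.inr ⟨σ, f g, ?_⟩)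
      change f _ = _
      rw [map_mul, map_inv, hom_smul]
  exact this hx

/-- A quotient by a normal subgroup that contains all commutators is commutative. -/
abbrev commGroupQuotient {K : Type u} [Group K] (N : Subgroup K) [N.Normal]
    (h : ∀ x y : K, ⁅x, y⁆ ∈ N) : CommGroup (K ⧸ N) :=
  { (inferInstance : Group (K ⧸ N)) with
    mul_comm := by
      rintro ⟨x⟩ ⟨y⟩
      refine QuotientGroup.eq.2 ?_
      have := h y⁻¹ x⁻¹
      simpa [commutatorElement_def, mul_assoc] using this }

instance : CommGroup (G ⧸ gammaCommutator G) :=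
  commGroupQuotient _ fun _ _ => commutator_le_gammaCommutator G
    (Subgroup.commutator_mem_commutator (Subgroup.mem_top _) (Subgroup.mem_top _))

instance (S : Subgroup G) : CommGroup (S ⧸ (commutator G).subgroupOf S) :=
  commGroupQuotient _ fun _ _ => Subgroup.commutator_mem_commutator (Subgroup.mem_top _) (Subgroup.mem_top _)

/-- The map `S / (S ∩ [G, G]) ⟶ S' / (S' ∩ [H, H])` induced by `f : G ⟶ H` with `f S ⊆ S'`. -/
def quotientMap {H : GammaGrp Γ} (f : G ⟶ H) (S : Subgroup G) (S' : Subgroup H)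
    (h : ∀ x ∈ S, f x ∈ S') :
    S ⧸ (commutator G).subgroupOf S →* S' ⧸ (commutator H).subgroupOf S' :=
  QuotientGroup.map _ _
    (((Hom.monoidHom f).comp S.subtype).codRestrict S' fun x => h x x.2)
    fun _ hx => map_commutator f hx

end Commutators

variable (Γ)

/-- The `Γ`-abelianization functor `G ↦ G / [G, G]_Γ`. -/
def gammaAb : GammaGrp Γ ⥤ AddCommGrpCat.{u} where
  obj G := AddCommGrpCat.of (Additive (G ⧸ gammaCommutator G))
  map {G H} f := AddCommGrpCat.ofHom (MonoidHom.toAdditive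
    (QuotientGroup.map (gammaCommutator _) (gammaCommutator _) (Hom.monoidHom f)
      fun _ hx => map_gammaCommutator f hx))
  map_id G := AddCommGrpCat.hom_ext <| AddMonoidHom.ext <| by rintro ⟨x⟩; rfl
  map_comp f g := AddCommGrpCat.hom_ext <| AddMonoidHom.ext <| by rintro ⟨x⟩; rfl

/-- The functor `TΓ : G ↦ [G, G]_Γ / [G, G]`. -/
def TGamma : GammaGrp Γ ⥤ AddCommGrpCat.{u} where
  obj G := AddCommGrpCat.of
    (Additive (gammaCommutator G ⧸ (commutator G).subgroupOf (gammaCommutator G)))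
  map f := AddCommGrpCat.ofHom (MonoidHom.toAdditive
    (quotientMap f _ _ fun _ hx => map_gammaCommutator f hx))
  map_id G := AddCommGrpCat.hom_ext <| AddMonoidHom.ext <| by rintro ⟨x⟩; rfl
  map_comp f g := AddCommGrpCat.hom_ext <| AddMonoidHom.ext <| by rintro ⟨x⟩; rfl

/-- The functor `G ↦ Γ · G / ([G, G] ∩ Γ · G)`. -/
def gammaDiffQuotient : GammaGrp Γ ⥤ AddCommGrpCat.{u} where
  obj G := AddCommGrpCat.of
    (Additive (gammaDiff G ⧸ (commutator G).subgroupOf (gammaDiff G)))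
  map f := AddCommGrpCat.ofHom (MonoidHom.toAdditive
    (quotientMap f _ _ fun _ hx => map_gammaDiff f hx))
  map_id G := AddCommGrpCat.hom_ext <| AddMonoidHom.ext <| by rintro ⟨x⟩; rfl
  map_comp f g := AddCommGrpCat.hom_ext <| AddMonoidHom.ext <| by rintro ⟨x⟩; rfl

end GammaGrp

/-! ## Equivariant homology -/

/-- The ring of integers, in the universe of the groups under consideration. -/
def ZZ : Type u := ULift.{u} ℤ

instance : CommRing ZZ.{u} := inferInstanceAs (CommRing (ULift.{u} ℤ))

namespace GammaGrp

open Finsupp TensorProduct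

variable {Γ : Type u} [Group Γ]

/-- The semidirect product `G ⋊ Γ`. -/
abbrev Semi (G : GammaGrp Γ) : Type u := G ⋊[MulDistribMulAction.toMulAut Γ G] Γ

/-- A `G ⋊ Γ`-module is relatively free if, as a `G`-module, it is free with basis a `Γ`-subset:
the translates of the elements of this subset by the elements of `G` are a `ℤ`-basis. -/
def IsRelFree {G : GammaGrp Γ} (V : Rep.{u} ZZ.{u} (Semi G)) : Prop :=
  ∃ B : Set V, (∀ (σ : Γ), ∀ b ∈ B, V.ρ (SemidirectProduct.inr σ) b ∈ B) ∧
    LinearIndependent ZZ.{u} (fun p : G × B => V.ρ (SemidirectProduct.inl p.1) p.2) ∧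
    Submodule.span ZZ.{u} (Set.range fun p : G × B => V.ρ (SemidirectProduct.inl p.1) p.2) = ⊤

/-- A `G ⋊ Γ`-module is relatively projective if it is a retract of a relatively free one. -/
def IsRelProjective {G : GammaGrp Γ} (V : Rep.{u} ZZ.{u} (Semi G)) : Prop :=
  ∃ W : Rep.{u} ZZ.{u} (Semi G), IsRelFree W ∧ Nonempty (Retract V W)

/-- The trivial `G ⋊ Γ`-module `ℤ`. -/
noncomputable abbrev trivialZ (G : GammaGrp Γ) : Rep.{u} ZZ.{u} (Semi G) :=
  Rep.trivial ZZ.{u} (Semi G) ZZ.{u}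

/-- A resolution `⋯ ⟶ P₁ ⟶ P₀ ⟶ ℤ ⟶ 0` of the trivial `G ⋊ Γ`-module `ℤ` by relatively projective
modules, in which each map onto its image, the kernel of the next map, has a section that is a
map of `Γ`-sets. -/
structure RelProjResolution (G : GammaGrp Γ) where
  /-- The complex of relatively projective modules. -/
  complex : ChainComplex (Rep.{u} ZZ.{u} (Semi G)) ℕ
  /-- The augmentation. -/
  ε : complex.X 0 ⟶ trivialZ G
  d_comp_ε : complex.d 1 0 ≫ ε = 0
  projective (n : ℕ) : IsRelProjective (complex.X n)
  split_ε : ∃ γ : ZZ.{u} → complex.X 0,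
    (∀ (σ : Γ) z, γ z = (complex.X 0).ρ (SemidirectProduct.inr σ) (γ z)) ∧ ∀ z, ε (γ z) = z
  split_zero : ∃ γ : {x : complex.X 0 // ε x = 0} → complex.X 1,
    (∀ (σ : Γ) x y, y.1 = (complex.X 0).ρ (SemidirectProduct.inr σ) x.1 →
      γ y = (complex.X 1).ρ (SemidirectProduct.inr σ) (γ x)) ∧
    ∀ x, complex.d 1 0 (γ x) = x.1
  split_succ (n : ℕ) : ∃ γ : {x : complex.X (n + 1) // complex.d (n + 1) n x = 0} →
      complex.X (n + 2),
    (∀ (σ : Γ) x y, y.1 = (complex.X (n + 1)).ρ (SemidirectProduct.inr σ) x.1 →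
      γ y = (complex.X (n + 2)).ρ (SemidirectProduct.inr σ) (γ x)) ∧
    ∀ x, complex.d (n + 2) (n + 1) (γ x) = x.1

/-- The complex `P_* ⊗_{G ⋊ Γ} A`, i.e. the `G ⋊ Γ`-coinvariants of the complex `A ⊗ P_*`. -/
noncomputable abbrev RelProjResolution.tensor {G : GammaGrp Γ} (P : RelProjResolution G)
    (A : Rep.{u} ZZ.{u} (Semi G)) : ChainComplex (ModuleCat.{u} ZZ.{u}) ℕ :=
  P.complex.coinvariantsTensorObj A

/-- The relative torsion groups `Tor_n(ℤ, A)`, computed from the resolution `P` of `ℤ`. -/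
noncomputable abbrev RelProjResolution.tor {G : GammaGrp Γ} (P : RelProjResolution G)
    (A : Rep.{u} ZZ.{u} (Semi G)) (n : ℕ) : ModuleCat.{u} ZZ.{u} :=
  (P.tensor A).homology n

section Standard

variable (G : GammaGrp Γ)

/-- The action of `G ⋊ Γ` on `Gⁿ` given by `(g, σ) (x₁, …, xₙ) = (g σx₁, …, g σxₙ)`. -/
def semiAct (n : ℕ) (h : Semi G) (x : Fin n → G) : Fin n → G :=
  fun i => h.left * h.right • x i

lemma semiAct_one (n : ℕ) (x : Fin n → G) : semiAct G n 1 x = x := by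
  funext i; simp [semiAct]

lemma semiAct_mul (n : ℕ) (h h' : Semi G) (x : Fin n → G) :
    semiAct G n (h * h') x = semiAct G n h (semiAct G n h' x) := by
  funext i; simp [semiAct, mul_smul, mul_assoc]

/-- The permutation module `ℤ[Gⁿ]` of `G ⋊ Γ`. -/
noncomputable def stdRep (n : ℕ) : Representation ZZ.{u} (Semi G) ((Fin n → G) →₀ ZZ.{u}) where
  toFun h := lmapDomain ZZ.{u} ZZ.{u} (semiAct G n h)
  map_one' := by
    ext x : 2
    simp [semiAct_one]
  map_mul' h h' := by
    ext x : 2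
    simp [semiAct_mul]

lemma stdRep_single (n : ℕ) (h : Semi G) (x : Fin n → G) (a : ZZ.{u}) :
    stdRep G n h (single x a) = single (semiAct G n h x) a := mapDomain_single

/-- The map `ℤ[Gⁿ] ⟶ ℤ[Gᵐ]` induced by a map of indices `Fin m → Fin n`. -/
noncomputable def stdMap {n m : ℕ} (α : Fin m → Fin n) :
    Rep.of (stdRep G n) ⟶ Rep.of (stdRep G m) :=
  Rep.ofHom ⟨lmapDomain ZZ.{u} ZZ.{u} (· ∘ α), fun h => by
    ext x : 2
    simp [stdRep_single]
    rfl⟩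

lemma stdMap_single {n m : ℕ} (α : Fin m → Fin n) (x : Fin n → G) (a : ZZ.{u}) :
    (stdMap G α).hom (single x a) = single (x ∘ α) a := mapDomain_single

/-- The simplicial `G ⋊ Γ`-module `[n] ↦ ℤ[Gⁿ⁺¹]`. -/
noncomputable def stdSimplicial : SimplicialObject (Rep.{u} ZZ.{u} (Semi G)) where
  obj k := Rep.of (stdRep G (k.unop.len + 1))
  map f := stdMap G f.unop.toOrderHom
  map_id k := by
    ext x : 4
    exact stdMap_single G _ x 1
  map_comp f g := by
    ext x : 4
    refine (stdMap_single G _ x 1).trans ?_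
    refine ((congrArg (stdMap G g.unop.toOrderHom).hom (stdMap_single G f.unop.toOrderHom x 1)).trans
      (stdMap_single G _ _ 1)).symm

/-- The `Γ`-equivariant standard (homogeneous bar) complex of `G`, with `ℤ[Gⁿ⁺¹]` in degree `n`
and differential `(x₀, …, xₙ) ↦ ∑ᵢ (-1)ⁱ (x₀, …, x̂ᵢ, …, xₙ)`. -/
noncomputable def stdComplex : ChainComplex (Rep.{u} ZZ.{u} (Semi G)) ℕ :=
  (AlgebraicTopology.alternatingFaceMapComplex _).obj (stdSimplicial G)

/-- The `ℤ`-linear map `(x₀, …, xₙ₊₁) ↦ ∑ᵢ (-1)ⁱ (x₀, …, x̂ᵢ, …, xₙ₊₁)`. -/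
noncomputable def stdD (n : ℕ) :
    ((Fin (n + 2) → G) →₀ ZZ.{u}) →ₗ[ZZ.{u}] ((Fin (n + 1) → G) →₀ ZZ.{u}) :=
  ∑ i : Fin (n + 2), (-1 : ℤ) ^ (i : ℕ) • lmapDomain ZZ.{u} ZZ.{u} (· ∘ i.succAbove)

lemma stdD_single (n : ℕ) (x : Fin (n + 2) → G) (a : ZZ.{u}) :
    stdD G n (single x a) =
      ∑ i : Fin (n + 2), (-1 : ℤ) ^ (i : ℕ) • single (x ∘ i.succAbove) a := by
  simp only [stdD, LinearMap.sum_apply, LinearMap.smul_apply, lmapDomain_apply, mapDomain_single]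

lemma stdComplex_d (n : ℕ) (v : (Fin (n + 2) → G) →₀ ZZ.{u}) :
    ((stdComplex G).d (n + 1) n).hom v = stdD G n v := by
  have h : (stdComplex G).d (n + 1) n =
      ∑ i : Fin (n + 2), (-1 : ℤ) ^ (i : ℕ) • stdMap G i.succAbove :=
    AlgebraicTopology.AlternatingFaceMapComplex.obj_d_eq _ n
  have h' : (∑ i : Fin (n + 2), (-1 : ℤ) ^ (i : ℕ) • stdMap G i.succAbove).hom v =
      stdD G n v := by
    rw [Rep.sum_hom]
    refine (Representation.IntertwiningMap.sum_apply _ _ _ _ _).trans ?_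
    rw [stdD, LinearMap.sum_apply]
    refine Finset.sum_congr rfl fun i _ => ?_
    rw [Rep.zsmul_hom]
    rfl
  exact (congrArg (fun f : Rep.of (stdRep G (n + 2)) ⟶ Rep.of (stdRep G (n + 1)) =>
    f.hom v) h).trans h'

/-- The augmentation `ℤ[G] ⟶ ℤ` of the standard complex. -/
noncomputable def stdε : (stdComplex G).X 0 ⟶ trivialZ G :=
  Rep.ofHom (ρ := stdRep G 1) ⟨linearCombination ZZ.{u} fun _ => (1 : ZZ.{u}), fun h => by
    ext x : 2
    simp [stdRep_single]⟩

lemma stdε_apply (v : (Fin 1 → G) →₀ ZZ.{u}) :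
    (stdε G).hom v = linearCombination ZZ.{u} (fun _ => (1 : ZZ.{u})) v := rfl

/-- The contraction `(x₁, …, xₙ) ↦ (1, x₁, …, xₙ)`. -/
noncomputable def stdContraction (n : ℕ) :
    ((Fin n → G) →₀ ZZ.{u}) →ₗ[ZZ.{u}] ((Fin (n + 1) → G) →₀ ZZ.{u}) :=
  lmapDomain ZZ.{u} ZZ.{u} fun x => (Fin.cons 1 x : Fin (n + 1) → G)

lemma stdContraction_single (n : ℕ) (x : Fin n → G) (a : ZZ.{u}) :
    stdContraction G n (single x a) = single (Fin.cons 1 x : Fin (n + 1) → G) a :=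
  mapDomain_single

lemma stdContraction_smul (n : ℕ) (σ : Γ) (v : (Fin n → G) →₀ ZZ.{u}) :
    stdContraction G n (stdRep G n (SemidirectProduct.inr σ) v) =
      stdRep G (n + 1) (SemidirectProduct.inr σ) (stdContraction G n v) := by
  have : (stdContraction G n) ∘ₗ stdRep G n (SemidirectProduct.inr σ) =
      stdRep G (n + 1) (SemidirectProduct.inr σ) ∘ₗ stdContraction G n := by
    ext x : 2
    simp only [LinearMap.comp_apply, lsingle_apply, stdRep_single, stdContraction_single]
    congr 1
    funext i
    refine Fin.cases ?_ (fun j => ?_) i <;> simp [semiAct]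
  exact LinearMap.congr_fun this v

lemma stdContraction_succ (n : ℕ) (v : (Fin (n + 2) → G) →₀ ZZ.{u}) :
    stdD G (n + 1) (stdContraction G (n + 2) v) =
      v - stdContraction G (n + 1) (stdD G n v) := by
  have : stdD G (n + 1) ∘ₗ stdContraction G (n + 2) =
      LinearMap.id - stdContraction G (n + 1) ∘ₗ stdD G n := by
    ext x : 2
    simp only [LinearMap.comp_apply, lsingle_apply, LinearMap.sub_apply, LinearMap.id_apply]
    rw [stdContraction_single, stdD_single, stdD_single, Fin.sum_univ_succ,
      map_sum, sub_eq_add_neg, ← Finset.sum_neg_distrib]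
    congr 1
    · simp only [Fin.val_zero, pow_zero, one_smul]
      congr 1
    · refine Finset.sum_congr rfl fun i _ => ?_
      rw [map_zsmul, stdContraction_single, Fin.val_succ, pow_succ, mul_neg_one, neg_smul]
      congr 3
      funext j
      refine Fin.cases ?_ (fun k => ?_) j <;> simp
  exact LinearMap.congr_fun this v

lemma stdContraction_zero (v : (Fin 1 → G) →₀ ZZ.{u}) :
    stdD G 0 (stdContraction G 1 v) =
      v - stdContraction G 0
        (single ![] (linearCombination ZZ.{u} (fun _ => (1 : ZZ.{u})) v)) := by
  have : stdD G 0 ∘ₗ stdContraction G 1 =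
      LinearMap.id - stdContraction G 0 ∘ₗ (lsingle ![] : ZZ.{u} →ₗ[ZZ.{u}] _) ∘ₗ
        linearCombination ZZ.{u} (fun _ => (1 : ZZ.{u})) := by
    ext x : 2
    simp only [LinearMap.comp_apply, lsingle_apply, LinearMap.sub_apply, LinearMap.id_apply,
      linearCombination_single, smul_eq_mul, mul_one]
    rw [stdContraction_single, stdD_single, stdContraction_single, Fin.sum_univ_two]
    simp only [Fin.val_zero, pow_zero, one_smul, Fin.val_one, pow_one, neg_smul, sub_eq_add_neg]
    have e0 : (Fin.cons 1 x : Fin 2 → G) ∘ Fin.succAbove 0 = x := by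
      funext j; simp
    have e1 : (Fin.cons 1 x : Fin 2 → G) ∘ Fin.succAbove 1 = Fin.cons 1 ![] := by
      funext j
      fin_cases j
      rfl
    rw [← e1]
    exact congrArg (fun y => single y (1 : ZZ.{u}) + _) e0
  exact LinearMap.congr_fun this v

lemma stdRep_isRelFree (n : ℕ) : IsRelFree (Rep.of (stdRep G (n + 1))) := by
  let b : (Fin (n + 1) → G) → ((Fin (n + 1) → G) →₀ ZZ.{u}) := fun x => single x 1
  let B : Set ((Fin (n + 1) → G) →₀ ZZ.{u}) := b '' {x | x 0 = 1}
  have hb : LinearIndependent ZZ.{u} b := Finsupp.linearIndependent_single_one _ _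
  have hsp : Submodule.span ZZ.{u} (Set.range b) = ⊤ := by
    have := (Finsupp.basisSingleOne (R := ZZ.{u}) (ι := Fin (n + 1) → G)).span_eq
    simpa [b] using this
  have hinl (g : G) (x : Fin (n + 1) → G) :
      semiAct G (n + 1) (SemidirectProduct.inl g) x = fun i => g * x i := by
    funext i; simp [semiAct]
  choose y hy using fun p : G × B => p.2.2
  have hfam (p : G × B) : stdRep G (n + 1) (SemidirectProduct.inl p.1) p.2 =
      b fun i => p.1 * y p i := by
    rw [← (hy p).2, stdRep_single, hinl]
  refine ⟨B, ?_, ?_, ?_⟩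
  · rintro σ _ ⟨x, hx, rfl⟩
    refine ⟨semiAct G (n + 1) (SemidirectProduct.inr σ) x, ?_, (stdRep_single G _ _ _ _).symm⟩
    have hx' : x 0 = 1 := hx
    simp [semiAct, hx']
  · have hinj : Function.Injective fun (p : G × B) (i : Fin (n + 1)) => p.1 * y p i := by
      intro p q hpq
      have h0 : p.1 = q.1 := by
        have := congrFun hpq 0
        simpa [show y p 0 = 1 from (hy p).1, show y q 0 = 1 from (hy q).1] using this
      have h1 : y p = y q := by
        funext i
        have := congrFun hpq i
        simpa [h0] using this
      refine Prod.ext h0 (Subtype.ext ?_)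
      rw [← (hy p).2, ← (hy q).2, h1]
    have hli := hb.comp _ hinj
    have e : (b ∘ fun (p : G × B) (i : Fin (n + 1)) => p.1 * y p i) =
        fun p => stdRep G (n + 1) (SemidirectProduct.inl p.1) p.2 := funext fun p => (hfam p).symm
    rw [e] at hli
    exact hli
  · refine top_le_iff.1 (hsp ▸ Submodule.span_mono ?_)
    rintro _ ⟨x, rfl⟩
    let p : G × B := (x 0, ⟨b fun i => (x 0)⁻¹ * x i, _, by simp, rfl⟩)
    refine ⟨p, (stdRep_single G _ _ _ _).trans ?_⟩
    rw [hinl]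
    simp [b, p]

lemma stdε_d (v : (Fin 2 → G) →₀ ZZ.{u}) :
    linearCombination ZZ.{u} (fun _ => (1 : ZZ.{u})) (stdD G 0 v) = 0 := by
  have : linearCombination ZZ.{u} (fun _ => (1 : ZZ.{u})) ∘ₗ stdD G 0 = 0 := by
    ext x : 2
    simp only [LinearMap.comp_apply, lsingle_apply]
    rw [stdD_single, Fin.sum_univ_two]
    simp
  exact LinearMap.congr_fun this v

/-- The equivariant standard complex is a resolution by relatively free modules, and the contraction
`(x₀, …, xₙ) ↦ (1, x₀, …, xₙ)` provides the `Γ`-sections. -/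
noncomputable def stdResolution : RelProjResolution G where
  complex := stdComplex G
  ε := stdε G
  d_comp_ε := Rep.hom_ext <| Representation.IntertwiningMap.ext <| LinearMap.ext fun v =>
    (congrArg (stdε G).hom (stdComplex_d G 0 v)).trans (stdε_d G v)
  projective n := ⟨_, stdRep_isRelFree G n, ⟨Retract.refl _⟩⟩
  split_ε := by
    refine ⟨fun z => stdContraction G 0 (single ![] z), fun σ z => ?_, fun z => ?_⟩
    · refine Eq.trans ?_ (stdContraction_smul G 0 σ _)
      rw [stdRep_single]
      exact congrArg (fun x => stdContraction G 0 (single x z)) (Subsingleton.elim _ _)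
    · refine (stdε_apply G _).trans ?_
      simp only [stdContraction_single, linearCombination_single, smul_eq_mul, mul_one]
  split_zero := by
    refine ⟨fun x => stdContraction G 1 x.1, fun σ x y hxy => ?_, fun x => ?_⟩
    · exact (congrArg (stdContraction G 1) hxy).trans (stdContraction_smul G 1 σ x.1)
    · refine (stdComplex_d G 0 _).trans ((stdContraction_zero G x.1).trans ?_)
      have h : linearCombination ZZ.{u} (fun _ => (1 : ZZ.{u})) x.1 = 0 := x.2
      rw [h, single_zero, map_zero]
      exact sub_zero (G := (Fin 1 → G) →₀ ZZ.{u}) x.1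
  split_succ n := by
    refine ⟨fun x => stdContraction G (n + 2) x.1, fun σ x y hxy => ?_, fun x => ?_⟩
    · exact (congrArg (stdContraction G (n + 2)) hxy).trans (stdContraction_smul G (n + 2) σ x.1)
    · refine (stdComplex_d G (n + 1) _).trans ((stdContraction_succ G n x.1).trans ?_)
      have h : stdD G n x.1 = 0 := (stdComplex_d G n x.1).symm.trans x.2
      rw [h, map_zero]
      exact sub_zero (G := (Fin (n + 2) → G) →₀ ZZ.{u}) x.1

end Standard

end GammaGrp

namespace GammaGrp

open Finsupp TensorProduct

variable {Γ : Type u} [Group Γ]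

section Functoriality

/-- The degree `n - 1` part `ℤ[Gⁿ] ⊗_{G ⋊ Γ} ℤ` of the complex `P_* ⊗_{G ⋊ Γ} ℤ` for the standard
resolution `P_*`. -/
abbrev StdCoinv (G : GammaGrp Γ) (n : ℕ) : Type u :=
  ((Representation.trivial ZZ.{u} (Semi G) ZZ.{u}).tprod (stdRep G n)).Coinvariants

/-- The class of `a ⊗ v` in `ℤ[Gⁿ] ⊗_{G ⋊ Γ} ℤ`. -/
noncomputable def stdMk (G : GammaGrp Γ) (n : ℕ) :
    ZZ.{u} →ₗ[ZZ.{u}] ((Fin n → G) →₀ ZZ.{u}) →ₗ[ZZ.{u}] StdCoinv G n :=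
  (TensorProduct.mk ZZ.{u} ZZ.{u} _).compr₂ (Representation.Coinvariants.mk _)

lemma stdMk_smul (G : GammaGrp Γ) (n : ℕ) (h : Semi G) (a : ZZ.{u}) (v) :
    stdMk G n a (stdRep G n h v) = stdMk G n a v :=
  Representation.Coinvariants.mk_self_apply
    ((Representation.trivial ZZ.{u} (Semi G) ZZ.{u}).tprod (stdRep G n)) h (a ⊗ₜ v)

lemma stdCoinv_ext {G : GammaGrp Γ} {n : ℕ} {M : Type*} [AddCommGroup M] [Module ZZ.{u} M]
    {f g : StdCoinv G n →ₗ[ZZ.{u}] M}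
    (h : ∀ x, f (stdMk G n 1 (single x 1)) = g (stdMk G n 1 (single x 1))) : f = g := by
  refine Representation.Coinvariants.hom_ext (TensorProduct.ext (LinearMap.ext_ring ?_))
  ext x : 2
  exact h x

/-- The complex `P_* ⊗_{G ⋊ Γ} ℤ` for the standard resolution `P_*`. -/
noncomputable abbrev stdChains (G : GammaGrp Γ) : ChainComplex (ModuleCat.{u} ZZ.{u}) ℕ :=
  (stdResolution G).tensor (trivialZ G)

lemma stdChains_d (G : GammaGrp Γ) (n : ℕ) (a : ZZ.{u}) (v : (Fin (n + 2) → G) →₀ ZZ.{u}) :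
    ((stdChains G).d (n + 1) n).hom (stdMk G (n + 2) a v) = stdMk G (n + 1) a (stdD G n v) :=
  congrArg (stdMk G (n + 1) a) (stdComplex_d G n v)

variable {G H K : GammaGrp Γ}

lemma semiAct_comp (f : G ⟶ H) (n : ℕ) (h : Semi G) (x : Fin n → G) :
    f ∘ semiAct G n h x = semiAct H n ⟨f h.left, h.right⟩ (f ∘ x) := by
  funext i
  change f (h.left * h.right • x i) = f h.left * h.right • f (x i)
  rw [map_mul, hom_smul]

/-- The map `ℤ[Gⁿ] ⊗_{G ⋊ Γ} ℤ ⟶ ℤ[Hⁿ] ⊗_{H ⋊ Γ} ℤ` induced by `f : G ⟶ H`. -/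
noncomputable def stdPush (f : G ⟶ H) (n : ℕ) : StdCoinv G n →ₗ[ZZ.{u}] StdCoinv H n :=
  Representation.Coinvariants.lift _
    (TensorProduct.lift ((stdMk H n).compl₂
      (lmapDomain ZZ.{u} ZZ.{u} fun x : Fin n → G => (f ∘ x : Fin n → H)))) fun h => by
    refine TensorProduct.ext (LinearMap.ext_ring ?_)
    ext x : 2
    change stdMk H n 1 (mapDomain _ (stdRep G n h (single x 1))) =
      stdMk H n 1 (mapDomain _ (single x 1))
    rw [stdRep_single, mapDomain_single, mapDomain_single, semiAct_comp, ← stdRep_single,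
      stdMk_smul]

lemma stdPush_mk (f : G ⟶ H) (n : ℕ) (a : ZZ.{u}) (x : Fin n → G) (b : ZZ.{u}) :
    stdPush f n (stdMk G n a (single x b)) = stdMk H n a (single (f ∘ x) b) :=
  congrArg (stdMk H n a) mapDomain_single

/-- The chain map `P_*(G) ⊗_{G ⋊ Γ} ℤ ⟶ P_*(H) ⊗_{H ⋊ Γ} ℤ` induced by `f : G ⟶ H`. -/
noncomputable def stdChainsMap (f : G ⟶ H) : stdChains G ⟶ stdChains H where
  f n := ModuleCat.ofHom (stdPush f (n + 1))
  comm' i j hij := by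
    obtain rfl : j + 1 = i := hij
    refine ModuleCat.hom_ext (stdCoinv_ext (G := G) (n := j + 2) fun x => ?_)
    change ((stdChains H).d (j + 1) j).hom (stdPush f (j + 2) (stdMk G (j + 2) 1 (single x 1))) =
      stdPush f (j + 1) (((stdChains G).d (j + 1) j).hom (stdMk G (j + 2) 1 (single x 1)))
    rw [stdChains_d]
    rw [stdPush_mk]
    refine (stdChains_d H j 1 _).trans ?_
    rw [stdD_single, stdD_single, map_sum, map_sum, map_sum]
    refine Finset.sum_congr rfl fun i _ => ?_
    rw [map_zsmul, map_zsmul, map_zsmul, stdPush_mk]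
    rfl

/-- The functor `G ↦ P_*(G) ⊗_{G ⋊ Γ} ℤ`. -/
noncomputable def stdChainsFunctor (Γ : Type u) [Group Γ] :
    GammaGrp Γ ⥤ ChainComplex (ModuleCat.{u} ZZ.{u}) ℕ where
  obj G := stdChains G
  map f := stdChainsMap f
  map_id G := by
    ext n : 1
    exact ModuleCat.hom_ext (stdCoinv_ext (G := G) fun x => stdPush_mk (𝟙 G) (n + 1) 1 x 1)
  map_comp {G H K} f g := by
    ext n : 1
    refine ModuleCat.hom_ext (stdCoinv_ext (G := G) fun x => ?_)
    refine (stdPush_mk (f ≫ g) (n + 1) 1 x 1).trans ?_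
    exact ((congrArg (stdPush g (n + 1)) (stdPush_mk f (n + 1) 1 x 1)).trans
      (stdPush_mk g (n + 1) 1 (f ∘ x) 1)).symm

/-- The equivariant integral homology `H_n^Γ(G) = Tor_n(ℤ, ℤ)`, as a functor. -/
noncomputable def equivariantHomology (Γ : Type u) [Group Γ] (n : ℕ) :
    GammaGrp Γ ⥤ AddCommGrpCat.{u} :=
  stdChainsFunctor Γ ⋙ HomologicalComplex.homologyFunctor _ _ n ⋙ forget₂ _ AddCommGrpCat

/-- The complex that computes the integral homology of the group underlying a `Γ`-group. -/
noncomputable def chainsFunctor (Γ : Type u) [Group Γ] :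
    GammaGrp Γ ⥤ ChainComplex (ModuleCat.{u} ZZ.{u}) ℕ where
  obj G := groupHomology.inhomogeneousChains (Rep.trivial ZZ.{u} G ZZ.{u})
  map f := groupHomology.chainsMap (Hom.monoidHom f) (𝟙 (Rep.trivial ZZ.{u} _ ZZ.{u}))
  map_id _ := groupHomology.chainsMap_id
  map_comp f g := groupHomology.chainsMap_comp (Hom.monoidHom f) (Hom.monoidHom g) (𝟙 _) (𝟙 _)

/-- The integral homology `H_n(G)` of the group underlying a `Γ`-group, as a functor. -/
noncomputable def integralHomology (Γ : Type u) [Group Γ] (n : ℕ) :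
    GammaGrp Γ ⥤ AddCommGrpCat.{u} :=
  chainsFunctor Γ ⋙ HomologicalComplex.homologyFunctor _ _ n ⋙ forget₂ _ AddCommGrpCat

lemma integralHomology_obj (G : GammaGrp Γ) (n : ℕ) : (integralHomology Γ n).obj G =
    (forget₂ (ModuleCat ZZ.{u}) AddCommGrpCat).obj
      (groupHomology (Rep.trivial ZZ.{u} G ZZ.{u}) n) := rfl

lemma equivariantHomology_obj (G : GammaGrp Γ) (n : ℕ) : (equivariantHomology Γ n).obj G =
    (forget₂ (ModuleCat ZZ.{u}) AddCommGrpCat).obj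
      ((stdResolution G).tor (trivialZ G) n) := rfl

/-- The map `ℤ[Gⁿ] ⟶ ℤ[Gⁿ⁺¹] ⊗_{G ⋊ Γ} ℤ`, `(g₁, …, gₙ) ↦ (1, g₁, g₁g₂, …, g₁⋯gₙ)`. -/
noncomputable def betaLinear (G : GammaGrp Γ) (n : ℕ) :
    ((Fin n → G) →₀ ZZ.{u}) →ₗ[ZZ.{u}] StdCoinv G (n + 1) :=
  stdMk G (n + 1) 1 ∘ₗ lmapDomain ZZ.{u} ZZ.{u} (Fin.partialProd (n := n) (M := G))

lemma betaLinear_single (G : GammaGrp Γ) (n : ℕ) (x : Fin n → G) (a : ZZ.{u}) :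
    betaLinear G n (single x a) = stdMk G (n + 1) 1 (single (Fin.partialProd x) a) :=
  congrArg (stdMk G (n + 1) 1) mapDomain_single

/-- The chain map from the inhomogeneous chains of the group `G` to `P_* ⊗_{G ⋊ Γ} ℤ`. -/
noncomputable def betaChains (G : GammaGrp Γ) :
    groupHomology.inhomogeneousChains (Rep.trivial ZZ.{u} G ZZ.{u}) ⟶ stdChains G where
  f n := ModuleCat.ofHom (betaLinear G n)
  comm' i j hij := by
    obtain rfl : j + 1 = i := hij
    refine ModuleCat.hom_ext (Finsupp.lhom_ext' fun x => LinearMap.ext_ring ?_)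
    change ((stdChains G).d (j + 1) j).hom (betaLinear G (j + 1) (single x 1)) =
      betaLinear G j (((groupHomology.inhomogeneousChains
        (Rep.trivial ZZ.{u} G ZZ.{u})).d (j + 1) j).hom (single x 1))
    rw [groupHomology.inhomogeneousChains.d_def, betaLinear_single]
    refine (stdChains_d G j 1 _).trans ?_
    refine Eq.trans ?_ (congrArg (betaLinear G j)
      (groupHomology.inhomogeneousChains.d_single (A := Rep.trivial ZZ.{u} G ZZ.{u})
        j x (1 : ZZ.{u}))).symm
    rw [stdD_single, Fin.sum_univ_succ, map_add, map_add, map_sum, map_sum]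
    congr 1
    · have e : Fin.partialProd x ∘ Fin.succAbove 0 =
          semiAct G (j + 1) (SemidirectProduct.inl (x 0)) (Fin.partialProd fun i => x i.succ) := by
        funext i
        simp only [semiAct, Function.comp_apply, Fin.zero_succAbove, SemidirectProduct.left_inl,
          SemidirectProduct.right_inl, one_smul]
        exact Fin.partialProd_succ' x i
      rw [e, Fin.val_zero, pow_zero, one_smul, ← stdRep_single, stdMk_smul]
      exact (betaLinear_single G j (fun i => x i.succ) 1).symm
    · refine Finset.sum_congr rfl fun i _ => ?_
      have e : (-1 : ZZ.{u}) ^ ((i : ℕ) + 1) • (single (Fin.contractNth i (· * ·) x) (1 : ZZ.{u}) :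
          (Fin j → G) →₀ ZZ.{u}) =
          (-1 : ℤ) ^ ((i : ℕ) + 1) • single (Fin.contractNth i (· * ·) x) (1 : ZZ.{u}) := by
        rcases neg_one_pow_eq_or ℤ ((i : ℕ) + 1) with h | h <;>
        rcases Nat.even_or_odd ((i : ℕ) + 1) with h' | h' <;>
        simp_all
      refine Eq.trans ?_ (congrArg (betaLinear G j) e).symm
      rw [map_zsmul, map_zsmul, betaLinear_single, Fin.partialProd_contractNth]
      rfl

/-- The natural transformation `β_n : H_n(G) ⟶ H_n^Γ(G)`. On the standard resolution `P_*` it is the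
projection `P_* ⊗_G ℤ ⟶ P_* ⊗_{G ⋊ Γ} ℤ`, where `P_* ⊗_G ℤ` is identified with the complex of
inhomogeneous chains of `G` in the usual way. -/
noncomputable def beta (Γ : Type u) [Group Γ] (n : ℕ) :
    integralHomology Γ n ⟶ equivariantHomology Γ n :=
  Functor.whiskerRight (G := chainsFunctor Γ) (H := stdChainsFunctor Γ)
    { app := betaChains
      naturality G H f := by
        ext n : 1
        refine ModuleCat.hom_ext (Finsupp.lhom_ext' fun x => LinearMap.ext_ring ?_)
        change betaLinear H n (((groupHomology.chainsMap (A := Rep.trivial ZZ.{u} G ZZ.{u})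
          (B := Rep.trivial ZZ.{u} H ZZ.{u}) (Hom.monoidHom f) (𝟙 _)).f n).hom (single x 1)) =
            stdPush f (n + 1) (betaLinear G n (single x 1))
        rw [betaLinear_single, stdPush_mk]
        refine (congrArg (betaLinear H n) (groupHomology.chainsMap_f_single
          (A := Rep.trivial ZZ.{u} G ZZ.{u}) (B := Rep.trivial ZZ.{u} H ZZ.{u})
          (Hom.monoidHom f) (𝟙 _) n x (1 : ZZ.{u}))).trans ?_
        refine (betaLinear_single H n _ _).trans ?_
        congr 2
        funext i
        refine Fin.induction ?_ (fun j hj => ?_) i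
        · simp
        · simp only [Function.comp_apply] at hj ⊢
          rw [Fin.partialProd_succ, Fin.partialProd_succ, map_mul, hj]
          rfl }
    (HomologicalComplex.homologyFunctor _ _ n ⋙ forget₂ _ AddCommGrpCat)

end Functoriality

end GammaGrp

open GammaGrp

/-! Ordinary and equivariant homology in degree `n + 1` are both the `n`-th cotriple derived functor
of their own first homology, `G / [G, G]` and `G / [G, G]_Γ`. The kernel of the projection between
these two functors is `TΓ`. The sequence `TΓ ⟶ ordinaryAb ⟶ gammaAb` is short exact on every
`Γ`-group, in particular on each `F_n(G)`, so it yields a short exact sequence of complexes; its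
long exact homology sequence is the one claimed, once the identifications are known to carry the
projection to `β`.

The derived functors are computed by acyclic models. Let `K` be the chains with degree zero removed
(the differential into degree zero vanishes, whence the shift by one), augmented to `T`, and form
the double complex with entries `K_q(W^{p+1} A)`. Its rows contract onto `K_q(A)`: in inhomogeneous
coordinates the chains are `ℤ[Gⁿ]_Γ` and depend only on the `Γ`-set `G`, so the equivariant map `g ↦
|g|`, although not a homomorphism, is a natural section of the map induced by the counit
(`isIso_homologyMap_totToBase`). Its columns resolve `T(W^{p+1} A)` (`isIso_homologyMap_totToAlt`).
Exactness at the bottom of a column says that first homology is `T` (`exists_stdCoinvD_eq`).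
Exactness higher up says that a free `Γ`-group on a `Γ`-set has no homology above degree one. The
reason is that its Cayley tree is stable under `F ⋊ Γ`, so that the standard complex is
equivariantly homotopic to one concentrated in degrees zero and one
(`PathSystem.exists_stdCoinvD_eq`, `freePathSystem`).

Ordinary homology needs no second argument: for the trivial group acting trivially, `betaLinear`
identifies the inhomogeneous chains with the equivariant ones, and exactness is carried across. The
compatibility with `β` is `altOrdinaryIso_hom_beta` on derived functors and
`abProjection_gammaAbIso` in degree one. -/

section Bicomplex

/-! ### Solving equations in a double complex with exact rows. -/

variable {X : ℕ → ℕ → Type u} [∀ p q, AddCommGroup (X p q)]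

/-- The part of total degree `n` of a family indexed by bidegrees. -/
def bidegreePart (n : ℕ) (y : ∀ p q, X p q) (p q : ℕ) : X p q := if p + q = n then y p q else 0

variable (h : ∀ p q, X (p + 1) q →+ X p q) (v : ∀ p q, X p (q + 1) →+ X p q)

/-- The total differential on families indexed by bidegrees. -/
def totalDiff (y : ∀ p q, X p q) (p q : ℕ) : X p q := h p q (y (p + 1) q) + v p q (y p (q + 1))

/-- The total differential is homogeneous of degree `-1`. Hence equations can be solved for families
over all bidegrees at once and cut down to one total degree afterwards. -/
lemma totalDiff_bidegreePart (n : ℕ) (y : ∀ p q, X p q) :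
    totalDiff h v (bidegreePart (n + 1) y) = bidegreePart n (totalDiff h v y) := by
  funext p q
  have e : p + 1 + q = n + 1 ↔ p + q = n := by omega
  have e' : p + (q + 1) = n + 1 ↔ p + q = n := by omega
  by_cases H : p + q = n
  · simp [totalDiff, bidegreePart, e, e', H]
  · simp [totalDiff, bidegreePart, e, e', H]

lemma totalDiff_bidegreePart_zero (y : ∀ p q, X p q) :
    totalDiff h v (bidegreePart 0 y) = 0 := by
  funext p q
  have e : ¬ (p + 1 + q = 0) := by omega
  have e' : ¬ (p + (q + 1) = 0) := by omega
  simp only [totalDiff, bidegreePart, if_neg e, if_neg e', map_zero, add_zero, Pi.zero_apply]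

variable {h v} {B : ℕ → Type u} [∀ q, AddCommGroup (B q)] {ε : ∀ q, X 0 q →+ B q}

/-- In a double complex with exact rows, a primitive of a cycle can be prescribed in the zeroth
column if this is possible after augmentation. -/
lemma exists_totalDiff_eq (hhv : ∀ p q x, h p q (v (p + 1) q x) = -v p q (h p (q + 1) x))
    (hv : ∀ p q x, v p q (v p (q + 1) x) = 0)
    (exact_zero : ∀ q x, ε q x = 0 → ∃ y, h 0 q y = x)
    (exact_succ : ∀ p q x, h p q x = 0 → ∃ y, h (p + 1) q y = x)
    (z : ∀ p q, X p q) (hz : totalDiff h v z = 0) (a : ∀ q, X 0 q)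
    (ha : ∀ q, ε q (z 0 q - v 0 q (a (q + 1))) = 0) :
    ∃ y, y 0 = a ∧ totalDiff h v y = z := by
  classical
  -- Columns are chosen one after the other, each lifting the error left by its predecessor through
  -- the horizontal differential. The value `0` is a default that never occurs: `key` shows that the
  -- lift always exists.
  let y : ∀ p q, X p q := fun p => Nat.rec (motive := fun p => ∀ q, X p q) a
    (fun p w q => if H : ∃ x, h p q x = z p q - v p q (w (q + 1)) then H.choose else 0) p
  have y_succ (p q : ℕ) (H : ∃ x, h p q x = z p q - v p q (y p (q + 1))) :
      h p q (y (p + 1) q) = z p q - v p q (y p (q + 1)) := by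
    have e : y (p + 1) q = H.choose := dif_pos H
    rw [e]
    exact H.choose_spec
  have key (p : ℕ) : ∀ q, h p q (y (p + 1) q) = z p q - v p q (y p (q + 1)) := by
    induction p with
    | zero => exact fun q => y_succ 0 q (exact_zero q _ (ha q))
    | succ p ih =>
      refine fun q => y_succ (p + 1) q (exact_succ p q _ ?_)
      -- The next error is a horizontal cycle because `z` is a total cycle and the two differentials
      -- anticommute.
      have h0 : h p q (z (p + 1) q) + v p q (z p (q + 1)) = 0 := congrFun (congrFun hz p) q
      rw [map_sub, hhv, ih, map_sub, hv, sub_zero, sub_neg_eq_add, h0]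
  refine ⟨y, rfl, ?_⟩
  funext p q
  simp only [totalDiff, key, sub_add_cancel]

/-- The case `z = 0` of `exists_totalDiff_eq`: a cycle of the augmentation, lifted to column zero,
extends to a total cycle. This gives surjectivity on homology. -/
lemma exists_total_cycle (hhv : ∀ p q x, h p q (v (p + 1) q x) = -v p q (h p (q + 1) x))
    (hv : ∀ p q x, v p q (v p (q + 1) x) = 0)
    (exact_zero : ∀ q x, ε q x = 0 → ∃ y, h 0 q y = x)
    (exact_succ : ∀ p q x, h p q x = 0 → ∃ y, h (p + 1) q y = x)
    (n : ℕ) (a : ∀ q, X 0 q) (hn : ∀ q, q ≠ n → a q = 0)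
    (ha : ∀ q, ε q (v 0 q (a (q + 1))) = 0) :
    ∃ y : ∀ p q, X p q, (∀ p q, p + q ≠ n → y p q = 0) ∧ y 0 = a ∧ totalDiff h v y = 0 := by
  obtain ⟨y, hy, hy'⟩ := exists_totalDiff_eq hhv hv exact_zero exact_succ 0
    (by funext p q; simp [totalDiff]) a (fun q => by simp [ha])
  refine ⟨bidegreePart n y, fun p q hpq => if_neg hpq, ?_, ?_⟩
  · funext q
    by_cases hq : q = n
    · simp [bidegreePart, hq, hy]
    · simp [bidegreePart, hq, hn q hq]
  · cases n with
    | zero => exact totalDiff_bidegreePart_zero h v y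
    | succ n =>
      rw [totalDiff_bidegreePart, hy']
      funext p q
      simp [bidegreePart]

/-- The counterpart for injectivity on homology: a total cycle bounds as soon as its augmentation
bounds, with `a` a lift of the primitive. -/
lemma exists_total_boundary (hhv : ∀ p q x, h p q (v (p + 1) q x) = -v p q (h p (q + 1) x))
    (hv : ∀ p q x, v p q (v p (q + 1) x) = 0)
    (exact_zero : ∀ q x, ε q x = 0 → ∃ y, h 0 q y = x)
    (exact_succ : ∀ p q x, h p q x = 0 → ∃ y, h (p + 1) q y = x)
    (n : ℕ) (x : ∀ p q, X p q) (hn : ∀ p q, p + q ≠ n → x p q = 0) (hx : totalDiff h v x = 0)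
    (a : ∀ q, X 0 q) (ha : ∀ q, ε q (x 0 q) = ε q (v 0 q (a (q + 1)))) :
    ∃ y : ∀ p q, X p q, (∀ p q, p + q ≠ n + 1 → y p q = 0) ∧ totalDiff h v y = x := by
  obtain ⟨y, hy, hy'⟩ := exists_totalDiff_eq hhv hv exact_zero exact_succ x hx a
    (fun q => by simp [ha])
  refine ⟨bidegreePart (n + 1) y, fun p q hpq => if_neg hpq, ?_⟩
  rw [totalDiff_bidegreePart, hy']
  funext p q
  by_cases hpq : p + q = n
  · simp [bidegreePart, hpq]
  · simp [bidegreePart, hpq, hn p q hpq]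

end Bicomplex

/-! ### Total complexes of first-quadrant double complexes of abelian groups. -/

namespace AbComplex

/-- A chain map of complexes of abelian groups is a quasi-isomorphism in degree `n` if it
is bijective on cycles modulo boundaries. -/
lemma isIso_homologyMap {K L : ChainComplex AddCommGrpCat.{u} ℕ} (f : K ⟶ L) (n : ℕ)
    (hsurj : ∀ b : L.X n, (∀ m, L.d n m b = 0) →
      ∃ a : K.X n, (∀ m, K.d n m a = 0) ∧ ∃ c, f.f n a = b + L.d (n + 1) n c)
    (hinj : ∀ a : K.X n, (∀ m, K.d n m a = 0) → (∃ c, f.f n a = L.d (n + 1) n c) →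
      ∃ c, K.d (n + 1) n c = a) :
    IsIso (HomologicalComplex.homologyMap f n) := by
  have hrel : (ComplexShape.down ℕ).prev n = n + 1 := by simp
  have mk (K : ChainComplex AddCommGrpCat.{u} ℕ) (x : K.X n) (hx : ∀ m, K.d n m x = 0) :
      ∃ z : K.cycles n, K.iCycles n z = x :=
    ⟨(K.sc n).abCyclesIso.inv ⟨x, hx _⟩, (K.sc n).abCyclesIso_inv_apply_iCycles ⟨x, hx _⟩⟩
  have dz (K : ChainComplex AddCommGrpCat.{u} ℕ) (z : K.cycles n) (m : ℕ) :
      K.d n m (K.iCycles n z) = 0 := by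
    rw [← ConcreteCategory.comp_apply, K.iCycles_d]; rfl
  -- Homology is the cokernel of `toCycles`, so a class vanishes exactly when its cycle is a
  -- boundary; injectivity of `iCycles` lets this be read in `K.X n`.
  have ex (K : ChainComplex AddCommGrpCat.{u} ℕ) (z : K.cycles n) :
      K.homologyπ n z = 0 ↔ ∃ c, K.d (n + 1) n c = K.iCycles n z := by
    have inj : Function.Injective (K.iCycles n) :=
      (AddCommGrpCat.mono_iff_injective _).1 inferInstance
    have e := (ShortComplex.ab_exact_iff_function_exact _).1 (ShortComplex.exact_of_g_is_cokernel
      (ShortComplex.mk _ _ (K.toCycles_comp_homologyπ (n + 1) n))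
        (K.homologyIsCokernel _ n hrel)) z
    refine e.trans (exists_congr fun c => ?_)
    rw [← K.toCycles_i (n + 1) n, ConcreteCategory.comp_apply]
    exact inj.eq_iff.symm
  have surjπ (K : ChainComplex AddCommGrpCat.{u} ℕ) : Function.Surjective (K.homologyπ n) :=
    (AddCommGrpCat.epi_iff_surjective _).1 inferInstance
  have nat (z : K.cycles n) : HomologicalComplex.homologyMap f n (K.homologyπ n z) =
      L.homologyπ n (HomologicalComplex.cyclesMap f n z) := by
    rw [← ConcreteCategory.comp_apply, HomologicalComplex.homologyπ_naturality]; rfl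
  have nat' (z : K.cycles n) : L.iCycles n (HomologicalComplex.cyclesMap f n z) =
      f.f n (K.iCycles n z) := by
    rw [← ConcreteCategory.comp_apply, HomologicalComplex.cyclesMap_i]; rfl
  refine (ConcreteCategory.isIso_iff_bijective _).2 ⟨?_, ?_⟩
  · refine (injective_iff_map_eq_zero (HomologicalComplex.homologyMap f n).hom).2 fun w hw => ?_
    obtain ⟨z, rfl⟩ := surjπ K w
    have hw' := (nat z).symm.trans hw
    obtain ⟨c, hc⟩ := (ex L _).1 hw'
    exact (ex K z).2 (hinj _ (dz K z) ⟨c, by rw [hc, nat']⟩)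
  · intro w
    obtain ⟨z, rfl⟩ := surjπ L w
    obtain ⟨a, ha, c, hc⟩ := hsurj _ (dz L z)
    obtain ⟨y, rfl⟩ := mk K a ha
    refine ⟨K.homologyπ n y, ?_⟩
    rw [nat, ← sub_eq_zero, ← map_sub, ex]
    refine ⟨c, ?_⟩
    rw [map_sub, nat', hc, add_sub_cancel_left]

/-- Chain complexes of chain complexes of abelian groups, viewed as double complexes with
commuting squares; the complex `Y.X p` is the `p`-th column. -/
abbrev DoubleComplex := ChainComplex (ChainComplex AddCommGrpCat.{u} ℕ) ℕ

namespace DoubleComplex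

variable (Y : DoubleComplex.{u})

/-- The group in bidegree `(p, q)`. -/
abbrev bi (p q : ℕ) : Type u := (Y.X p).X q

/-- The horizontal differential. -/
def hDiff (p q : ℕ) : Y.bi (p + 1) q →+ Y.bi p q := ((Y.d (p + 1) p).f q).hom

/-- The vertical differential, with the sign that makes it anticommute with the horizontal one. -/
def vDiff (p q : ℕ) : Y.bi p (q + 1) →+ Y.bi p q := (-1 : ℤ) ^ p • ((Y.X p).d (q + 1) q).hom

variable {Y}

lemma hDiff_apply (p q : ℕ) (x : Y.bi (p + 1) q) : Y.hDiff p q x = (Y.d (p + 1) p).f q x := rfl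

lemma vDiff_apply (p q : ℕ) (x : Y.bi p (q + 1)) :
    Y.vDiff p q x = (-1 : ℤ) ^ p • (Y.X p).d (q + 1) q x := rfl

lemma d_f_d_f (p q : ℕ) (x : Y.bi (p + 2) q) :
    (Y.d (p + 1) p).f q ((Y.d (p + 2) (p + 1)).f q x) = 0 := by
  rw [← ConcreteCategory.comp_apply, ← HomologicalComplex.comp_f, Y.d_comp_d]; rfl

lemma d_d (C : ChainComplex AddCommGrpCat.{u} ℕ) (q : ℕ) (x : C.X (q + 2)) :
    C.d (q + 1) q (C.d (q + 2) (q + 1) x) = 0 := by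
  rw [← ConcreteCategory.comp_apply, C.d_comp_d]; rfl

lemma comm_apply {C D : ChainComplex AddCommGrpCat.{u} ℕ} (f : C ⟶ D) (q : ℕ) (x : C.X (q + 1)) :
    f.f q (C.d (q + 1) q x) = D.d (q + 1) q (f.f (q + 1) x) := by
  rw [← ConcreteCategory.comp_apply, ← ConcreteCategory.comp_apply, f.comm]

lemma hDiff_hDiff (p q : ℕ) (x : Y.bi (p + 2) q) : Y.hDiff p q (Y.hDiff (p + 1) q x) = 0 :=
  d_f_d_f p q x

lemma vDiff_vDiff (p q : ℕ) (x : Y.bi p (q + 2)) : Y.vDiff p q (Y.vDiff p (q + 1) x) = 0 := by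
  rw [vDiff_apply, vDiff_apply, map_zsmul, d_d, smul_zero, smul_zero]

lemma hDiff_vDiff (p q : ℕ) (x : Y.bi (p + 1) (q + 1)) :
    Y.hDiff p q (Y.vDiff (p + 1) q x) = -Y.vDiff p q (Y.hDiff p (q + 1) x) := by
  rw [vDiff_apply, vDiff_apply, map_zsmul, hDiff_apply, hDiff_apply, comm_apply, pow_succ,
    mul_neg_one, neg_smul]

lemma vDiff_hDiff (p q : ℕ) (x : Y.bi (p + 1) (q + 1)) :
    Y.vDiff p q (Y.hDiff p (q + 1) x) = -Y.hDiff p q (Y.vDiff (p + 1) q x) := by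
  rw [hDiff_vDiff, neg_neg]

variable (Y)

/-- The families of elements of total degree `n`. -/
def totSubgroup (n : ℕ) : AddSubgroup (∀ p q, Y.bi p q) where
  carrier := {x | ∀ p q, p + q ≠ n → x p q = 0}
  zero_mem' _ _ _ := rfl
  add_mem' {a b} ha hb p q hpq := by
    change a p q + b p q = 0
    rw [ha p q hpq, hb p q hpq, add_zero]
  neg_mem' {a} ha p q hpq := by
    change -a p q = 0
    rw [ha p q hpq, neg_zero]

/-- The differential of the total complex. -/
def totD (n : ℕ) : Y.totSubgroup (n + 1) →+ Y.totSubgroup n where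
  toFun x := ⟨totalDiff Y.hDiff Y.vDiff x.1, fun p q hpq => by
    change Y.hDiff p q (x.1 (p + 1) q) + Y.vDiff p q (x.1 p (q + 1)) = 0
    rw [x.2 (p + 1) q (by omega), x.2 p (q + 1) (by omega), map_zero, map_zero, add_zero]⟩
  map_zero' := Subtype.ext (by funext p q; simp [totalDiff])
  map_add' x y := Subtype.ext (by
    funext p q
    change Y.hDiff p q (x.1 (p + 1) q + y.1 (p + 1) q) +
      Y.vDiff p q (x.1 p (q + 1) + y.1 p (q + 1)) =
        (Y.hDiff p q (x.1 (p + 1) q) + Y.vDiff p q (x.1 p (q + 1))) +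
        (Y.hDiff p q (y.1 (p + 1) q) + Y.vDiff p q (y.1 p (q + 1)))
    rw [map_add, map_add, add_add_add_comm])

lemma totD_totD (n : ℕ) (x : Y.totSubgroup (n + 2)) : Y.totD n (Y.totD (n + 1) x) = 0 := by
  refine Subtype.ext ?_
  funext p q
  change Y.hDiff p q (Y.hDiff (p + 1) q (x.1 (p + 2) q) + Y.vDiff (p + 1) q (x.1 (p + 1) (q + 1))) +
    Y.vDiff p q (Y.hDiff p (q + 1) (x.1 (p + 1) (q + 1)) + Y.vDiff p (q + 1) (x.1 p (q + 2))) = 0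
  rw [map_add, map_add, hDiff_hDiff, vDiff_vDiff, hDiff_vDiff, zero_add, add_zero, neg_add_cancel]

/-- The total complex of a double complex. -/
def tot : ChainComplex AddCommGrpCat.{u} ℕ :=
  ChainComplex.of (fun n => AddCommGrpCat.of (Y.totSubgroup n))
    (fun n => AddCommGrpCat.ofHom (Y.totD n))
    fun n => AddCommGrpCat.hom_ext (AddMonoidHom.ext (Y.totD_totD n))

lemma tot_d (n : ℕ) : Y.tot.d (n + 1) n = AddCommGrpCat.ofHom (Y.totD n) :=
  ChainComplex.of_d (fun n => AddCommGrpCat.of (Y.totSubgroup n))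
    (fun n => AddCommGrpCat.ofHom (Y.totD n)) n

variable {Y}

/-- The bihomogeneous component of an element of the total complex. -/
def comp {n : ℕ} (x : Y.tot.X n) (p q : ℕ) : Y.bi p q :=
  Subtype.val (p := (· ∈ Y.totSubgroup n)) x p q

lemma comp_eq_zero {n : ℕ} (x : Y.tot.X n) {p q : ℕ} (h : p + q ≠ n) : comp x p q = 0 :=
  Subtype.property (p := (· ∈ Y.totSubgroup n)) x p q h

lemma tot_ext {n : ℕ} {x y : Y.tot.X n} (h : ∀ p q, comp x p q = comp y p q) : x = y :=
  Subtype.ext (p := (· ∈ Y.totSubgroup n)) (funext fun p => funext fun q => h p q)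

/-- The element of the total complex with the given bihomogeneous components. -/
def mkTot (n : ℕ) (y : ∀ p q, Y.bi p q) (hy : ∀ p q, p + q ≠ n → y p q = 0) : Y.tot.X n :=
  Subtype.mk (p := (· ∈ Y.totSubgroup n)) y hy

lemma comp_mkTot {n : ℕ} (y : ∀ p q, Y.bi p q) (hy : ∀ p q, p + q ≠ n → y p q = 0) (p q : ℕ) :
    comp (mkTot n y hy) p q = y p q := rfl

lemma comp_d {n : ℕ} (x : Y.tot.X (n + 1)) (p q : ℕ) :
    comp (Y.tot.d (n + 1) n x) p q =
      Y.hDiff p q (comp x (p + 1) q) + Y.vDiff p q (comp x p (q + 1)) := by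
  rw [tot_d]; rfl

/-- The bihomogeneous component, as a homomorphism. -/
def compHom (Y : DoubleComplex.{u}) (n p q : ℕ) : Y.tot.X n →+ Y.bi p q where
  toFun x := comp x p q
  map_zero' := rfl
  map_add' _ _ := rfl

/-- With `d_eq_zero`, this translates cycles of `tot` into families killed by `totalDiff`. In degree
zero the differential of the complex carries no information, and both terms vanish for reasons of
degree. -/
lemma totalDiff_comp_eq_zero {n : ℕ} (x : Y.tot.X n) (hx : ∀ m, Y.tot.d n m x = 0) :
    totalDiff Y.hDiff Y.vDiff (comp x) = 0 := by
  funext p q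
  cases n with
  | zero =>
    change Y.hDiff p q (comp x (p + 1) q) + Y.vDiff p q (comp x p (q + 1)) = 0
    rw [comp_eq_zero x (by omega), comp_eq_zero x (by omega), map_zero, map_zero, add_zero]
  | succ n =>
    refine (comp_d x p q).symm.trans ?_
    rw [hx n]
    rfl

lemma d_eq_zero {n : ℕ} (x : Y.tot.X n) (hx : totalDiff Y.hDiff Y.vDiff (comp x) = 0) (m : ℕ) :
    Y.tot.d n m x = 0 := by
  by_cases h : m + 1 = n
  · subst h
    exact tot_ext fun p q => (comp_d x p q).trans (congrFun (congrFun hx p) q)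
  · rw [Y.tot.shape _ _ h]; rfl

/-- Functoriality of the total complex. -/
def totMap {Y Z : DoubleComplex.{u}} (f : Y ⟶ Z) : Y.tot ⟶ Z.tot where
  f n := AddCommGrpCat.ofHom (X := Y.totSubgroup n) (Y := Z.totSubgroup n)
    { toFun x := ⟨fun p q => (f.f p).f q (x.1 p q), fun p q hpq =>
        (congrArg ((f.f p).f q) (x.2 p q hpq)).trans (map_zero ((f.f p).f q).hom)⟩
      map_zero' := Subtype.ext (by funext p q; exact map_zero _)
      map_add' x y := Subtype.ext (by funext p q; exact map_add ((f.f p).f q).hom _ _) }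
  comm' i n hi := by
    obtain rfl : n + 1 = i := hi
    ext x
    refine tot_ext fun p q => ?_
    have e1 : (Z.d (p + 1) p).f q ((f.f (p + 1)).f q (comp x (p + 1) q)) =
        (f.f p).f q ((Y.d (p + 1) p).f q (comp x (p + 1) q)) := by
      rw [← ConcreteCategory.comp_apply, ← ConcreteCategory.comp_apply,
        ← HomologicalComplex.comp_f, ← HomologicalComplex.comp_f, f.comm]
    change comp (Z.tot.d (n + 1) n _) p q = (f.f p).f q (comp (Y.tot.d (n + 1) n x) p q)
    rw [comp_d, comp_d, map_add, hDiff_apply, hDiff_apply, vDiff_apply, vDiff_apply, map_zsmul,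
      comm_apply, ← e1]
    rfl

/-- The total complex, as a functor. -/
def totFunctor : DoubleComplex.{u} ⥤ ChainComplex AddCommGrpCat.{u} ℕ where
  obj Y := Y.tot
  map f := totMap f
  map_id Y := by ext n x; exact tot_ext fun p q => rfl
  map_comp f g := by ext n x; exact tot_ext fun p q => rfl

/-! ### Exact rows or exact columns: the total complex computes the augmentation. -/

section Rows

variable {B : ChainComplex AddCommGrpCat.{u} ℕ} (ε : Y.X 0 ⟶ B) (hε : Y.d 1 0 ≫ ε = 0)

include hε in
lemma rowAug_hDiff (q : ℕ) (x : Y.bi 1 q) : ε.f q (Y.hDiff 0 q x) = 0 := by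
  rw [hDiff_apply, ← ConcreteCategory.comp_apply, ← HomologicalComplex.comp_f, hε]; rfl

lemma rowAug_vDiff (q : ℕ) (x : Y.bi 0 (q + 1)) :
    ε.f q (Y.vDiff 0 q x) = B.d (q + 1) q (ε.f (q + 1) x) := by
  rw [vDiff_apply, pow_zero, one_smul, comm_apply]

/-- The projection of the total complex to the augmentation of the rows. -/
def totToRowAug : Y.tot ⟶ B where
  f n := AddCommGrpCat.ofHom ((ε.f n).hom.comp (compHom Y n 0 n))
  comm' i n hi := by
    obtain rfl : n + 1 = i := hi
    ext x
    change B.d (n + 1) n (ε.f (n + 1) (comp x 0 (n + 1))) =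
      ε.f n (comp (Y.tot.d (n + 1) n x) 0 n)
    rw [comp_d, map_add, rowAug_hDiff ε hε, zero_add, rowAug_vDiff]

lemma totToRowAug_apply {n : ℕ} (x : Y.tot.X n) :
    (totToRowAug ε hε).f n x = ε.f n (comp x 0 n) := rfl

/-- Lift a cycle, or a primitive, of `B` to column zero and correct it across the remaining columns
by exactness of the augmented rows. -/
lemma isIso_homologyMap_totToRowAug (surj : ∀ q, Function.Surjective (ε.f q))
    (exact_zero : ∀ q (x : Y.bi 0 q), ε.f q x = 0 → ∃ y : Y.bi 1 q, (Y.d 1 0).f q y = x)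
    (exact_succ : ∀ p q (x : Y.bi (p + 1) q), (Y.d (p + 1) p).f q x = 0 →
      ∃ y : Y.bi (p + 2) q, (Y.d (p + 2) (p + 1)).f q y = x) (n : ℕ) :
    IsIso (HomologicalComplex.homologyMap (totToRowAug ε hε) n) := by
  classical
  refine isIso_homologyMap _ n (fun b hb => ?_) (fun x hx ⟨c, hc⟩ => ?_)
  · obtain ⟨a, rfl⟩ := surj n b
    -- The prescribed column zero is `a` in row `n` and zero elsewhere. Its vertical differential
    -- has augmentation zero because `ε a` is a cycle.
    obtain ⟨y, hy, hy0, hy'⟩ := exists_total_cycle (h := Y.hDiff) (v := Y.vDiff)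
      (B := fun q => B.X q) (ε := fun q => (ε.f q).hom) hDiff_vDiff vDiff_vDiff exact_zero
      exact_succ n (Pi.single n a) (fun q hq => Pi.single_eq_of_ne hq _) (fun q => by
        refine (rowAug_vDiff ε q _).trans ?_
        by_cases hq : q + 1 = n
        · subst hq
          rw [Pi.single_eq_same, hb]
        · rw [Pi.single_eq_of_ne hq, map_zero, map_zero])
    refine ⟨mkTot n y hy, fun m => d_eq_zero (mkTot n y hy) hy' m, 0, ?_⟩
    rw [map_zero, add_zero, totToRowAug_apply, comp_mkTot]
    congr 1
    exact (congrFun hy0 n).trans (Pi.single_eq_same _ _)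
  · obtain ⟨a, rfl⟩ := surj (n + 1) c
    rw [totToRowAug_apply] at hc
    obtain ⟨y, hy, hy'⟩ := exists_total_boundary (h := Y.hDiff) (v := Y.vDiff)
      (B := fun q => B.X q) (ε := fun q => (ε.f q).hom) hDiff_vDiff vDiff_vDiff exact_zero
      exact_succ n (comp x) (fun p q => comp_eq_zero x) (totalDiff_comp_eq_zero x hx)
      (Pi.single (n + 1) a) (fun q => by
        refine Eq.trans ?_ (rowAug_vDiff ε q _).symm
        by_cases hq : q = n
        · subst hq
          rw [Pi.single_eq_same]
          exact hc
        · rw [Pi.single_eq_of_ne (by omega), map_zero, map_zero,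
            comp_eq_zero x (by omega), map_zero])
    refine ⟨mkTot (n + 1) y hy, tot_ext fun p q => ?_⟩
    rw [comp_d]
    exact congrFun (congrFun hy' p) q

end Rows

section Columns

variable {A : ChainComplex AddCommGrpCat.{u} ℕ} (η : ∀ p, (Y.X p).X 0 ⟶ A.X p)
  (hη : ∀ p, (Y.d (p + 1) p).f 0 ≫ η p = η (p + 1) ≫ A.d (p + 1) p)
  (hη' : ∀ p, (Y.X p).d 1 0 ≫ η p = 0)

include hη' in
lemma colAug_vDiff (p : ℕ) (x : Y.bi p 1) : η p (Y.vDiff p 0 x) = 0 := by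
  have e : η p ((Y.X p).d 1 0 x) = 0 := by
    rw [← ConcreteCategory.comp_apply, hη']; rfl
  rw [vDiff_apply, map_zsmul, e, smul_zero]

include hη in
lemma colAug_hDiff (p : ℕ) (x : Y.bi (p + 1) 0) :
    η p (Y.hDiff p 0 x) = A.d (p + 1) p (η (p + 1) x) := by
  rw [hDiff_apply, ← ConcreteCategory.comp_apply, hη]; rfl

/-- The projection of the total complex to the augmentation of the columns. -/
def totToColAug : Y.tot ⟶ A where
  f n := AddCommGrpCat.ofHom ((η n).hom.comp (compHom Y n n 0))
  comm' i n hi := by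
    obtain rfl : n + 1 = i := hi
    ext x
    change A.d (n + 1) n (η (n + 1) (comp x (n + 1) 0)) = η n (comp (Y.tot.d (n + 1) n x) n 0)
    rw [comp_d, map_add, colAug_vDiff η hη', add_zero, colAug_hDiff η hη]

lemma totToColAug_apply {n : ℕ} (x : Y.tot.X n) :
    (totToColAug η hη hη').f n x = η n (comp x n 0) := rfl

/-- The sign in `vDiff` is invertible, so the unsigned columns and the signed ones are exact
together; `d_eq_zero_of_vDiff` is the other half. -/
lemma exists_vDiff_eq {p q : ℕ} {x : Y.bi p q}
    (h : ∃ y : Y.bi p (q + 1), (Y.X p).d (q + 1) q y = x) : ∃ y, Y.vDiff p q y = x := by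
  obtain ⟨y, rfl⟩ := h
  refine ⟨(-1 : ℤ) ^ p • y, ?_⟩
  rw [vDiff_apply, map_zsmul, smul_smul, ← mul_pow, neg_one_mul, neg_neg, one_pow, one_smul]

lemma d_eq_zero_of_vDiff {p q : ℕ} {x : Y.bi p (q + 1)} (h : Y.vDiff p q x = 0) :
    (Y.X p).d (q + 1) q x = 0 := by
  have := congrArg ((-1 : ℤ) ^ p • ·) h
  simpa only [vDiff_apply, smul_smul, ← mul_pow, neg_one_mul, neg_neg, one_pow, one_smul,
    smul_zero] using this

/-- Anticommutation of the differentials is symmetric, so the lemmas on exact rows apply with the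
roles of `p` and `q` exchanged. -/
lemma isIso_homologyMap_totToColAug (surj : ∀ p, Function.Surjective (η p))
    (exact_zero : ∀ p (x : Y.bi p 0), η p x = 0 → ∃ y : Y.bi p 1, (Y.X p).d 1 0 y = x)
    (exact_succ : ∀ p q (x : Y.bi p (q + 1)), (Y.X p).d (q + 1) q x = 0 →
      ∃ y : Y.bi p (q + 2), (Y.X p).d (q + 2) (q + 1) y = x) (n : ℕ) :
    IsIso (HomologicalComplex.homologyMap (totToColAug η hη hη') n) := by
  classical
  refine isIso_homologyMap _ n (fun b hb => ?_) (fun x hx ⟨c, hc⟩ => ?_)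
  · obtain ⟨a, rfl⟩ := surj n b
    obtain ⟨y, hy, hy0, hy'⟩ := exists_total_cycle (X := fun q p => Y.bi p q)
      (h := fun q p => Y.vDiff p q) (v := fun q p => Y.hDiff p q)
      (B := fun p => A.X p) (ε := fun p => (η p).hom) (fun q p => vDiff_hDiff p q)
      (fun q p => hDiff_hDiff p q) (fun p x hx => exists_vDiff_eq (exact_zero p x hx))
      (fun q p x hx => exists_vDiff_eq (exact_succ p q x (d_eq_zero_of_vDiff hx)))
      n (Pi.single n a) (fun p hp => Pi.single_eq_of_ne hp _) (fun p => by
        refine (colAug_hDiff η hη p _).trans ?_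
        by_cases hp : p + 1 = n
        · subst hp
          rw [Pi.single_eq_same, hb]
        · rw [Pi.single_eq_of_ne hp, map_zero, map_zero])
    refine ⟨mkTot n (fun p q => y q p) fun p q hpq => hy q p (by omega),
      d_eq_zero (mkTot n _ _) ?_, 0, ?_⟩
    · funext p q
      exact (add_comm _ _).trans (congrFun (congrFun hy' q) p)
    · rw [map_zero, add_zero, totToColAug_apply, comp_mkTot]
      congr 1
      exact (congrFun hy0 n).trans (Pi.single_eq_same _ _)
  · obtain ⟨a, rfl⟩ := surj (n + 1) c
    rw [totToColAug_apply] at hc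
    obtain ⟨y, hy, hy'⟩ := exists_total_boundary (X := fun q p => Y.bi p q)
      (h := fun q p => Y.vDiff p q) (v := fun q p => Y.hDiff p q)
      (B := fun p => A.X p) (ε := fun p => (η p).hom) (fun q p => vDiff_hDiff p q)
      (fun q p => hDiff_hDiff p q) (fun p x hx => exists_vDiff_eq (exact_zero p x hx))
      (fun q p x hx => exists_vDiff_eq (exact_succ p q x (d_eq_zero_of_vDiff hx)))
      n (fun q p => comp x p q) (fun q p h => comp_eq_zero x (by omega)) (by
        funext q p
        exact (add_comm _ _).trans (congrFun (congrFun (totalDiff_comp_eq_zero x hx) p) q))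
      (Pi.single (n + 1) a) (fun p => by
        refine Eq.trans ?_ (colAug_hDiff η hη p _).symm
        by_cases hp : p = n
        · subst hp
          rw [Pi.single_eq_same]
          exact hc
        · rw [Pi.single_eq_of_ne (by omega), map_zero, map_zero,
            comp_eq_zero x (by omega), map_zero])
    refine ⟨mkTot (n + 1) (fun p q => y q p) fun p q hpq => hy q p (by omega),
      tot_ext fun p q => ?_⟩
    rw [comp_d]
    exact (add_comm _ _).trans (congrFun (congrFun hy' q) p)

end Columns

end DoubleComplex

end AbComplex

/-! ### From homotopy groups to alternating face map complexes. -/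

namespace CotripleResolution

open AlgebraicTopology AbComplex

variable {C : Type*} [Category C] (W : Comonad C)

/-- The alternating face map complex of the simplicial object `T W_* A`. -/
noncomputable def altChains {V : Type*} [Category V] [Preadditive V] (T : C ⥤ V) :
    C ⥤ ChainComplex V ℕ :=
  resolution W ⋙ (SimplicialObject.whiskering C V).obj T ⋙ alternatingFaceMapComplex V

/-- The effect of a natural transformation on `altChains`. -/
noncomputable def altChainsMap {V : Type*} [Category V] [Preadditive V] {T T' : C ⥤ V}
    (τ : T ⟶ T') : altChains W T ⟶ altChains W T' :=
  Functor.whiskerLeft (resolution W)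
    (Functor.whiskerRight ((SimplicialObject.whiskering C V).map τ) (alternatingFaceMapComplex V))

/-- The coface map `Fin n → Fin (n + 1)` that misses `i`. -/
abbrev coface {n : ℕ} (i : Fin (n + 1)) : Fin n →o Fin (n + 1) :=
  (Fin.succAboveOrderEmb i).toOrderHom

lemma altChains_d {V : Type*} [Category V] [Preadditive V] (T : C ⥤ V) (A : C) (n : ℕ) :
    ((altChains W T).obj A).d (n + 1) n =
      ∑ i : Fin (n + 2), (-1 : ℤ) ^ (i : ℕ) •
        T.map (opMap W A (n + 2) (n + 1) (coface i)) :=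
  AlternatingFaceMapComplex.obj_d_eq _ n

/-- The homotopy of the simplicial abelian group `T W_* A` is the homology of its alternating
face map complex. -/
noncomputable def derivedIsoAlt (T : C ⥤ AddCommGrpCat.{u}) (n : ℕ) :
    cotripleDerived W T n ≅
      altChains W T ⋙ HomologicalComplex.homologyFunctor _ (ComplexShape.down ℕ) n :=
  NatIso.ofComponents (fun A =>
    (DoldKan.homotopyEquivNormalizedMooreComplexAlternatingFaceMapComplex
      (Y := ((SimplicialObject.whiskering C AddCommGrpCat).obj T).obj
        ((resolution W).obj A))).toHomologyIso n) fun {A B} f => by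
    -- The homotopy equivalence is given object by object, but its forward map is the inclusion of
    -- the Moore complex, which is natural.
    have e := (inclusionOfMooreComplex AddCommGrpCat.{u}).naturality
      (((SimplicialObject.whiskering C AddCommGrpCat).obj T).map ((resolution W).map f))
    have e' := congrArg (fun g => HomologicalComplex.homologyMap g n) e
    simp only [HomologicalComplex.homologyMap_comp] at e'
    exact e'

end CotripleResolution

/-! ### Acyclic models: the double complex that compares `K` with `T W_*`. -/

namespace CotripleResolution

open AlgebraicTopology AbComplex

variable {C : Type*} [Category C] (W : Comonad C)

/-- A functorial chain complex `K` with augmentation `η : K₀ ⟶ T` that computes the left derived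
functors of `T`: it is right exact at `T`, exact in positive degrees on objects `W A`, and each
of the functors `K_q` is a natural retract of `K_q W`. -/
structure IsAcyclicResolution (K : C ⥤ ChainComplex AddCommGrpCat.{u} ℕ)
    (T : C ⥤ AddCommGrpCat.{u}) (η : K ⋙ HomologicalComplex.eval _ _ 0 ⟶ T) : Prop where
  d_comp (A : C) : (K.obj A).d 1 0 ≫ η.app A = 0
  surjective (A : C) : Function.Surjective (η.app A)
  exact_zero (A : C) (x : (K.obj A).X 0) : η.app A x = 0 → ∃ y, (K.obj A).d 1 0 y = x
  exact_succ (A : C) (q : ℕ) (x : (K.obj (W.obj A)).X (q + 1)) :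
    (K.obj (W.obj A)).d (q + 1) q x = 0 → ∃ y, (K.obj (W.obj A)).d (q + 2) (q + 1) y = x
  retract (q : ℕ) : ∃ s : K ⋙ HomologicalComplex.eval _ _ q ⟶
    W.toFunctor ⋙ K ⋙ HomologicalComplex.eval _ _ q,
    ∀ A, s.app A ≫ (K.map (W.ε.app A)).f q = 𝟙 _

variable {W} (K K' : C ⥤ ChainComplex AddCommGrpCat.{u} ℕ)

variable (W)

/-- The total complex of `K W_* A`. -/
noncomputable def totChains : C ⥤ ChainComplex AddCommGrpCat.{u} ℕ :=
  altChains W K ⋙ DoubleComplex.totFunctor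

variable {K}

lemma sum_zsmul_apply {X Y : AddCommGrpCat.{u}} {ι : Type*} (s : Finset ι) (c : ι → ℤ)
    (f : ι → (X ⟶ Y)) (x : X) : (∑ i ∈ s, c i • f i) x = ∑ i ∈ s, c i • f i x := by
  classical
  induction s using Finset.induction_on with
  | empty => rfl
  | insert a s ha ih =>
    rw [Finset.sum_insert ha, Finset.sum_insert ha, ← ih]
    rfl

lemma sum_zsmul_f_apply {C D : ChainComplex AddCommGrpCat.{u} ℕ} {ι : Type*} (s : Finset ι)
    (c : ι → ℤ) (f : ι → (C ⟶ D)) (q : ℕ) (x : C.X q) :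
    (∑ i ∈ s, c i • f i).f q x = ∑ i ∈ s, c i • (f i).f q x := by
  have e : (∑ i ∈ s, c i • f i).f q = ∑ i ∈ s, c i • (f i).f q :=
    (map_sum (HomologicalComplex.Hom.fAddMonoidHom (C₁ := C) (C₂ := D) q) _ _).trans
      (Finset.sum_congr rfl fun i _ => map_zsmul (HomologicalComplex.Hom.fAddMonoidHom q) _ _)
  rw [e, sum_zsmul_apply]

lemma alternating_two_comp {V : Type*} [Category V] [Preadditive V] {X Y Z : V}
    (F : Fin 2 → (X ⟶ Y)) (h : Y ⟶ Z) (e : F 0 ≫ h = F 1 ≫ h) :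
    (∑ i : Fin 2, (-1 : ℤ) ^ (i : ℕ) • F i) ≫ h = 0 := by
  rw [Fin.sum_univ_two, Preadditive.add_comp, Preadditive.zsmul_comp, Preadditive.zsmul_comp, e]
  simp

lemma altChains_d_f_apply (A : C) (p q : ℕ) (x : (K.obj (pow W A (p + 2))).X q) :
    (((altChains W K).obj A).d (p + 1) p).f q x =
      ∑ i : Fin (p + 2), (-1 : ℤ) ^ (i : ℕ) •
        (K.map (opMap W A (p + 2) (p + 1) (coface i))).f q x := by
  rw [altChains_d]
  exact sum_zsmul_f_apply _ _ _ _ _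

lemma opMap_coface_zero (A : C) (n : ℕ) :
    opMap W A (n + 1) n (coface 0) = counit W A n := opMap_succAbove_zero W n

lemma opMap_coface_succ (A : C) (n : ℕ) (i : Fin (n + 1)) :
    opMap W A (n + 2) (n + 1) (coface i.succ) =
      up W (opMap W A (n + 1) n (coface i)) := opMap_succAbove_succ W n i

/-- The two faces of `W² A` agree after the counit, by naturality of the counit applied to itself.
-/
lemma altChains_d_comp_counit (A : C) :
    ((altChains W K).obj A).d 1 0 ≫ K.map (W.ε.app A) = 0 := by
  refine (congrArg (· ≫ K.map (W.ε.app A)) (altChains_d W K A 0)).trans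
    (alternating_two_comp (fun i => K.map (opMap W A 2 1 (coface i))) (K.map (W.ε.app A)) ?_)
  have e : opMap W A 2 1 (coface 1) = up W (opMap W A 1 0 (coface 0)) :=
    opMap_coface_succ W A 0 0
  rw [e, opMap_coface_zero, opMap_coface_zero]
  refine (K.map_comp _ _).symm.trans (Eq.trans ?_ (K.map_comp _ _))
  exact congrArg K.map (up_counit W (counit W A 0)).symm

/-- The projection of the total complex of `K W_* A` to `K A`. -/
noncomputable def totToBase : totChains W K ⟶ K where
  app A := DoubleComplex.totToRowAug (Y := (altChains W K).obj A) (K.map (W.ε.app A))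
    (altChains_d_comp_counit W A)
  naturality A B f := by
    ext n x
    have e : K.map (W.map f) ≫ K.map (W.ε.app B) = K.map (W.ε.app A) ≫ K.map f := by
      rw [← K.map_comp, ← K.map_comp]
      exact congrArg K.map (W.ε.naturality f)
    exact congrArg (fun g => g.f n (DoubleComplex.comp x 0 n)) e

variable {T T' : C ⥤ AddCommGrpCat.{u}} (η : K ⋙ HomologicalComplex.eval _ _ 0 ⟶ T)

lemma altChains_d_comp (A : C) (p : ℕ) :
    (((altChains W K).obj A).d (p + 1) p).f 0 ≫ η.app (pow W A (p + 1)) =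
      η.app (pow W A (p + 2)) ≫ ((altChains W T).obj A).d (p + 1) p := by
  ext x
  have e (i : Fin (p + 2)) := congrArg (fun g => g x)
    (η.naturality (opMap W A (p + 2) (p + 1) (coface i)))
  refine (congrArg (η.app _) (altChains_d_f_apply W A p 0 x)).trans
    (Eq.trans ?_ (congrArg (fun g => g (η.app (pow W A (p + 2)) x))
      (altChains_d W T A p)).symm)
  refine Eq.trans ?_ (sum_zsmul_apply _ _ _ _).symm
  refine (map_sum (η.app (pow W A (p + 1))).hom _ _).trans ?_
  refine Finset.sum_congr rfl fun i _ => ?_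
  refine (map_zsmul (η.app (pow W A (p + 1))).hom _ _).trans (congrArg _ ?_)
  exact e i

/-- The projection of the total complex of `K W_* A` to `T W_* A`. -/
noncomputable def totToAlt (hη : ∀ A, (K.obj A).d 1 0 ≫ η.app A = 0) :
    totChains W K ⟶ altChains W T where
  app A := DoubleComplex.totToColAug (Y := (altChains W K).obj A) (A := (altChains W T).obj A)
    (fun p => η.app (pow W A (p + 1))) (altChains_d_comp W η A)
    fun p => hη _
  naturality A B f := by
    ext n x
    exact congrArg (fun g => g (DoubleComplex.comp x n 0)) (congrArg ConcreteCategory.hom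
      (η.naturality (powMap W f (n + 1))))

end CotripleResolution

namespace CotripleResolution

open AlgebraicTopology AbComplex

variable {C : Type*} [Category C] {W : Comonad C} {K K' : C ⥤ ChainComplex AddCommGrpCat.{u} ℕ}
  {T T' : C ⥤ AddCommGrpCat.{u}} {η : K ⋙ HomologicalComplex.eval _ _ 0 ⟶ T}
  {η' : K' ⋙ HomologicalComplex.eval _ _ 0 ⟶ T'}

namespace IsAcyclicResolution

/-- For fixed `q` the natural section of `K_q W ⟶ K_q` acts as an extra degeneracy on `K_q W_* A`,
so each augmented row is contractible. The sections need not commute with the vertical differential,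
since only exactness of single rows is used. -/
lemma isIso_homologyMap_totToBase (h : IsAcyclicResolution W K T η) (A : C) (n : ℕ) :
    IsIso (HomologicalComplex.homologyMap ((totToBase W (K := K)).app A) n) := by
  choose s₀ hs using h.retract
  let s (q n : ℕ) : (K.obj (pow W A n)).X q ⟶ (K.obj (pow W A (n + 1))).X q :=
    (s₀ q).app (pow W A n)
  have hs' (q n : ℕ) (x : (K.obj (pow W A n)).X q) :
      (K.map (counit W A n)).f q (s q n x) = x := congrArg (fun g => g x) (hs q (pow W A n))
  have nat (q : ℕ) {n m : ℕ} (f : pow W A n ⟶ pow W A m) (x : (K.obj (pow W A n)).X q) :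
      (K.map (up W f)).f q (s q n x) = s q m ((K.map f).f q x) :=
    (congrArg (fun g => g x) ((s₀ q).naturality f)).symm
  -- This is the contraction identity `d s = 1 - s d`: the section cancels face `0`, while face `i +
  -- 1` is `W` of face `i` and passes through the section by naturality, with a change of sign. For
  -- `p = 0` the sum on the right is the augmentation.
  have key (p q : ℕ) (x : (K.obj (pow W A (p + 1))).X q) :
      (((altChains W K).obj A).d (p + 1) p).f q (s q (p + 1) x) =
        x - s q p (∑ i : Fin (p + 1), (-1 : ℤ) ^ (i : ℕ) •
          (K.map (opMap W A (p + 1) p (coface i))).f q x) := by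
    refine (altChains_d_f_apply W A p q _).trans ?_
    rw [Fin.sum_univ_succ, sub_eq_add_neg]
    refine congrArg₂ (· + ·) ?_ ?_
    · rw [opMap_coface_zero]
      exact (one_smul _ _).trans (hs' q (p + 1) x)
    · refine Eq.trans ?_ (congrArg Neg.neg (map_sum (s q p).hom _ _).symm)
      rw [← Finset.sum_neg_distrib]
      refine Finset.sum_congr rfl fun i _ => ?_
      rw [opMap_coface_succ, nat, Fin.val_succ, pow_succ, mul_neg_one, neg_smul]
      exact congrArg Neg.neg (map_zsmul (s q p).hom _ _).symm
  refine DoubleComplex.isIso_homologyMap_totToRowAug (Y := (altChains W K).obj A)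
    (K.map (W.ε.app A)) (altChains_d_comp_counit W A) (fun q x => ?_)
    (fun q (x : (K.obj (pow W A 1)).X q) hx => ?_)
    (fun p q (x : (K.obj (pow W A (p + 2))).X q) hx => ?_) n
  · exact ⟨s q 0 x, hs' q 0 x⟩
  · refine ⟨s q 1 x, (key 0 q x).trans ?_⟩
    have hx' : (K.map (counit W A 0)).f q x = 0 := hx
    rw [Fin.sum_univ_one, opMap_coface_zero, hx', smul_zero, map_zero, sub_zero]
  · refine ⟨s q (p + 2) x, (key (p + 1) q x).trans ?_⟩
    have hx' := (altChains_d_f_apply W A p q x).symm.trans hx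
    refine (congrArg (x - s q (p + 1) ·) hx').trans ?_
    refine (congrArg (x - ·) (map_zero (s q (p + 1)).hom)).trans (sub_zero x)

/-- Column `p` is `K` at `W (Wᵖ A)`, an object on which `K` is exact in positive degrees. -/
lemma isIso_homologyMap_totToAlt (h : IsAcyclicResolution W K T η) (A : C) (n : ℕ) :
    IsIso (HomologicalComplex.homologyMap ((totToAlt W η h.d_comp).app A) n) :=
  DoubleComplex.isIso_homologyMap_totToColAug (Y := (altChains W K).obj A)
    (A := (altChains W T).obj A)
    (fun p => η.app (pow W A (p + 1))) (altChains_d_comp W η A) (fun _ => h.d_comp _)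
    (fun _ => h.surjective _)
    (fun _ => h.exact_zero _) (fun p => h.exact_succ (pow W A p)) n

variable (K) in
/-- The homology of a functorial complex. -/
noncomputable abbrev homologyComp (n : ℕ) : C ⥤ AddCommGrpCat.{u} :=
  K ⋙ HomologicalComplex.homologyFunctor _ (ComplexShape.down ℕ) n

/-- The effect on homology of a natural transformation of functorial complexes. -/
noncomputable abbrev homologyCompMap (κ : K ⟶ K') (n : ℕ) : homologyComp K n ⟶ homologyComp K' n :=
  Functor.whiskerRight κ (HomologicalComplex.homologyFunctor _ (ComplexShape.down ℕ) n)

lemma homologyCompMap_comp {K'' : C ⥤ ChainComplex AddCommGrpCat.{u} ℕ} (κ : K ⟶ K')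
    (κ' : K' ⟶ K'') (n : ℕ) :
    homologyCompMap (κ ≫ κ') n = homologyCompMap κ n ≫ homologyCompMap κ' n :=
  Functor.whiskerRight_comp _ _ _

/-- The homology of the total complex is the homology of `T W_*`. -/
noncomputable def totAltIso (h : IsAcyclicResolution W K T η) (n : ℕ) :
    homologyComp (totChains W K) n ≅ homologyComp (altChains W T) n :=
  have (A : C) : IsIso ((homologyCompMap (totToAlt W η h.d_comp) n).app A) :=
    h.isIso_homologyMap_totToAlt A n
  have := NatIso.isIso_of_isIso_app (homologyCompMap (totToAlt W η h.d_comp) n)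
  asIso (homologyCompMap (totToAlt W η h.d_comp) n)

/-- The homology of the total complex is the homology of `K`. -/
noncomputable def totBaseIso (h : IsAcyclicResolution W K T η) (n : ℕ) :
    homologyComp (totChains W K) n ≅ homologyComp K n :=
  have (A : C) : IsIso ((homologyCompMap (totToBase W (K := K)) n).app A) :=
    h.isIso_homologyMap_totToBase A n
  have := NatIso.isIso_of_isIso_app (homologyCompMap (totToBase W (K := K)) n)
  asIso (homologyCompMap (totToBase W (K := K)) n)

/-- The homology of `K` is the homology of the alternating face map complex of `T W_*`. -/
noncomputable def altIso (h : IsAcyclicResolution W K T η) (n : ℕ) :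
    homologyComp (altChains W T) n ≅ homologyComp K n :=
  (h.totAltIso n).symm ≪≫ h.totBaseIso n

/-- The identification of the homology of `K` with the derived functors of `T` is natural in `K`
and `T`. -/
lemma altIso_hom_naturality (h : IsAcyclicResolution W K T η)
    (h' : IsAcyclicResolution W K' T' η') (κ : K ⟶ K') (τ : T ⟶ T')
    (e : ∀ A, η.app A ≫ τ.app A = (κ.app A).f 0 ≫ η'.app A) (n : ℕ) :
    homologyCompMap (altChainsMap W τ) n ≫ (h'.altIso n).hom =
      (h.altIso n).hom ≫ homologyCompMap κ n := by
  let t : totChains W K ⟶ totChains W K' :=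
    Functor.whiskerRight (altChainsMap W κ) DoubleComplex.totFunctor
  -- Both projections of the total complex commute with the map `t` induced by `κ`; naturality of
  -- the zigzag follows by inverting one of them on homology.
  have e1 : totToAlt W η h.d_comp ≫ altChainsMap W τ = t ≫ totToAlt W η' h'.d_comp := by
    ext A p x
    exact congrArg (fun g => g (DoubleComplex.comp x p 0)) (e (pow W A (p + 1)))
  have e2 : totToBase W (K := K) ≫ κ = t ≫ totToBase W (K := K') := by
    ext A p x
    exact congrArg (fun g => g.f p (DoubleComplex.comp x 0 p)) (κ.naturality (W.ε.app A))
  have e1' := congrArg (homologyCompMap · n) e1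
  have e2' := congrArg (homologyCompMap · n) e2
  simp only [homologyCompMap_comp] at e1' e2'
  rw [altIso, altIso, Iso.trans_hom, Iso.trans_hom, Iso.symm_hom, Iso.symm_hom, Category.assoc,
    Iso.eq_inv_comp]
  refine (Category.assoc _ _ _).symm.trans ((congrArg (· ≫ _) e1').trans ?_)
  refine (Category.assoc _ _ _).trans (Eq.trans ?_ e2'.symm)
  exact congrArg (homologyCompMap t n ≫ ·) ((h'.totAltIso n).hom_inv_id_assoc _)

end IsAcyclicResolution

end CotripleResolution

/-! ### Coinvariants of the standard complex and inhomogeneous coordinates. -/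

namespace GammaGrp

open Finsupp TensorProduct

variable {Γ : Type u} [Group Γ]

section Coinvariants

variable {G H : GammaGrp Γ} {n m : ℕ}

/-- The class of a tuple in `ℤ[Gⁿ] ⊗_{G ⋊ Γ} ℤ`. -/
noncomputable def stdGen (x : Fin n → G) : StdCoinv G n := stdMk G n 1 (single x 1)

lemma stdGen_semiAct (h : Semi G) (x : Fin n → G) : stdGen (semiAct G n h x) = stdGen x := by
  rw [stdGen, ← stdRep_single, stdMk_smul, stdGen]

lemma stdGen_left_mul (g : G) (x : Fin n → G) : stdGen (fun i => g * x i) = stdGen x := by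
  rw [← stdGen_semiAct (SemidirectProduct.inl g) x]
  congr 1
  funext i
  simp [semiAct]

lemma stdGen_smul (σ : Γ) (x : Fin n → G) : stdGen (fun i => σ • x i) = stdGen x := by
  rw [← stdGen_semiAct (SemidirectProduct.inr σ) x]
  congr 1
  funext i
  simp [semiAct]

/-- The linear map out of `ℤ[Gⁿ] ⊗_{G ⋊ Γ} ℤ` induced by an invariant linear map. -/
noncomputable def stdDescLinear {M : Type*} [AddCommGroup M] [Module ZZ.{u} M]
    (f : ((Fin n → G) →₀ ZZ.{u}) →ₗ[ZZ.{u}] M)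
    (hf : ∀ (h : Semi G) v, f (stdRep G n h v) = f v) : StdCoinv G n →ₗ[ZZ.{u}] M :=
  Representation.Coinvariants.lift _
    (TensorProduct.lift ((LinearMap.lsmul ZZ.{u} M).compl₂ f)) fun h => by
    refine TensorProduct.ext (LinearMap.ext_ring (LinearMap.ext fun v => ?_))
    exact congrArg ((1 : ZZ.{u}) • ·) (hf h v)

lemma stdDescLinear_mk {M : Type*} [AddCommGroup M] [Module ZZ.{u} M]
    (f : ((Fin n → G) →₀ ZZ.{u}) →ₗ[ZZ.{u}] M)
    (hf : ∀ (h : Semi G) v, f (stdRep G n h v) = f v) (v) :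
    stdDescLinear f hf (stdMk G n 1 v) = f v := one_smul ZZ.{u} (f v)

lemma stdMk_surjective : Function.Surjective (stdMk G n 1) := by
  have : (LinearMap.range (stdMk G n 1)).mkQ = 0 := stdCoinv_ext fun x => by
    rw [LinearMap.zero_apply, Submodule.mkQ_apply, Submodule.Quotient.mk_eq_zero]
    exact ⟨_, rfl⟩
  rw [← LinearMap.range_eq_top, ← Submodule.ker_mkQ (LinearMap.range (stdMk G n 1)), this,
    LinearMap.ker_zero]

/-- The map out of `ℤ[Gⁿ] ⊗_{G ⋊ Γ} ℤ` induced by an invariant function on tuples. -/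
noncomputable def stdDesc {M : Type*} [AddCommGroup M] [Module ZZ.{u} M] (f : (Fin n → G) → M)
    (hf : ∀ (h : Semi G) x, f (semiAct G n h x) = f x) : StdCoinv G n →ₗ[ZZ.{u}] M :=
  stdDescLinear (linearCombination ZZ.{u} f) fun h v => by
    have : linearCombination ZZ.{u} f ∘ₗ stdRep G n h = linearCombination ZZ.{u} f := by
      ext x : 2
      simp [stdRep_single, hf]
    exact LinearMap.congr_fun this v

lemma stdDesc_gen {M : Type*} [AddCommGroup M] [Module ZZ.{u} M] (f : (Fin n → G) → M)
    (hf : ∀ (h : Semi G) x, f (semiAct G n h x) = f x) (x : Fin n → G) :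
    stdDesc f hf (stdGen x) = f x := by
  refine (stdDescLinear_mk _ _ _).trans ?_
  rw [linearCombination_single, one_smul]

/-- The differential of `P_* ⊗_{G ⋊ Γ} ℤ`. -/
noncomputable abbrev stdCoinvD (G : GammaGrp Γ) (n : ℕ) :
    StdCoinv G (n + 2) →ₗ[ZZ.{u}] StdCoinv G (n + 1) := ((stdChains G).d (n + 1) n).hom

lemma stdCoinvD_mk (v : (Fin (n + 2) → G) →₀ ZZ.{u}) :
    stdCoinvD G n (stdMk G (n + 2) 1 v) = stdMk G (n + 1) 1 (stdD G n v) := stdChains_d G n 1 v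

lemma stdCoinvD_gen (x : Fin (n + 2) → G) :
    stdCoinvD G n (stdGen x) =
      ∑ i : Fin (n + 2), (-1 : ℤ) ^ (i : ℕ) • stdGen (x ∘ i.succAbove) := by
  rw [stdGen, stdCoinvD_mk, stdD_single, map_sum]
  refine Finset.sum_congr rfl fun i _ => ?_
  rw [map_zsmul]
  rfl

/-- `G` is transitive on its vertices, so the two endpoints of an edge have the same class. This
vanishing makes the degree shift possible. -/
lemma stdCoinvD_zero : stdCoinvD G 0 = 0 := stdCoinv_ext fun x => by
  refine (stdCoinvD_gen x).trans ?_
  have e : ∀ y : Fin 1 → G, stdGen y = stdGen (fun _ => 1 : Fin 1 → G) := fun y => by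
    rw [← stdGen_left_mul (y 0) fun _ => 1]
    congr 1
    funext i
    rw [Subsingleton.elim i 0, mul_one]
  rw [Fin.sum_univ_two, e (x ∘ Fin.succAbove 0), e (x ∘ Fin.succAbove 1)]
  simp

end Coinvariants

section Push

variable {G H K : GammaGrp Γ} {n : ℕ}

/-- The consecutive quotients `xᵢ⁻¹ xᵢ₊₁` of a tuple. -/
def quotients (x : Fin (n + 1) → G) (i : Fin n) : G := (x i.castSucc)⁻¹ * x i.succ

lemma quotients_partialProd (y : Fin n → G) : quotients (Fin.partialProd y) = y := by
  funext i
  exact Fin.partialProd_right_inv y i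

/-- Left translation cancels in consecutive quotients, and only the `Γ`-part of the action survives.
Thus the coinvariants of `ℤ[Gⁿ⁺¹]` are `ℤ[Gⁿ]_Γ`, which depends on the `Γ`-set `G` alone. -/
lemma quotients_semiAct (h : Semi G) (x : Fin (n + 1) → G) :
    quotients (semiAct G (n + 1) h x) = fun i => h.right • quotients x i := by
  funext i
  simp only [quotients, semiAct, mul_inv_rev, smul_mul', smul_inv']
  group

lemma stdGen_partialProd_quotients (x : Fin (n + 1) → G) :
    stdGen (Fin.partialProd (quotients x)) = stdGen x := by
  rw [← stdGen_left_mul (x 0) (Fin.partialProd (quotients x))]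
  congr 1
  exact Fin.partialProd_left_inv x

lemma smul_partialProd (σ : Γ) (y : Fin n → G) :
    Fin.partialProd (fun i => σ • y i) = fun i => σ • Fin.partialProd y i := by
  funext i
  refine Fin.induction ?_ (fun j hj => ?_) i
  · simp
  · simp only [Fin.partialProd_succ, hj, smul_mul']

/-- The map `ℤ[Gⁿ⁺¹] ⊗_{G ⋊ Γ} ℤ ⟶ ℤ[Hⁿ⁺¹] ⊗_{H ⋊ Γ} ℤ` that is given by a map of `Γ`-sets
`f : G → H` in inhomogeneous coordinates. -/
noncomputable def stdPushSet (f : G → H) (hf : ∀ (σ : Γ) x, f (σ • x) = σ • f x) (n : ℕ) :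
    StdCoinv G (n + 1) →ₗ[ZZ.{u}] StdCoinv H (n + 1) :=
  stdDesc (fun x => stdGen (Fin.partialProd fun i => f (quotients x i))) fun h x => by
    rw [quotients_semiAct]
    simp only [hf, smul_partialProd, stdGen_smul]

lemma stdPushSet_gen (f : G → H) (hf : ∀ (σ : Γ) x, f (σ • x) = σ • f x) (x : Fin (n + 1) → G) :
    stdPushSet f hf n (stdGen x) = stdGen (Fin.partialProd fun i => f (quotients x i)) :=
  stdDesc_gen _ _ x

lemma stdPush_gen (f : G ⟶ H) (x : Fin n → G) :
    stdPush f n (stdGen x) = stdGen (f ∘ x : Fin n → H) := stdPush_mk f n 1 x 1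

/-- Homomorphisms and mere maps of `Γ`-sets are put on the same footing, so that `stdPushSet_comp`
applies to composites of `g ↦ |g|` with a homomorphism. -/
lemma stdPush_eq_stdPushSet (f : G ⟶ H) (n : ℕ) :
    stdPush f (n + 1) = stdPushSet (fun x => f x) (hom_smul f) n := stdCoinv_ext fun x => by
  refine (stdPush_gen f x).trans (Eq.trans ?_ (stdPushSet_gen _ _ x).symm)
  rw [← stdGen_partialProd_quotients (f ∘ x : Fin (n + 1) → H)]
  congr 2
  funext i
  simp only [quotients, Function.comp_apply, map_mul, map_inv]

lemma stdPushSet_comp (f : G → H) (hf : ∀ (σ : Γ) x, f (σ • x) = σ • f x) (g : H → K)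
    (hg : ∀ (σ : Γ) x, g (σ • x) = σ • g x) (n : ℕ) :
    stdPushSet g hg n ∘ₗ stdPushSet f hf n =
      stdPushSet (fun x => g (f x)) (fun σ x => by rw [hf, hg]) n := stdCoinv_ext fun x => by
  refine (congrArg (stdPushSet g hg n) (stdPushSet_gen f hf x)).trans ?_
  refine (stdPushSet_gen g hg _).trans (Eq.trans ?_ (stdPushSet_gen _ _ x).symm)
  rw [quotients_partialProd]

lemma stdPushSet_id (n : ℕ) : stdPushSet (fun x : G => x) (fun _ _ => rfl) n = LinearMap.id :=
  stdCoinv_ext fun x => (stdPushSet_gen _ _ x).trans (stdGen_partialProd_quotients x)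

end Push

/-! ### First equivariant homology is `G / [G, G]_Γ`. -/

section Abelianization

variable {G H : GammaGrp Γ}

/-- Every abelian group is a module over the lifted ring of integers. -/
noncomputable abbrev zzModule (M : Type*) [AddCommGroup M] : Module ZZ.{u} M :=
  Module.compHom M (ULift.ringEquiv.toRingHom : ZZ.{u} →+* ℤ)

/-- The class of `x₀⁻¹ x₁` in `G / [G, G]_Γ`. -/
def quotientClass (x : Fin 2 → G) : Additive (G ⧸ gammaCommutator G) :=
  Additive.ofMul (QuotientGroup.mk ((x 0)⁻¹ * x 1))

lemma quotientClass_semiAct (h : Semi G) (x : Fin 2 → G) :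
    quotientClass (semiAct G 2 h x) = quotientClass x := by
  refine congrArg Additive.ofMul ((QuotientGroup.eq (s := gammaCommutator G)).2 ?_)
  have e0 := congrFun (quotients_semiAct h x) 0
  change (semiAct G 2 h x 0)⁻¹ * semiAct G 2 h x 1 = h.right • ((x 0)⁻¹ * x 1) at e0
  rw [e0, ← inv_mem_iff, mul_inv_rev, inv_inv]
  have e : h.right • ((x 0)⁻¹ * x 1) * ((x 0)⁻¹ * x 1)⁻¹ ∈ gammaCommutator G :=
    Subgroup.subset_closure (Or.inr ⟨_, _, rfl⟩)
  -- Normality exchanges the two factors and gives the order that the left coset relation asks for.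
  exact ((gammaCommutator_normal G).mem_comm_iff).1 e

/-- The map `ℤ[G²] ⊗_{G ⋊ Γ} ℤ ⟶ G / [G, G]_Γ`, `(x₀, x₁) ↦ x₀⁻¹ x₁`. -/
noncomputable def stdToAb (G : GammaGrp Γ) :
    StdCoinv G 2 →+ Additive (G ⧸ gammaCommutator G) :=
  letI := zzModule.{u} (Additive (G ⧸ gammaCommutator G))
  (stdDesc quotientClass quotientClass_semiAct).toAddMonoidHom

lemma stdToAb_gen (x : Fin 2 → G) :
    stdToAb G (stdGen x) = Additive.ofMul (QuotientGroup.mk ((x 0)⁻¹ * x 1)) :=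
  letI := zzModule.{u} (Additive (G ⧸ gammaCommutator G))
  stdDesc_gen quotientClass quotientClass_semiAct x

lemma map_zz_smul {A M : Type*} [AddCommGroup A] [Module ZZ.{u} A] [AddCommGroup M]
    [Module ZZ.{u} M] (f : A →+ M) (a : ZZ.{u}) (x : A) : f (a • x) = a • f x := by
  have e : a = ((ULift.down a : ℤ) : ZZ.{u}) := rfl
  rw [e, Int.cast_smul_eq_zsmul, Int.cast_smul_eq_zsmul, map_zsmul]

/-- Additive maps between modules over the lifted ring of integers are linear. -/
def zzLinear {A M : Type*} [AddCommGroup A] [Module ZZ.{u} A] [AddCommGroup M]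
    [Module ZZ.{u} M] (f : A →+ M) : A →ₗ[ZZ.{u}] M :=
  { f with map_smul' := map_zz_smul f }

/-- Additive maps are automatically linear over the lifted integers, so the module extensionality
lemma also serves for targets that are only abelian groups. -/
lemma stdCoinv_hom_ext {n : ℕ} {M : Type*} [AddCommGroup M] {f g : StdCoinv G n →+ M}
    (h : ∀ x, f (stdGen x) = g (stdGen x)) : f = g := by
  let _ := zzModule.{u} M
  have e : zzLinear f = zzLinear g := stdCoinv_ext h
  exact AddMonoidHom.ext fun x => LinearMap.congr_fun e x

lemma finsupp_hom_ext {α M : Type*} [AddCommGroup M] {f g : (α →₀ ZZ.{u}) →+ M}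
    (h : ∀ x, f (single x 1) = g (single x 1)) : f = g := by
  let _ := zzModule.{u} M
  have e : zzLinear f = zzLinear g := Finsupp.lhom_ext' fun x => LinearMap.ext_ring (h x)
  exact AddMonoidHom.ext fun x => LinearMap.congr_fun e x

lemma stdToAb_surjective : Function.Surjective (stdToAb G) := by
  intro y
  obtain ⟨g, hg⟩ := QuotientGroup.mk_surjective (s := gammaCommutator G) y.toMul
  refine ⟨stdGen ![1, g], ?_⟩
  rw [stdToAb_gen]
  refine (congrArg Additive.ofMul ?_).trans (ofMul_toMul y)
  rw [← hg]
  simp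

/-- The three sides of a triangle satisfy `x₀⁻¹ x₂ = (x₀⁻¹ x₁) (x₁⁻¹ x₂)`. -/
lemma stdToAb_stdCoinvD (y : StdCoinv G 3) : stdToAb G (stdCoinvD G 1 y) = 0 := by
  have : (stdToAb G).comp (stdCoinvD G 1).toAddMonoidHom = 0 := stdCoinv_hom_ext fun x => by
    refine (congrArg (stdToAb G) (stdCoinvD_gen x)).trans ?_
    rw [Fin.sum_univ_three, map_add, map_add, map_zsmul, map_zsmul, map_zsmul]
    rw [stdToAb_gen, stdToAb_gen, stdToAb_gen]
    have e : Additive.ofMul (QuotientGroup.mk ((x 0)⁻¹ * x 2) : G ⧸ gammaCommutator G) =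
        Additive.ofMul (QuotientGroup.mk ((x 0)⁻¹ * x 1)) +
          Additive.ofMul (QuotientGroup.mk ((x 1)⁻¹ * x 2)) := by
      rw [← ofMul_mul, ← QuotientGroup.mk_mul]
      congr 2
      group
    have e0 : (x ∘ Fin.succAbove 0) 0 = x 1 := rfl
    have e0' : (x ∘ Fin.succAbove 0) 1 = x 2 := rfl
    have e1 : (x ∘ Fin.succAbove 1) 0 = x 0 := rfl
    have e1' : (x ∘ Fin.succAbove 1) 1 = x 2 := rfl
    have e2 : (x ∘ Fin.succAbove 2) 0 = x 0 := rfl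
    have e2' : (x ∘ Fin.succAbove 2) 1 = x 1 := rfl
    rw [e0, e0', e1, e1', e2, e2', e]
    simp only [Fin.val_zero, Fin.val_one, Fin.val_two, pow_zero, pow_one, one_smul, neg_smul,
      even_two, Even.neg_pow, one_pow, AddMonoidHom.zero_apply]
    abel
  exact DFunLike.congr_fun this y

/-- In the cokernel `Q` of the differential, `g ↦ [(1, g)]` is a homomorphism, by the boundary of
`(1, g, gh)`, and it is `Γ`-invariant. As `Q` is abelian, it factors through `G / [G, G]_Γ`, and the
factorization composed with `stdToAb` is the quotient map. So the kernel of `stdToAb` dies in `Q`.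
-/
lemma exists_stdCoinvD_eq (x : StdCoinv G 2) (hx : stdToAb G x = 0) :
    ∃ y, stdCoinvD G 1 y = x := by
  let Q := StdCoinv G 2 ⧸ LinearMap.range (stdCoinvD G 1)
  let π : StdCoinv G 2 →+ Q := (LinearMap.range (stdCoinvD G 1)).mkQ.toAddMonoidHom
  have hπ (y) : π (stdCoinvD G 1 y) = 0 :=
    (Submodule.Quotient.mk_eq_zero _).2 ⟨y, rfl⟩
  have mul (g h : G) : π (stdGen ![1, g * h]) = π (stdGen ![1, g]) + π (stdGen ![1, h]) := by
    have e := hπ (stdGen ![1, g, g * h])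
    rw [stdCoinvD_gen, Fin.sum_univ_three] at e
    have e0 : (![1, g, g * h] : Fin 3 → G) ∘ Fin.succAbove 0 = fun i => g * ![1, h] i := by
      funext i; fin_cases i <;> simp
    have e1 : (![1, g, g * h] : Fin 3 → G) ∘ Fin.succAbove 1 = ![1, g * h] := by
      funext i; fin_cases i <;> rfl
    have e2 : (![1, g, g * h] : Fin 3 → G) ∘ Fin.succAbove 2 = ![1, g] := by
      funext i; fin_cases i <;> rfl
    rw [e0, e1, e2, stdGen_left_mul] at e
    simp only [Fin.val_zero, Fin.val_one, Fin.val_two, pow_zero, pow_one, one_smul, neg_smul,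
      even_two, Even.neg_pow, one_pow, map_add, map_neg] at e
    rw [← sub_eq_zero, ← neg_eq_zero, ← e]
    abel
  let ψ : G →* Multiplicative Q :=
    MonoidHom.mk' (fun g => Multiplicative.ofAdd (π (stdGen ![1, g])))
    fun g h => congrArg Multiplicative.ofAdd (mul g h)
  have hψ : gammaCommutator G ≤ ψ.ker := by
    refine (Subgroup.closure_le _).2 (Set.union_subset ?_ ?_)
    · exact Abelianization.commutator_subset_ker ψ
    · rintro _ ⟨σ, g, rfl⟩
      have e : ψ (σ • g) = ψ g := by
        refine congrArg (fun z => Multiplicative.ofAdd (π z)) ?_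
        rw [← stdGen_smul σ ![1, g]]
        congr 1
        funext i; fin_cases i <;> simp
      rw [SetLike.mem_coe, MonoidHom.mem_ker, map_mul, map_inv, e, mul_inv_cancel]
  let ψ' : Additive (G ⧸ gammaCommutator G) →+ Q :=
    MonoidHom.toAdditiveLeft (QuotientGroup.lift _ ψ hψ)
  have key : ψ'.comp (stdToAb G) = π := stdCoinv_hom_ext fun x => by
    refine (congrArg ψ' (stdToAb_gen x)).trans ?_
    change π (stdGen ![1, (x 0)⁻¹ * x 1]) = _
    rw [← stdGen_left_mul (x 0)]
    congr 2
    funext i; fin_cases i <;> simp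
  have := (DFunLike.congr_fun key x).symm.trans ((congrArg ψ' hx).trans (map_zero ψ'))
  exact (Submodule.Quotient.mk_eq_zero _).1 this

end Abelianization

end GammaGrp

/-! ### Equivariant homotopies from path systems. -/

namespace GammaGrp

open Finsupp TensorProduct

variable {Γ : Type u} [Group Γ]

section Cone

variable (G : GammaGrp Γ)

/-- The cone `(x₁, …, xₙ) ↦ (g, x₁, …, xₙ)`. -/
noncomputable def stdCone (g : G) (n : ℕ) :
    ((Fin n → G) →₀ ZZ.{u}) →ₗ[ZZ.{u}] ((Fin (n + 1) → G) →₀ ZZ.{u}) :=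
  lmapDomain ZZ.{u} ZZ.{u} fun x => (Fin.cons g x : Fin (n + 1) → G)

variable {G} {n : ℕ}

lemma stdCone_single (g : G) (x : Fin n → G) (a : ZZ.{u}) :
    stdCone G g n (single x a) = single (Fin.cons g x : Fin (n + 1) → G) a :=
  mapDomain_single

/-- The apex moves with the action. A cone whose apex is the first vertex of the simplex is
therefore equivariant under all of `G ⋊ Γ`, whereas a cone with apex `1` is equivariant under `Γ`
only. -/
lemma stdRep_stdCone (h : Semi G) (g : G) (v : (Fin n → G) →₀ ZZ.{u}) :
    stdRep G (n + 1) h (stdCone G g n v) =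
      stdCone G (h.left * h.right • g) n (stdRep G n h v) := by
  have : stdRep G (n + 1) h ∘ₗ stdCone G g n =
      stdCone G (h.left * h.right • g) n ∘ₗ stdRep G n h := by
    ext x : 2
    simp only [LinearMap.comp_apply, lsingle_apply, stdRep_single, stdCone_single]
    congr 1
    funext i
    refine Fin.cases ?_ (fun j => ?_) i <;> simp [semiAct]
  exact LinearMap.congr_fun this v

lemma stdD_stdRep (h : Semi G) (v : (Fin (n + 2) → G) →₀ ZZ.{u}) :
    stdD G n (stdRep G (n + 2) h v) = stdRep G (n + 1) h (stdD G n v) := by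
  have : stdD G n ∘ₗ stdRep G (n + 2) h = stdRep G (n + 1) h ∘ₗ stdD G n := by
    ext x : 2
    simp only [LinearMap.comp_apply, lsingle_apply, stdRep_single, stdD_single, map_sum, map_zsmul]
    rfl
  exact LinearMap.congr_fun this v

lemma stdD_stdCone (g : G) (v : (Fin (n + 2) → G) →₀ ZZ.{u}) :
    stdD G (n + 1) (stdCone G g (n + 2) v) = v - stdCone G g (n + 1) (stdD G n v) := by
  have : stdD G (n + 1) ∘ₗ stdCone G g (n + 2) =
      LinearMap.id - stdCone G g (n + 1) ∘ₗ stdD G n := by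
    ext x : 2
    simp only [LinearMap.comp_apply, lsingle_apply, LinearMap.sub_apply, LinearMap.id_apply]
    rw [stdCone_single, stdD_single, stdD_single, Fin.sum_univ_succ,
      map_sum, sub_eq_add_neg, ← Finset.sum_neg_distrib]
    congr 1
    · simp only [Fin.val_zero, pow_zero, one_smul]
      congr 1
    · refine Finset.sum_congr rfl fun i _ => ?_
      rw [map_zsmul, stdCone_single, Fin.val_succ, pow_succ, mul_neg_one, neg_smul]
      congr 3
      funext j
      refine Fin.cases ?_ (fun k => ?_) j <;> simp
  exact LinearMap.congr_fun this v

lemma stdD_stdD (v : (Fin (n + 3) → G) →₀ ZZ.{u}) : stdD G n (stdD G (n + 1) v) = 0 := by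
  rw [← stdComplex_d, ← stdComplex_d]
  have := congrArg (fun f => f.hom v) ((stdComplex G).d_comp_d (n + 2) (n + 1) n)
  exact this

end Cone

section PathContraction

variable {G : GammaGrp Γ}

/-- An equivariant choice of paths in the standard complex of `G` that is compatible with the
composition of paths: a combinatorial form of a `G ⋊ Γ`-tree. -/
structure PathSystem (G : GammaGrp Γ) where
  /-- The path from `a` to `b`. -/
  path : G → G → ((Fin 2 → G) →₀ ZZ.{u})
  stdD_path (a b : G) : stdD G 0 (path a b) = single (fun _ => b) 1 - single (fun _ => a) 1
  path_add (a b c : G) : path a b + path b c = path a c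
  stdRep_path (h : Semi G) (a b : G) :
    stdRep G 2 h (path a b) = path (h.left * h.right • a) (h.left * h.right • b)

namespace PathSystem

variable (P : PathSystem G)

/-- The retraction of the module of edges on the edges of the tree. -/
noncomputable def proj : ((Fin 2 → G) →₀ ZZ.{u}) →ₗ[ZZ.{u}] ((Fin 2 → G) →₀ ZZ.{u}) :=
  linearCombination ZZ.{u} fun x => P.path (x 0) (x 1)

lemma proj_single (x : Fin 2 → G) : P.proj (single x 1) = P.path (x 0) (x 1) := by
  rw [proj, linearCombination_single, one_smul]

lemma stdD_proj (v) : stdD G 0 (P.proj v) = stdD G 0 v := by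
  have : stdD G 0 ∘ₗ P.proj = stdD G 0 := by
    ext x : 2
    simp only [LinearMap.comp_apply, lsingle_apply]
    rw [proj_single, stdD_path, stdD_single, Fin.sum_univ_two]
    simp only [Fin.val_zero, Fin.val_one, pow_zero, pow_one, one_smul, neg_smul, sub_eq_add_neg]
    congr 3 <;> funext i <;> obtain rfl := Subsingleton.elim (α := Fin 1) i 0 <;> rfl
  exact LinearMap.congr_fun this v

/-- Paths compose, so the three sides of a triangle cancel. Together with `stdD_proj` this makes the
identity in degree zero, `proj` in degree one and zero above a chain map, to which the identity is
homotopic. -/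
lemma proj_stdD (v) : P.proj (stdD G 1 v) = 0 := by
  have : P.proj ∘ₗ stdD G 1 = 0 := by
    ext x : 2
    simp only [LinearMap.comp_apply, lsingle_apply, LinearMap.zero_apply]
    rw [stdD_single, Fin.sum_univ_three, map_add, map_add, map_zsmul, map_zsmul, map_zsmul,
      proj_single, proj_single, proj_single]
    have e : P.path (x 0) (x 2) = P.path (x 0) (x 1) + P.path (x 1) (x 2) :=
      (P.path_add _ _ _).symm
    have e0 : P.path ((x ∘ Fin.succAbove 0) 0) ((x ∘ Fin.succAbove 0) 1) =
        P.path (x 1) (x 2) := rfl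
    have e1 : P.path ((x ∘ Fin.succAbove 1) 0) ((x ∘ Fin.succAbove 1) 1) =
        P.path (x 0) (x 2) := rfl
    have e2 : P.path ((x ∘ Fin.succAbove 2) 0) ((x ∘ Fin.succAbove 2) 1) =
        P.path (x 0) (x 1) := rfl
    rw [e0, e1, e2, e]
    simp only [Fin.val_zero, Fin.val_one, Fin.val_two, pow_zero, pow_one, one_smul, neg_smul,
      even_two, Even.neg_pow, one_pow]
    abel
  exact LinearMap.congr_fun this v

/-- The equivariant homotopy from the identity of the standard complex to `proj`. -/
noncomputable def homotopy : (n : ℕ) →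
    ((Fin (n + 2) → G) →₀ ZZ.{u}) →ₗ[ZZ.{u}] ((Fin (n + 3) → G) →₀ ZZ.{u})
  | 0 => linearCombination ZZ.{u} fun x =>
      stdCone G (x 0) 2 (single x 1 - P.proj (single x 1))
  | n + 1 => linearCombination ZZ.{u} fun x =>
      stdCone G (x 0) (n + 3) (single x 1 - homotopy n (stdD G (n + 1) (single x 1)))

lemma homotopy_zero_single (x : Fin 2 → G) : P.homotopy 0 (single x 1) =
    stdCone G (x 0) 2 (single x 1 - P.proj (single x 1)) := by
  rw [homotopy, linearCombination_single, one_smul]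

lemma homotopy_succ_single (n : ℕ) (x : Fin (n + 3) → G) : P.homotopy (n + 1) (single x 1) =
    stdCone G (x 0) (n + 3) (single x 1 - P.homotopy n (stdD G (n + 1) (single x 1))) := by
  rw [homotopy, linearCombination_single, one_smul]

/-- Equivariance is what lets the homotopy descend to coinvariants. -/
lemma homotopy_stdRep (n : ℕ) (h : Semi G) (v) :
    P.homotopy n (stdRep G (n + 2) h v) = stdRep G (n + 3) h (P.homotopy n v) := by
  induction n with
  | zero =>
    have : P.homotopy 0 ∘ₗ stdRep G 2 h = stdRep G 3 h ∘ₗ P.homotopy 0 := by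
      ext x : 2
      simp only [LinearMap.comp_apply, lsingle_apply]
      rw [stdRep_single, homotopy_zero_single, homotopy_zero_single, stdRep_stdCone,
        map_sub (stdRep G 2 h), stdRep_single, proj_single, proj_single, stdRep_path]
      rfl
    exact LinearMap.congr_fun this v
  | succ n ih =>
    have : P.homotopy (n + 1) ∘ₗ stdRep G (n + 3) h = stdRep G (n + 4) h ∘ₗ P.homotopy (n + 1) := by
      ext x : 2
      simp only [LinearMap.comp_apply, lsingle_apply]
      rw [stdRep_single, homotopy_succ_single, homotopy_succ_single, stdRep_stdCone,
        map_sub (stdRep G (n + 3) h), ← ih, ← stdD_stdRep, stdRep_single]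
      rfl
    exact LinearMap.congr_fun this v

lemma stdD_homotopy_zero (v) : stdD G 1 (P.homotopy 0 v) = v - P.proj v := by
  have : stdD G 1 ∘ₗ P.homotopy 0 = LinearMap.id - P.proj := by
    ext x : 2
    simp only [LinearMap.comp_apply, lsingle_apply, LinearMap.sub_apply, LinearMap.id_apply]
    rw [homotopy_zero_single, stdD_stdCone, map_sub, stdD_proj, sub_self, map_zero, sub_zero]
  exact LinearMap.congr_fun this v

/-- A cone fills its base up to the cone on the boundary of that base. The hypothesis `H` says that
the base used in `homotopy (n + 1)` is a cycle. -/
lemma stdD_homotopy_of_boundary (n : ℕ)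
    (H : ∀ v, stdD G (n + 1) (P.homotopy n (stdD G (n + 1) v)) = stdD G (n + 1) v) (v) :
    stdD G (n + 2) (P.homotopy (n + 1) v) = v - P.homotopy n (stdD G (n + 1) v) := by
  have : stdD G (n + 2) ∘ₗ P.homotopy (n + 1) =
      LinearMap.id - P.homotopy n ∘ₗ stdD G (n + 1) := by
    ext x : 2
    simp only [LinearMap.comp_apply, lsingle_apply, LinearMap.sub_apply, LinearMap.id_apply]
    rw [homotopy_succ_single, stdD_stdCone, map_sub, H, sub_self, map_zero, sub_zero]
  exact LinearMap.congr_fun this v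

lemma stdD_homotopy_succ (n : ℕ) (v : (Fin (n + 3) → G) →₀ ZZ.{u}) :
    stdD G (n + 2) (P.homotopy (n + 1) v) = v - P.homotopy n (stdD G (n + 1) v) := by
  induction n with
  | zero =>
    exact P.stdD_homotopy_of_boundary 0
      (fun v => by rw [stdD_homotopy_zero, proj_stdD, sub_zero]) v
  | succ n ih =>
    exact P.stdD_homotopy_of_boundary (n + 1)
      (fun v => by rw [ih, stdD_stdD, map_zero, sub_zero]) v

end PathSystem

/-- If `G` has a path system, then `P_* ⊗_{G ⋊ Γ} ℤ` is exact in degrees at least `2`. -/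
lemma PathSystem.exists_stdCoinvD_eq (P : PathSystem G) (n : ℕ) (x : StdCoinv G (n + 3))
    (hx : stdCoinvD G (n + 1) x = 0) :
    ∃ y, stdCoinvD G (n + 2) y = x := by
  let H (m : ℕ) : StdCoinv G (m + 2) →ₗ[ZZ.{u}] StdCoinv G (m + 3) :=
    stdDescLinear (stdMk G (m + 3) 1 ∘ₗ P.homotopy m) fun h v => by
      rw [LinearMap.comp_apply, P.homotopy_stdRep, stdMk_smul, LinearMap.comp_apply]
  have hH (m : ℕ) (v) : H m (stdMk G (m + 2) 1 v) = stdMk G (m + 3) 1 (P.homotopy m v) :=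
    stdDescLinear_mk _ _ v
  refine ⟨H (n + 1) x, ?_⟩
  -- No term from `proj` appears because `x` has homological degree `n + 2`; in degree one it would
  -- remain.
  have key : stdCoinvD G (n + 2) (H (n + 1) x) = x - H n (stdCoinvD G (n + 1) x) := by
    obtain ⟨v, rfl⟩ := stdMk_surjective x
    rw [hH, stdCoinvD_mk, stdCoinvD_mk, hH, P.stdD_homotopy_succ, map_sub]
  rw [key, hx, map_zero, sub_zero]

end PathContraction

end GammaGrp

/-! ### Paths in the Cayley tree of a free `Γ`-group. -/

namespace GammaGrp

open Finsupp TensorProduct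

variable {Γ : Type u} [Group Γ]

section FreePaths

variable (G : GammaGrp Γ)

/-- The module of edges of the complete graph on the free group. -/
abbrev FreeEdges : Type u := (Fin 2 → G.free) →₀ ZZ.{u}

variable {G}

/-- The translation of edges by an element of the free group. -/
noncomputable abbrev translate (w : G.free) : FreeEdges G →ₗ[ZZ.{u}] FreeEdges G :=
  stdRep G.free 2 (SemidirectProduct.inl w)

lemma translate_mul (v w : G.free) (m : FreeEdges G) :
    translate (v * w) m = translate v (translate w m) := by
  rw [translate, map_mul, map_mul]; rfl

lemma translate_one (m : FreeEdges G) : translate 1 m = m := by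
  rw [translate, map_one, map_one]; rfl

/-- The edge from `1` to the generator `|x|`. -/
noncomputable def genEdge (x : G) : FreeEdges G := single ![1, gen x] 1

/-- The affine automorphism `m ↦ |x| m + e_x` of the module of edges. -/
noncomputable def affineGen (x : G) : Equiv.Perm (FreeEdges G) where
  toFun m := translate (gen x) m + genEdge x
  invFun m := translate (gen x)⁻¹ (m - genEdge x)
  left_inv m := by
    dsimp only
    rw [add_sub_cancel_right, ← translate_mul, inv_mul_cancel, translate_one]
  right_inv m := by
    dsimp only
    rw [← translate_mul, mul_inv_cancel, translate_one, sub_add_cancel]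

/-- The affine action of the free group on the module of edges. -/
noncomputable def affineAction (G : GammaGrp Γ) : G.free →* Equiv.Perm (FreeEdges G) :=
  FreeGroup.lift affineGen

lemma affineAction_gen (x : G) (m : FreeEdges G) :
    affineAction G (gen x) m = translate (gen x) m + genEdge x :=
  congrArg (fun f : Equiv.Perm (FreeEdges G) => f m) FreeGroup.lift_apply_of

/-- The path from `1` to `w` in the Cayley tree of the free group. -/
noncomputable def wordPath (w : G.free) : FreeEdges G := affineAction G w 0

lemma free_induction {p : G.free → Prop} (one : p 1) (gen : ∀ x : G, p (gen x))
    (inv : ∀ w, p w → p w⁻¹) (mul : ∀ v w, p v → p w → p (v * w)) (w : G.free) : p w :=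
  FreeGroup.induction_on (C := p) w one gen (fun _ => inv _) mul

/-- The linear part of the affine action is translation, so the orbit of `0` is a crossed
homomorphism. The universal property of the free group thereby produces a Fox-type derivative with
prescribed values on generators. -/
lemma affineAction_apply (w : G.free) (m : FreeEdges G) :
    affineAction G w m = translate w m + wordPath w := by
  induction w using free_induction generalizing m with
  | one =>
    rw [wordPath, map_one, translate_one]
    exact (add_zero m).symm
  | gen x =>
    rw [wordPath, affineAction_gen, affineAction_gen, map_zero, zero_add]
  | inv w ih =>
    have e (m : FreeEdges G) :
        affineAction G w⁻¹ m = translate w⁻¹ m - translate w⁻¹ (wordPath w) := by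
      rw [map_inv, Equiv.Perm.inv_eq_iff_eq, ih, map_sub, ← translate_mul, ← translate_mul,
        mul_inv_cancel, translate_one, translate_one, sub_add_cancel]
    rw [wordPath, e, e, map_zero, zero_sub, sub_eq_add_neg]
  | mul v w hv hw =>
    rw [wordPath, map_mul, Equiv.Perm.mul_apply, Equiv.Perm.mul_apply, hw, hv, hw, hv, map_zero,
      zero_add, map_add, translate_mul, add_assoc]

lemma wordPath_mul (v w : G.free) : wordPath (v * w) = wordPath v + translate v (wordPath w) := by
  rw [wordPath, map_mul, Equiv.Perm.mul_apply, affineAction_apply, add_comm]; rfl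

lemma wordPath_one : wordPath (1 : G.free) = 0 := by
  rw [wordPath, map_one]; rfl

lemma wordPath_inv (w : G.free) : wordPath w⁻¹ = -translate w⁻¹ (wordPath w) := by
  have := wordPath_mul w⁻¹ w
  rw [inv_mul_cancel, wordPath_one] at this
  exact eq_neg_of_add_eq_zero_left this.symm

lemma wordPath_gen (x : G) : wordPath (gen x) = genEdge x := by
  rw [wordPath, affineAction_gen, map_zero, zero_add]

/-- A vertex of the Cayley graph. -/
noncomputable abbrev vertex (w : G.free) : (Fin 1 → G.free) →₀ ZZ.{u} := single (fun _ => w) 1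

lemma stdRep_vertex (h : Semi G.free) (w : G.free) :
    stdRep G.free 1 h (vertex w) = vertex (h.left * h.right • w) := by
  rw [vertex, stdRep_single]; rfl

lemma stdRep_inl_vertex (v w : G.free) :
    stdRep G.free 1 (SemidirectProduct.inl v) (vertex w) = vertex (v * w) := by
  rw [stdRep_vertex, SemidirectProduct.left_inl, SemidirectProduct.right_inl, one_smul]

/-- Both sides are crossed homomorphisms in `w` that agree on generators. -/
lemma stdD_wordPath (w : G.free) : stdD G.free 0 (wordPath w) = vertex w - vertex 1 := by
  induction w using free_induction with
  | one =>
    rw [wordPath_one, map_zero, sub_self]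
  | gen x =>
    rw [wordPath_gen, genEdge, stdD_single, Fin.sum_univ_two]
    simp only [Fin.val_zero, Fin.val_one, pow_zero, pow_one, one_smul, neg_smul, sub_eq_add_neg]
    congr 3 <;> funext i <;> obtain rfl := Subsingleton.elim (α := Fin 1) i 0 <;> rfl
  | inv w ih =>
    rw [wordPath_inv, map_neg, stdD_stdRep, ih, map_sub, stdRep_inl_vertex, stdRep_inl_vertex,
      inv_mul_cancel, mul_one, neg_sub]
  | mul v w hv hw =>
    rw [wordPath_mul, map_add, stdD_stdRep, hv, hw, map_sub, stdRep_inl_vertex, stdRep_inl_vertex,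
      mul_one]
    abel

/-- `Γ` permutes the free generators, hence preserves the Cayley tree and the paths in it. This is
where it matters that the basis is a `Γ`-set. -/
lemma stdRep_inr_wordPath (σ : Γ) (w : G.free) :
    stdRep G.free 2 (SemidirectProduct.inr σ) (wordPath w) = wordPath (σ • w) := by
  have comm (v : G.free) (m : FreeEdges G) :
      stdRep G.free 2 (SemidirectProduct.inr σ) (translate v m) =
        translate (σ • v) (stdRep G.free 2 (SemidirectProduct.inr σ) m) := by
    have e : (SemidirectProduct.inr σ * SemidirectProduct.inl v : Semi G.free) =
        SemidirectProduct.inl (σ • v) * SemidirectProduct.inr σ := by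
      refine SemidirectProduct.ext ?_ ?_ <;> simp
    have e' := congrArg (fun h => stdRep G.free 2 h m) e
    rw [map_mul, map_mul] at e'
    exact e'
  induction w using free_induction with
  | one =>
    rw [smul_one, wordPath_one, map_zero]
  | gen x =>
    rw [← gen_smul, wordPath_gen, wordPath_gen, genEdge, stdRep_single, genEdge]
    congr 1
    funext i
    fin_cases i <;> simp [semiAct, gen_smul]
  | inv w ih =>
    rw [smul_inv', wordPath_inv, wordPath_inv, map_neg, comm, ih, smul_inv']
  | mul v w hv hw =>
    rw [smul_mul', wordPath_mul, wordPath_mul, map_add, comm, hv, hw]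

/-- The paths in the Cayley tree of a free group. -/
noncomputable def freePathSystem (G : GammaGrp Γ) : PathSystem G.free where
  path a b := translate a (wordPath (a⁻¹ * b))
  stdD_path a b := by
    rw [stdD_stdRep, stdD_wordPath, map_sub, stdRep_inl_vertex, stdRep_inl_vertex,
      mul_inv_cancel_left, mul_one]
  path_add a b c := by
    have e : a⁻¹ * c = (a⁻¹ * b) * (b⁻¹ * c) := by group
    rw [e, wordPath_mul (a⁻¹ * b), map_add, ← translate_mul, mul_inv_cancel_left]
  stdRep_path h a b := by
    -- Moving the `Γ`-part of `h` past the translation by `a` leaves it to act on a path that starts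
    -- at `1`.
    have e : h * SemidirectProduct.inl a = SemidirectProduct.inl (h.left * h.right • a) *
        SemidirectProduct.inr h.right := by
      refine SemidirectProduct.ext ?_ ?_ <;> simp
    have e' := congrArg (fun g => stdRep G.free 2 g (wordPath (a⁻¹ * b))) e
    rw [map_mul, map_mul] at e'
    refine Eq.trans e' ?_
    refine congrArg (translate _) ((stdRep_inr_wordPath _ _).trans ?_)
    rw [smul_mul', smul_inv', mul_inv_rev]
    congr 1
    group

end FreePaths

end GammaGrp

/-! ### The equivariant chains as an acyclic resolution. -/

namespace GammaGrp

open Finsupp CotripleResolution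

variable {Γ : Type u} [Group Γ]

/-- The underlying complexes of abelian groups, in positive degrees. -/
noncomputable abbrev positivePart (K : GammaGrp Γ ⥤ ChainComplex (ModuleCat.{u} ZZ.{u}) ℕ) :
    GammaGrp Γ ⥤ ChainComplex AddCommGrpCat.{u} ℕ :=
  K ⋙ (forget₂ (ModuleCat.{u} ZZ.{u}) AddCommGrpCat.{u}).mapHomologicalComplex _ ⋙
    ChainComplex.truncate

section Equivariant

/-- The augmentation of the positive part of `P_* ⊗_{G ⋊ Γ} ℤ` to `G / [G, G]_Γ`. -/
noncomputable def stdAug (Γ : Type u) [Group Γ] :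
    positivePart (stdChainsFunctor Γ) ⋙ HomologicalComplex.eval _ _ 0 ⟶ gammaAb Γ where
  app G := AddCommGrpCat.ofHom (X := StdCoinv G 2) (stdToAb G)
  naturality G H f := by
    refine AddCommGrpCat.hom_ext ?_
    have e : (stdToAb H).comp (stdPush f 2).toAddMonoidHom =
        ((gammaAb Γ).map f).hom.comp (stdToAb G) := stdCoinv_hom_ext fun x => by
      refine (congrArg (stdToAb H) (stdPush_gen f x)).trans ((stdToAb_gen _).trans ?_)
      refine Eq.trans ?_ (congrArg ((gammaAb Γ).map f).hom (stdToAb_gen x)).symm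
      change Additive.ofMul (QuotientGroup.mk ((f (x 0))⁻¹ * f (x 1))) =
        Additive.ofMul (QuotientGroup.mk (f ((x 0)⁻¹ * x 1)))
      rw [map_mul, map_inv]
    exact e

/-- The natural section `ℤ[Gⁿ]_Γ ⟶ ℤ[F(G)ⁿ]_Γ` given by `g ↦ |g|`. -/
noncomputable def stdSection (Γ : Type u) [Group Γ] (q : ℕ) :
    positivePart (stdChainsFunctor Γ) ⋙ HomologicalComplex.eval _ _ q ⟶
      (freeCotriple Γ).toFunctor ⋙ positivePart (stdChainsFunctor Γ) ⋙
        HomologicalComplex.eval _ _ q where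
  app G := AddCommGrpCat.ofHom (X := StdCoinv G (q + 2)) (Y := StdCoinv G.free (q + 2))
    (stdPushSet gen gen_smul (q + 1)).toAddMonoidHom
  naturality G H f := by
    have e : stdPushSet gen gen_smul (q + 1) ∘ₗ stdPush f (q + 2) =
        stdPush ((freeFunctor Γ).map f) (q + 2) ∘ₗ stdPushSet gen gen_smul (q + 1) := by
      rw [stdPush_eq_stdPushSet, stdPush_eq_stdPushSet, stdPushSet_comp]
      refine Eq.trans ?_ (stdPushSet_comp _ _ _ _ _).symm
      congr 1
    exact AddCommGrpCat.hom_ext (congrArg LinearMap.toAddMonoidHom e)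

/-- The complex `P_* ⊗_{G ⋊ Γ} ℤ` computes the derived functors of `G ↦ G / [G, G]_Γ`. -/
lemma stdChains_isAcyclicResolution (Γ : Type u) [Group Γ] :
    IsAcyclicResolution (freeCotriple Γ) (positivePart (stdChainsFunctor Γ)) (gammaAb Γ)
      (stdAug Γ) where
  d_comp G := AddCommGrpCat.hom_ext (AddMonoidHom.ext fun y => stdToAb_stdCoinvD (G := G) y)
  surjective G := stdToAb_surjective
  exact_zero G x hx := exists_stdCoinvD_eq x hx
  -- Degree `q + 1` of the positive part is degree `q + 2` of the full complex, made of tuples of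
  -- length `q + 3`.
  exact_succ G q x hx := (freePathSystem G).exists_stdCoinvD_eq q x hx
  retract q := by
    refine ⟨stdSection Γ q, fun G => ?_⟩
    have e : stdPush (freeCounit G) (q + 2) ∘ₗ stdPushSet gen gen_smul (q + 1) =
        LinearMap.id := by
      rw [stdPush_eq_stdPushSet]
      refine (stdPushSet_comp _ _ _ _ _).trans (Eq.trans ?_ (stdPushSet_id (q + 1)))
      congr 1
      funext x
      exact freeCounit_gen x
    exact AddCommGrpCat.hom_ext (congrArg LinearMap.toAddMonoidHom e)

end Equivariant

/-! ### Ordinary chains, by transfer from the trivial action. -/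

section Ordinary

/-- The differential of the inhomogeneous chains of a group, with integral coefficients. -/
noncomputable abbrev barD (G : Type u) [Group G] (n : ℕ) :
    ((Fin (n + 1) → G) →₀ ZZ.{u}) →ₗ[ZZ.{u}] ((Fin n → G) →₀ ZZ.{u}) :=
  ((groupHomology.inhomogeneousChains (Rep.trivial ZZ.{u} G ZZ.{u})).d (n + 1) n).hom

lemma betaLinear_barD (G : GammaGrp Γ) (n : ℕ) (v : (Fin (n + 1) → G) →₀ ZZ.{u}) :
    betaLinear G n (barD G n v) = stdCoinvD G n (betaLinear G (n + 1) v) :=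
  (congrArg (fun f => f.hom v) ((betaChains G).comm (n + 1) n)).symm

lemma betaLinear_single_one (G : GammaGrp Γ) (n : ℕ) (x : Fin n → G) :
    betaLinear G n (single x 1) = stdGen (Fin.partialProd x) := betaLinear_single G n x 1

lemma betaLinear_surjective (G : GammaGrp Γ) (n : ℕ) : Function.Surjective (betaLinear G n) := by
  have : (LinearMap.range (betaLinear G n)).mkQ = 0 := stdCoinv_ext fun x => by
    rw [LinearMap.zero_apply, Submodule.mkQ_apply, Submodule.Quotient.mk_eq_zero]
    exact ⟨single (quotients x) 1,
      (betaLinear_single_one G n _).trans (stdGen_partialProd_quotients x)⟩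
  rw [← LinearMap.range_eq_top, ← Submodule.ker_mkQ (LinearMap.range (betaLinear G n)), this,
    LinearMap.ker_zero]

/-- If `Γ` acts trivially, then `P_* ⊗_{G ⋊ Γ} ℤ` is the complex of inhomogeneous chains. -/
lemma betaLinear_injective (G : GammaGrp Γ) (h : ∀ (σ : Γ) (x : G), σ • x = x) (n : ℕ) :
    Function.Injective (betaLinear G n) := by
  let r : StdCoinv G (n + 1) →ₗ[ZZ.{u}] ((Fin n → G) →₀ ZZ.{u}) :=
    stdDesc (fun x => single (quotients x) 1) fun g x => by
      rw [quotients_semiAct]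
      simp only [h]
  have : r ∘ₗ betaLinear G n = LinearMap.id := Finsupp.lhom_ext' fun x => LinearMap.ext_ring <| by
    refine (congrArg r (betaLinear_single_one G n x)).trans ((stdDesc_gen _ _ _).trans ?_)
    rw [quotients_partialProd]
    rfl
  exact Function.LeftInverse.injective (g := r) fun v => LinearMap.congr_fun this v

/-- The trivial group. -/
def TrivialGroup : Type u := PUnit.{u + 1}

instance : Group TrivialGroup.{u} := inferInstanceAs (Group PUnit.{u + 1})

/-- A group, with the trivial action of the trivial group. -/
def plain (G : Type u) [Group G] : GammaGrp TrivialGroup.{u} where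
  carrier := G
  action :=
    { smul := fun _ g => g
      one_smul := fun _ => rfl
      mul_smul := fun _ _ _ => rfl
      smul_mul := fun _ _ _ => rfl
      smul_one := fun _ => rfl }

lemma plain_smul (G : Type u) [Group G] (σ : TrivialGroup.{u}) (g : plain G) : σ • g = g := rfl

lemma plain_free_smul (G : Type u) [Group G] (σ : TrivialGroup.{u}) (w : (plain G).free) :
    σ • w = w := FreeGroup.map.id w

/-- The inhomogeneous chains of a free group are exact in degrees at least two. -/
lemma exists_barD_eq_of_free (G : Type u) [Group G] (n : ℕ)
    (x : (Fin (n + 2) → FreeGroup G) →₀ ZZ.{u}) (hx : barD (FreeGroup G) (n + 1) x = 0) :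
    ∃ y, barD (FreeGroup G) (n + 2) y = x := by
  -- `betaLinear` is bijective in every degree for a trivial action and commutes with the
  -- differentials, so a primitive in the equivariant complex pulls back to one here.
  have inj := betaLinear_injective (plain G).free (plain_free_smul G)
  obtain ⟨y, hy⟩ := (freePathSystem (plain G)).exists_stdCoinvD_eq n
    (betaLinear (plain G).free (n + 2) x)
    ((betaLinear_barD (plain G).free (n + 1) x).symm.trans
      ((congrArg (betaLinear (plain G).free (n + 1)) hx).trans (map_zero _)))
  obtain ⟨z, rfl⟩ := betaLinear_surjective (plain G).free (n + 3) y
  exact ⟨z, inj (n + 2) ((betaLinear_barD (plain G).free (n + 2) z).trans hy)⟩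

/-- The map `ℤ[G] ⟶ G / [G, G]`. -/
noncomputable def barToAb (G : Type u) [Group G] :
    ((Fin 1 → G) →₀ ZZ.{u}) →+ Additive (Abelianization G) :=
  letI := zzModule.{u} (Additive (Abelianization G))
  (linearCombination ZZ.{u} fun x : Fin 1 → G =>
    Additive.ofMul (Abelianization.of (x 0))).toAddMonoidHom

lemma barToAb_single (G : Type u) [Group G] (x : Fin 1 → G) :
    barToAb G (single x 1) = Additive.ofMul (Abelianization.of (x 0)) := by
  let _ := zzModule.{u} (Additive (Abelianization G))
  refine (linearCombination_single ZZ.{u} _ _).trans (one_smul ZZ.{u} _)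

variable (Γ) in
/-- The functor `G ↦ G / [G, G]`. -/
def ordinaryAb : GammaGrp Γ ⥤ AddCommGrpCat.{u} where
  obj G := AddCommGrpCat.of (Additive (Abelianization G))
  map f := AddCommGrpCat.ofHom (MonoidHom.toAdditive (Abelianization.map (Hom.monoidHom f)))
  map_id G := AddCommGrpCat.hom_ext <| AddMonoidHom.ext <| by rintro ⟨x⟩; rfl
  map_comp f g := AddCommGrpCat.hom_ext <| AddMonoidHom.ext <| by rintro ⟨x⟩; rfl

variable (Γ) in
/-- The projection `G / [G, G] ⟶ G / [G, G]_Γ`. -/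
def abProjection : ordinaryAb Γ ⟶ gammaAb Γ where
  app G := AddCommGrpCat.ofHom (MonoidHom.toAdditive
    (Abelianization.lift (QuotientGroup.mk' (gammaCommutator G))))
  naturality G H f := AddCommGrpCat.hom_ext <| AddMonoidHom.ext <| by rintro ⟨x⟩; rfl

lemma chainsFunctor_map_single {G H : GammaGrp Γ} (f : G ⟶ H) (n : ℕ) (x : Fin n → G) :
    (((chainsFunctor Γ).map f).f n).hom (single x (1 : ZZ.{u})) =
      single (f ∘ x : Fin n → H) (1 : ZZ.{u}) :=
  groupHomology.chainsMap_f_single (A := Rep.trivial ZZ.{u} G ZZ.{u})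
    (B := Rep.trivial ZZ.{u} H ZZ.{u}) (Hom.monoidHom f) (𝟙 _) n x (1 : ZZ.{u})

/-- The augmentation of the positive part of the inhomogeneous chains to `G / [G, G]`. -/
noncomputable def barAug (Γ : Type u) [Group Γ] :
    positivePart (chainsFunctor Γ) ⋙ HomologicalComplex.eval _ _ 0 ⟶ ordinaryAb Γ where
  app G := AddCommGrpCat.ofHom (X := ((Fin 1 → G) →₀ ZZ.{u})) (barToAb G)
  naturality G H f := by
    refine AddCommGrpCat.hom_ext ?_
    have e : (barToAb H).comp (((chainsFunctor Γ).map f).f 1).hom.toAddMonoidHom =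
        ((ordinaryAb Γ).map f).hom.comp (barToAb G) := finsupp_hom_ext fun x => by
      refine (congrArg (barToAb H) (chainsFunctor_map_single f 1 x)).trans ?_
      refine (barToAb_single H _).trans ?_
      exact (congrArg ((ordinaryAb Γ).map f).hom (barToAb_single G x)).symm
    exact e

/-- The natural section `ℤ[Gⁿ] ⟶ ℤ[F(G)ⁿ]` given by `g ↦ |g|`. -/
noncomputable def barSection (Γ : Type u) [Group Γ] (q : ℕ) :
    positivePart (chainsFunctor Γ) ⋙ HomologicalComplex.eval _ _ q ⟶
      (freeCotriple Γ).toFunctor ⋙ positivePart (chainsFunctor Γ) ⋙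
        HomologicalComplex.eval _ _ q where
  app G := AddCommGrpCat.ofHom (X := ((Fin (q + 1) → G) →₀ ZZ.{u}))
    (Y := ((Fin (q + 1) → G.free) →₀ ZZ.{u}))
    (lmapDomain ZZ.{u} ZZ.{u} fun x : Fin (q + 1) → G =>
      (gen ∘ x : Fin (q + 1) → G.free)).toAddMonoidHom
  naturality G H f := by
    refine AddCommGrpCat.hom_ext ?_
    have e : (lmapDomain ZZ.{u} ZZ.{u} fun x : Fin (q + 1) → H =>
          (gen ∘ x : Fin (q + 1) → H.free)).toAddMonoidHom.comp
          (((chainsFunctor Γ).map f).f (q + 1)).hom.toAddMonoidHom =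
        (((chainsFunctor Γ).map ((freeFunctor Γ).map f)).f (q + 1)).hom.toAddMonoidHom.comp
          (lmapDomain ZZ.{u} ZZ.{u} fun x : Fin (q + 1) → G =>
            (gen ∘ x : Fin (q + 1) → G.free)).toAddMonoidHom := finsupp_hom_ext fun x => by
      refine (congrArg (lmapDomain ZZ.{u} ZZ.{u} fun x : Fin (q + 1) → H =>
          (gen ∘ x : Fin (q + 1) → H.free)) (chainsFunctor_map_single f (q + 1) x)).trans ?_
      refine mapDomain_single.trans (Eq.trans ?_ (congrArg
        (((chainsFunctor Γ).map ((freeFunctor Γ).map f)).f (q + 1)).hom mapDomain_single).symm)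
      refine Eq.trans ?_ (chainsFunctor_map_single ((freeFunctor Γ).map f) (q + 1) _).symm
      congr 1
    exact e

/-- The edge attached to `g` is `(1, g)`, whose class is that of `g`. The identity makes `β`
compatible with the augmentations and also transfers facts about `stdToAb` to `barToAb`. -/
lemma abProjection_barToAb (G : GammaGrp Γ) (v : (Fin 1 → G) →₀ ZZ.{u}) :
    (abProjection Γ).app G (barToAb G v) = stdToAb G (betaLinear G 1 v) := by
  have : ((abProjection Γ).app G).hom.comp (barToAb G) =
      (stdToAb G).comp (betaLinear G 1).toAddMonoidHom := finsupp_hom_ext fun x => by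
    refine (congrArg ((abProjection Γ).app G).hom (barToAb_single G x)).trans ?_
    refine Eq.trans ?_ (congrArg (stdToAb G) (betaLinear_single_one G 1 x)).symm
    rw [stdToAb_gen]
    have e : (Fin.partialProd x 0)⁻¹ * Fin.partialProd x 1 = x 0 :=
      Fin.partialProd_right_inv x 0
    rw [e]
    rfl
  exact DFunLike.congr_fun this v

/-- For a trivial action the elements `σ • g * g⁻¹` are all `1`, so `[G, G]_Γ = [G, G]`. -/
lemma abProjection_plain_injective (G : Type u) [Group G] :
    Function.Injective ((abProjection TrivialGroup.{u}).app (plain G)) := by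
  refine (injective_iff_map_eq_zero ((abProjection TrivialGroup.{u}).app (plain G)).hom).2 ?_
  rintro ⟨g⟩ hg
  have hg' : g ∈ gammaCommutator (plain G) :=
    (QuotientGroup.eq_one_iff (N := gammaCommutator (plain G)) g).1 hg
  have le : gammaCommutator (plain G) ≤ commutator (plain G) := by
    refine (Subgroup.closure_le _).2 (Set.union_subset (fun _ hx => hx) ?_)
    rintro _ ⟨σ, x, rfl⟩
    rw [plain_smul, mul_inv_cancel]
    exact one_mem _
  exact (QuotientGroup.eq_one_iff (N := commutator G) g).2 (le hg')

lemma barToAb_barD (G : Type u) [Group G] (y : (Fin 2 → G) →₀ ZZ.{u}) :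
    barToAb G (barD G 1 y) = 0 := by
  refine abProjection_plain_injective G ((abProjection_barToAb (plain G) _).trans ?_)
  refine (congrArg (stdToAb (plain G)) (betaLinear_barD (plain G) 1 y)).trans ?_
  exact (stdToAb_stdCoinvD _).trans (map_zero _).symm

lemma exists_barD_eq (G : Type u) [Group G] (x : (Fin 1 → G) →₀ ZZ.{u}) (hx : barToAb G x = 0) :
    ∃ y, barD G 1 y = x := by
  obtain ⟨y, hy⟩ := exists_stdCoinvD_eq (G := plain G) (betaLinear (plain G) 1 x)
    ((abProjection_barToAb (plain G) x).symm.trans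
      ((congrArg ((abProjection TrivialGroup.{u}).app (plain G)) hx).trans (map_zero _)))
  obtain ⟨z, rfl⟩ := betaLinear_surjective (plain G) 2 y
  exact ⟨z, betaLinear_injective (plain G) (plain_smul G) 1
    ((betaLinear_barD (plain G) 1 z).trans hy)⟩

/-- The complex of inhomogeneous chains computes the derived functors of `G ↦ G / [G, G]`. -/
lemma chains_isAcyclicResolution (Γ : Type u) [Group Γ] :
    IsAcyclicResolution (freeCotriple Γ) (positivePart (chainsFunctor Γ)) (ordinaryAb Γ)
      (barAug Γ) where
  d_comp G := AddCommGrpCat.hom_ext (AddMonoidHom.ext fun y => barToAb_barD G y)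
  surjective G := fun y => by
    obtain ⟨g, hg⟩ := QuotientGroup.mk_surjective (s := commutator G) y.toMul
    exact ⟨single (fun _ => g) 1, (barToAb_single G _).trans (congrArg Additive.ofMul hg)⟩
  exact_zero G x hx := exists_barD_eq G x hx
  exact_succ G q x hx := exists_barD_eq_of_free G q x hx
  retract q := by
    refine ⟨barSection Γ q, fun G => ?_⟩
    have e : (((chainsFunctor Γ).map (freeCounit G)).f (q + 1)).hom.toAddMonoidHom.comp
          (lmapDomain ZZ.{u} ZZ.{u} fun x : Fin (q + 1) → G =>
            (gen ∘ x : Fin (q + 1) → G.free)).toAddMonoidHom = AddMonoidHom.id _ :=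
      finsupp_hom_ext fun x => by
        refine (congrArg (((chainsFunctor Γ).map (freeCounit G)).f (q + 1)).hom
          mapDomain_single).trans ((chainsFunctor_map_single (freeCounit G) (q + 1) _).trans ?_)
        congr 1
        funext i
        exact freeCounit_gen (x i)
    exact AddCommGrpCat.hom_ext e

end Ordinary

end GammaGrp

/-! ### Shifting degrees by truncation, and homology in degree zero. -/

namespace ChainComplex

open HomologicalComplex

section Shift

variable {V V' : Type*} [Category V] [Abelian V] [Category V'] [Abelian V'] (F : V ⥤ V')
  [F.Additive]

/-- The differential that starts in degree `n + 1` of the truncation of a complex, or in degree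
zero the zero map, as a component of `truncateSc`. -/
def truncateScτ₃ (L : ChainComplex V ℕ) : (n : ℕ) → (F.obj (L.X (n - 1 + 1)) ⟶ F.obj (L.X n))
  | 0 => F.map (L.d 1 0)
  | _ + 1 => 𝟙 _

/-- The short complexes that compute the homology of `F L` in positive degrees and of its
truncation. -/
def truncateSc (L : ChainComplex V ℕ) (h : L.d 1 0 = 0) (n : ℕ) :
    (truncate.obj ((F.mapHomologicalComplex _).obj L)).sc' (n + 1) n (n - 1) ⟶
      F.mapShortComplex.obj (L.sc' (n + 2) (n + 1) n) where
  τ₁ := 𝟙 _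
  τ₂ := 𝟙 _
  τ₃ := truncateScτ₃ F L n
  comm₁₂ := (Category.id_comp _).trans (Category.comp_id _).symm
  comm₂₃ := by
    refine (Category.id_comp _).trans ?_
    cases n with
    | zero =>
      change F.map (L.d 1 0) = F.map (L.d 1 1) ≫ F.map (L.d 1 0)
      rw [h, F.map_zero, Limits.comp_zero]
    | succ n => exact (Category.comp_id (F.map (L.d (n + 2) (n + 1)))).symm

/-- For positive `n` the comparison is the identity in all three places. For `n = 0`, where `n - 1`
is again `0`, the third component is not invertible in general, but both outgoing differentials
vanish, so the cycles are everything on either side. -/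
lemma isIso_homologyMap_truncateSc (L : ChainComplex V ℕ) (h : L.d 1 0 = 0) (n : ℕ) :
    IsIso (ShortComplex.homologyMap (truncateSc F L h n)) := by
  have i₁ : IsIso (truncateSc F L h n).τ₁ := inferInstanceAs (IsIso (𝟙 _))
  have i₂ : IsIso (truncateSc F L h n).τ₂ := inferInstanceAs (IsIso (𝟙 _))
  refine ShortComplex.isIso_homologyMap_of_isIso_cyclesMap_of_epi ?_ inferInstance
  cases n with
  | zero =>
    have := ShortComplex.isIso_iCycles
      ((truncate.obj ((F.mapHomologicalComplex _).obj L)).sc' 1 0 0)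
      ((truncate.obj ((F.mapHomologicalComplex _).obj L)).shape 0 0 (Nat.succ_ne_zero 0))
    have := ShortComplex.isIso_iCycles (F.mapShortComplex.obj (L.sc' 2 1 0))
      ((congrArg F.map h).trans (F.map_zero _ _))
    have e := ShortComplex.cyclesMap_i (truncateSc F L h 0)
    have : IsIso (ShortComplex.cyclesMap (truncateSc F L h 0) ≫
        (F.mapShortComplex.obj (L.sc' 2 1 0)).iCycles) := by
      rw [e]
      infer_instance
    exact IsIso.of_isIso_comp_right _ (F.mapShortComplex.obj (L.sc' 2 1 0)).iCycles
  | succ n =>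
    exact ShortComplex.isIso_cyclesMap_of_isIso_of_mono' _ i₂ (inferInstanceAs (Mono (𝟙 _)))

variable [F.PreservesHomology]

/-- If `d₁₀` vanishes, then the homology of the truncation of `F L` is the homology of `L`,
with the degree shifted by one. -/
noncomputable def homologyTruncateIso (L : ChainComplex V ℕ) (h : L.d 1 0 = 0) (n : ℕ) :
    (truncate.obj ((F.mapHomologicalComplex _).obj L)).homology n ≅ F.obj (L.homology (n + 1)) :=
  (homologyFunctorIso' V' (ComplexShape.down ℕ) (n + 1) n (n - 1) (ChainComplex.prev ℕ n)
    (by cases n <;> simp)).app _ ≪≫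
  @asIso _ _ _ _ _ (isIso_homologyMap_truncateSc F L h n) ≪≫
  (L.sc' (n + 2) (n + 1) n).mapHomologyIso F ≪≫
  F.mapIso ((homologyFunctorIso' V (ComplexShape.down ℕ) (n + 2) (n + 1) n
    (ChainComplex.prev ℕ (n + 1)) (ChainComplex.next_nat_succ n)).app L).symm

lemma homologyTruncateIso_hom_naturality {L L' : ChainComplex V ℕ} (φ : L ⟶ L')
    (h : L.d 1 0 = 0) (h' : L'.d 1 0 = 0) (n : ℕ) :
    homologyMap (truncate.map ((F.mapHomologicalComplex _).map φ)) n ≫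
        (homologyTruncateIso F L' h' n).hom =
      (homologyTruncateIso F L h n).hom ≫ F.map (homologyMap φ (n + 1)) := by
  have e1 := (homologyFunctorIso' V' (ComplexShape.down ℕ) (n + 1) n (n - 1) (ChainComplex.prev ℕ n)
    (by cases n <;> simp)).hom.naturality (truncate.map ((F.mapHomologicalComplex _).map φ))
  have e4 := (homologyFunctorIso' V (ComplexShape.down ℕ) (n + 2) (n + 1) n
    (ChainComplex.prev ℕ (n + 1)) (ChainComplex.next_nat_succ n)).inv.naturality φ
  have e2 : (shortComplexFunctor' V' _ (n + 1) n (n - 1)).map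
        (truncate.map ((F.mapHomologicalComplex _).map φ)) ≫ truncateSc F L' h' n =
      truncateSc F L h n ≫
        F.mapShortComplex.map ((shortComplexFunctor' V _ (n + 2) (n + 1) n).map φ) := by
    refine ShortComplex.hom_ext _ _ ?_ ?_ ?_
    · exact (Category.comp_id _).trans (Category.id_comp _).symm
    · exact (Category.comp_id _).trans (Category.id_comp _).symm
    · cases n with
      | zero =>
        change F.map (φ.f 1) ≫ F.map (L'.d 1 0) = F.map (L.d 1 0) ≫ F.map (φ.f 0)
        rw [← F.map_comp, ← F.map_comp, φ.comm]
      | succ n => exact (Category.comp_id _).trans (Category.id_comp _).symm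
  have e3 := ShortComplex.mapHomologyIso_hom_naturality
    ((shortComplexFunctor' V _ (n + 2) (n + 1) n).map φ) F
  have e2' := (ShortComplex.homologyMap_comp ((shortComplexFunctor' V' _ (n + 1) n (n - 1)).map
        (truncate.map ((F.mapHomologicalComplex _).map φ))) (truncateSc F L' h' n)).symm.trans
    ((congrArg (fun f => ShortComplex.homologyMap f) e2).trans
      (ShortComplex.homologyMap_comp (truncateSc F L h n)
        (F.mapShortComplex.map ((shortComplexFunctor' V _ (n + 2) (n + 1) n).map φ))))
  refine ((reassoc_of% e1) _).trans ((congrArg (_ ≫ ·) ?_).trans (Category.assoc _ _ _).symm)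
  refine ((reassoc_of% e2') _).trans ((congrArg (_ ≫ ·) ?_).trans (Category.assoc _ _ _).symm)
  refine ((reassoc_of% e3) _).trans ((congrArg (_ ≫ ·) ?_).trans (Category.assoc _ _ _).symm)
  exact (F.map_comp _ _).symm.trans ((congrArg F.map e4).trans (F.map_comp _ _))

end Shift

section Zero

/-- If `L₁ ⟶ L₀ ⟶ A ⟶ 0` is exact, then `A` is the homology of `L` in degree zero. -/
noncomputable def homologyZeroMap (L : ChainComplex AddCommGrpCat.{u} ℕ) {A : AddCommGrpCat.{u}}
    (η : L.X 0 ⟶ A) (h : L.d 1 0 ≫ η = 0) : L.homology 0 ⟶ A :=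
  L.homologyι 0 ≫ L.descOpcycles η 1 (ChainComplex.prev ℕ 0) h

/-- In degree zero homology is the cokernel of the incoming differential, and right exactness
identifies this cokernel with `A`. -/
lemma isIso_homologyZeroMap (L : ChainComplex AddCommGrpCat.{u} ℕ) {A : AddCommGrpCat.{u}}
    (η : L.X 0 ⟶ A) (h : L.d 1 0 ≫ η = 0) (hs : Function.Surjective η)
    (he : ∀ x, η x = 0 → ∃ y, L.d 1 0 y = x) : IsIso (homologyZeroMap L η h) := by
  have hp : Function.Surjective (L.pOpcycles 0) :=
    (AddCommGrpCat.epi_iff_surjective _).1 inferInstance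
  have e (x : L.X 0) : L.descOpcycles η 1 (ChainComplex.prev ℕ 0) h (L.pOpcycles 0 x) = η x :=
    congrArg (fun f => f x) (L.p_descOpcycles η 1 (ChainComplex.prev ℕ 0) h)
  have : IsIso (L.descOpcycles η 1 (ChainComplex.prev ℕ 0) h) := by
    rw [ConcreteCategory.isIso_iff_bijective]
    refine ⟨(injective_iff_map_eq_zero
      (L.descOpcycles η 1 (ChainComplex.prev ℕ 0) h).hom).2 fun x hx => ?_, fun a => ?_⟩
    · obtain ⟨x, rfl⟩ := hp x
      obtain ⟨y, rfl⟩ := he x ((e x).symm.trans hx)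
      exact congrArg (fun f => f y) (L.d_pOpcycles 1 0)
    · obtain ⟨x, rfl⟩ := hs a
      exact ⟨_, e x⟩
  exact IsIso.comp_isIso

lemma homologyZeroMap_naturality {L L' : ChainComplex AddCommGrpCat.{u} ℕ}
    {A A' : AddCommGrpCat.{u}} (η : L.X 0 ⟶ A) (h : L.d 1 0 ≫ η = 0) (η' : L'.X 0 ⟶ A')
    (h' : L'.d 1 0 ≫ η' = 0) (φ : L ⟶ L') (τ : A ⟶ A') (e : η ≫ τ = φ.f 0 ≫ η') :
    homologyMap φ 0 ≫ homologyZeroMap L' η' h' = homologyZeroMap L η h ≫ τ := by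
  rw [homologyZeroMap, homologyZeroMap, homologyι_naturality_assoc, Category.assoc]
  congr 1
  rw [← cancel_epi (L.pOpcycles 0), p_opcyclesMap_assoc, p_descOpcycles, p_descOpcycles_assoc, e]

end Zero

end ChainComplex

/-! ### Both homologies as derived functors, and the role of `β`. -/

namespace GammaGrp

open Finsupp CotripleResolution IsAcyclicResolution

variable {Γ : Type u} [Group Γ]

section Shift

variable {K K' : GammaGrp Γ ⥤ ChainComplex (ModuleCat.{u} ZZ.{u}) ℕ}

/-- The effect of a natural transformation on the positive parts. -/
noncomputable abbrev positivePartMap (κ : K ⟶ K') : positivePart K ⟶ positivePart K' :=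
  Functor.whiskerRight κ
    ((forget₂ (ModuleCat.{u} ZZ.{u}) AddCommGrpCat.{u}).mapHomologicalComplex _ ⋙
      ChainComplex.truncate)

/-- If `d₁₀` vanishes, then the homology of the positive part of `K` is the homology of `K`,
with the degree shifted by one. -/
noncomputable def homologyPositivePartIso (h : ∀ G, (K.obj G).d 1 0 = 0) (n : ℕ) :
    homologyComp (positivePart K) n ≅
      K ⋙ HomologicalComplex.homologyFunctor _ _ (n + 1) ⋙
        forget₂ (ModuleCat.{u} ZZ.{u}) AddCommGrpCat.{u} :=
  NatIso.ofComponents (fun G => ChainComplex.homologyTruncateIso (forget₂ _ _) (K.obj G) (h G) n)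
    fun f => ChainComplex.homologyTruncateIso_hom_naturality (forget₂ _ _) (K.map f) (h _) (h _) n

lemma homologyPositivePartIso_hom_naturality (h : ∀ G, (K.obj G).d 1 0 = 0)
    (h' : ∀ G, (K'.obj G).d 1 0 = 0) (κ : K ⟶ K') (n : ℕ) :
    homologyCompMap (positivePartMap κ) n ≫ (homologyPositivePartIso h' n).hom =
      (homologyPositivePartIso h n).hom ≫ Functor.whiskerRight κ
        (HomologicalComplex.homologyFunctor _ _ (n + 1) ⋙
          forget₂ (ModuleCat.{u} ZZ.{u}) AddCommGrpCat.{u}) :=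
  NatTrans.ext (funext fun G => ChainComplex.homologyTruncateIso_hom_naturality (forget₂ _ _)
    (κ.app G) (h G) (h' G) n)

end Shift

lemma stdChainsFunctor_d_one_zero (G : GammaGrp Γ) : ((stdChainsFunctor Γ).obj G).d 1 0 = 0 :=
  ModuleCat.hom_ext stdCoinvD_zero

lemma barD_zero (G : Type u) [Group G] : barD G 0 = 0 :=
  LinearMap.ext fun v => betaLinear_injective (plain G) (plain_smul G) 0 <|
    (betaLinear_barD (plain G) 0 v).trans
      ((congrArg (fun f => f (betaLinear (plain G) 1 v)) (stdCoinvD_zero (G := plain G))).trans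
        (map_zero (betaLinear (plain G) 0)).symm)

lemma chainsFunctor_d_one_zero (G : GammaGrp Γ) : ((chainsFunctor Γ).obj G).d 1 0 = 0 :=
  ModuleCat.hom_ext (barD_zero G)

variable (Γ) in
/-- The chain maps that induce `β_n`, as a natural transformation. -/
noncomputable def betaNat : chainsFunctor Γ ⟶ stdChainsFunctor Γ where
  app := betaChains
  naturality G H f := by
    ext n : 1
    refine ModuleCat.hom_ext (Finsupp.lhom_ext' fun x => LinearMap.ext_ring ?_)
    refine (congrArg (betaLinear H n) (chainsFunctor_map_single f n x)).trans ?_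
    refine (betaLinear_single_one H n _).trans ?_
    refine Eq.trans ?_ (congrArg (stdPush f (n + 1)) (betaLinear_single_one G n x)).symm
    refine Eq.trans (congrArg stdGen ?_) (stdPush_mk f (n + 1) 1 _ 1).symm
    funext i
    refine Fin.induction ?_ (fun j hj => ?_) i
    · simp
    · simp only [Function.comp_apply] at hj ⊢
      rw [Fin.partialProd_succ, Fin.partialProd_succ, map_mul, hj]
      rfl

variable (Γ) in
/-- The homology of `T W_*` for `T G = G / [G, G]`. -/
noncomputable def altOrdinaryIso (n : ℕ) :
    homologyComp (altChains (freeCotriple Γ) (ordinaryAb Γ)) n ≅ integralHomology Γ (n + 1) :=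
  (chains_isAcyclicResolution Γ).altIso n ≪≫ homologyPositivePartIso chainsFunctor_d_one_zero n

variable (Γ) in
/-- The homology of `T W_*` for `T G = G / [G, G]_Γ`. -/
noncomputable def altGammaIso (n : ℕ) :
    homologyComp (altChains (freeCotriple Γ) (gammaAb Γ)) n ≅ equivariantHomology Γ (n + 1) :=
  (stdChains_isAcyclicResolution Γ).altIso n ≪≫
    homologyPositivePartIso stdChainsFunctor_d_one_zero n

lemma barAug_abProjection (G : GammaGrp Γ) :
    (barAug Γ).app G ≫ (abProjection Γ).app G =
      ((positivePartMap (betaNat Γ)).app G).f 0 ≫ (stdAug Γ).app G :=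
  AddCommGrpCat.hom_ext (AddMonoidHom.ext fun v => abProjection_barToAb G v)

/-- On derived functors `β` becomes the map induced by `G / [G, G] ⟶ G / [G, G]_Γ`. Both stages of
the identification, acyclic models and truncation, are natural for the chain map underlying `β`. -/
lemma altOrdinaryIso_hom_beta (n : ℕ) :
    (altOrdinaryIso Γ n).hom ≫ beta Γ (n + 1) =
      homologyCompMap (altChainsMap _ (abProjection Γ)) n ≫ (altGammaIso Γ n).hom := by
  have e1 := (chains_isAcyclicResolution Γ).altIso_hom_naturality (stdChains_isAcyclicResolution Γ)
    (positivePartMap (betaNat Γ)) (abProjection Γ) barAug_abProjection n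
  have e2 := homologyPositivePartIso_hom_naturality chainsFunctor_d_one_zero
    stdChainsFunctor_d_one_zero (betaNat Γ) n
  refine (Category.assoc _ _ _).trans ((congrArg (_ ≫ ·) e2.symm).trans ?_)
  exact (Category.assoc _ _ _).symm.trans
    ((congrArg (· ≫ _) e1.symm).trans (Category.assoc _ _ _))

/-! ### The short exact sequence of coefficient functors. -/

section LongExact

/-- The map `S / (S ∩ [G, G]) ⟶ G / [G, G]` for a subgroup `S` of `G`. -/
def subgroupToAb {G : GammaGrp Γ} (S : Subgroup G) :
    S ⧸ (commutator G).subgroupOf S →* Abelianization G :=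
  QuotientGroup.map _ _ S.subtype fun _ hx => hx

lemma subgroupToAb_injective {G : GammaGrp Γ} (S : Subgroup G) :
    Function.Injective (subgroupToAb S) := by
  refine (injective_iff_map_eq_one _).2 ?_
  rintro ⟨x⟩ hx
  exact (QuotientGroup.eq_one_iff (N := (commutator G).subgroupOf S) x).2
    ((QuotientGroup.eq_one_iff (N := commutator G) (x : G)).1 hx)

lemma abProjection_eq_zero_iff {G : GammaGrp Γ} (g : G) :
    (abProjection Γ).app G (Additive.ofMul (Abelianization.of g)) = 0 ↔
      g ∈ gammaCommutator G :=
  QuotientGroup.eq_one_iff (N := gammaCommutator G) g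

lemma abProjection_surjective (G : GammaGrp Γ) : Function.Surjective ((abProjection Γ).app G) := by
  rintro ⟨g⟩
  exact ⟨Additive.ofMul (Abelianization.of g), rfl⟩

/-- The image of `S` in `G / [G, G]` is `S [G, G] / [G, G]`. A general `S` covers both `[G, G]_Γ`,
for the long sequence, and `Γ · G`, for the short one. -/
lemma subgroupToAb_exact {G : GammaGrp Γ} (S : Subgroup G)
    (h : S ⊔ commutator G = gammaCommutator G) :
    Function.Exact (MonoidHom.toAdditive (subgroupToAb S)) ((abProjection Γ).app G) := by
  rintro ⟨g⟩
  refine (abProjection_eq_zero_iff g).trans ⟨fun hg => ?_, ?_⟩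
  · rw [← h] at hg
    obtain ⟨s, hs, c, hc, rfl⟩ := Subgroup.mem_sup_of_normal_right.1 hg
    refine ⟨Additive.ofMul (QuotientGroup.mk ⟨s, hs⟩), ?_⟩
    exact QuotientGroup.eq.2 (by simpa using hc)
  · rintro ⟨⟨s⟩, hs⟩
    have hc := QuotientGroup.eq.1 hs
    rw [← mul_inv_cancel_left (s : G) g, ← h]
    exact mul_mem (Subgroup.mem_sup_left s.2) (Subgroup.mem_sup_right hc)

lemma gammaCommutator_sup (G : GammaGrp Γ) :
    gammaCommutator G ⊔ commutator G = gammaCommutator G :=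
  sup_eq_left.2 (commutator_le_gammaCommutator G)

lemma gammaDiff_sup (G : GammaGrp Γ) : gammaDiff G ⊔ commutator G = gammaCommutator G := by
  rw [gammaCommutator, Subgroup.closure_union, Subgroup.closure_eq, sup_comm]
  rfl

variable (Γ)

/-- The inclusion `[G, G]_Γ / [G, G] ⟶ G / [G, G]`. -/
def tGammaInclusion : TGamma Γ ⟶ ordinaryAb Γ where
  app G := AddCommGrpCat.ofHom (MonoidHom.toAdditive (subgroupToAb (gammaCommutator G)))
  naturality G H f := AddCommGrpCat.hom_ext <| AddMonoidHom.ext <| by rintro ⟨x⟩; rfl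

/-- The map `Γ · G / ([G, G] ∩ Γ · G) ⟶ G / [G, G]`. -/
def gammaDiffInclusion : gammaDiffQuotient Γ ⟶ ordinaryAb Γ where
  app G := AddCommGrpCat.ofHom (MonoidHom.toAdditive (subgroupToAb (gammaDiff G)))
  naturality G H f := AddCommGrpCat.hom_ext <| AddMonoidHom.ext <| by rintro ⟨x⟩; rfl

lemma tGammaInclusion_abProjection : tGammaInclusion Γ ≫ abProjection Γ = 0 := by
  ext G x
  exact ((subgroupToAb_exact _ (gammaCommutator_sup G)) _).2 ⟨x, rfl⟩

/-- The short exact sequence of complexes `TΓ(F_*(G)) ⟶ F_*(G)^ab ⟶ F_*(G)^ab_Γ`. -/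
noncomputable def altSequence : GammaGrp Γ ⥤ ShortComplex (ChainComplex AddCommGrpCat.{u} ℕ) where
  obj G :=
    { f := (altChainsMap (freeCotriple Γ) (tGammaInclusion Γ)).app G
      g := (altChainsMap (freeCotriple Γ) (abProjection Γ)).app G
      zero := by
        ext n x
        exact congrArg (fun f => f.app (pow (freeCotriple Γ) G (n + 1)) x)
          (tGammaInclusion_abProjection Γ) }
  map f :=
    { τ₁ := (altChains (freeCotriple Γ) (TGamma Γ)).map f
      τ₂ := (altChains (freeCotriple Γ) (ordinaryAb Γ)).map f
      τ₃ := (altChains (freeCotriple Γ) (gammaAb Γ)).map f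
      comm₁₂ := (altChainsMap (freeCotriple Γ) (tGammaInclusion Γ)).naturality f
      comm₂₃ := (altChainsMap (freeCotriple Γ) (abProjection Γ)).naturality f }
  map_id G := ShortComplex.hom_ext _ _ ((altChains _ _).map_id G)
    ((altChains _ _).map_id G) ((altChains _ _).map_id G)
  map_comp f g := ShortComplex.hom_ext _ _ ((altChains _ _).map_comp f g)
    ((altChains _ _).map_comp f g) ((altChains _ _).map_comp f g)

/-- The three functors form a short exact sequence on every `Γ`-group; freeness of the groups in the
resolution plays no part. -/
lemma altSequence_shortExact (G : GammaGrp Γ) : ((altSequence Γ).obj G).ShortExact := by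
  refine HomologicalComplex.shortExact_of_degreewise_shortExact _ fun n => ?_
  let A := pow (freeCotriple Γ) G (n + 1)
  exact
    { exact := (ShortComplex.ab_exact_iff_function_exact _).2
        (subgroupToAb_exact _ (gammaCommutator_sup A))
      mono_f := (AddCommGrpCat.mono_iff_injective ((tGammaInclusion Γ).app A)).2
        (subgroupToAb_injective _)
      epi_g := (AddCommGrpCat.epi_iff_surjective ((abProjection Γ).app A)).2
        (abProjection_surjective A) }

/-- The connecting homomorphism. -/
noncomputable def altConnecting (n : ℕ) :
    homologyComp (altChains (freeCotriple Γ) (gammaAb Γ)) (n + 1) ⟶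
      homologyComp (altChains (freeCotriple Γ) (TGamma Γ)) n where
  app G := (altSequence_shortExact Γ G).δ (n + 1) n rfl
  naturality G H f := (HomologicalComplex.HomologySequence.δ_naturality ((altSequence Γ).map f)
    (altSequence_shortExact Γ G) (altSequence_shortExact Γ H) (n + 1) n rfl).symm

end LongExact

end GammaGrp

namespace CotripleResolution.IsAcyclicResolution

open ChainComplex

variable {C : Type*} [Category C] {W : Comonad C} {K K' : C ⥤ ChainComplex AddCommGrpCat.{u} ℕ}
  {T T' : C ⥤ AddCommGrpCat.{u}} {η : K ⋙ HomologicalComplex.eval _ _ 0 ⟶ T}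
  {η' : K' ⋙ HomologicalComplex.eval _ _ 0 ⟶ T'}

/-- The homology of `K` in degree zero is `T`. -/
noncomputable def zeroIso (h : IsAcyclicResolution W K T η) : homologyComp K 0 ≅ T :=
  NatIso.ofComponents (fun A => @asIso _ _ _ _ (homologyZeroMap (K.obj A) (η.app A) (h.d_comp A))
      (isIso_homologyZeroMap _ _ _ (h.surjective A) (h.exact_zero A)))
    fun f => homologyZeroMap_naturality _ _ _ _ (K.map f) (T.map f) (η.naturality f).symm

lemma zeroIso_hom_naturality (h : IsAcyclicResolution W K T η)
    (h' : IsAcyclicResolution W K' T' η') (κ : K ⟶ K') (τ : T ⟶ T')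
    (e : ∀ A, η.app A ≫ τ.app A = (κ.app A).f 0 ≫ η'.app A) :
    homologyCompMap κ 0 ≫ h'.zeroIso.hom = h.zeroIso.hom ≫ τ :=
  NatTrans.ext (funext fun A => homologyZeroMap_naturality _ _ _ _ (κ.app A) (τ.app A) (e A))

end CotripleResolution.IsAcyclicResolution

/-! ### The map `β` in degree one, and assembly of the sequences. -/

namespace GammaGrp

open CotripleResolution IsAcyclicResolution

variable (Γ : Type u) [Group Γ]

/-- The first homology group of `G` is `G / [G, G]`. -/
noncomputable def ordinaryAbIso : ordinaryAb Γ ≅ integralHomology Γ 1 :=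
  (chains_isAcyclicResolution Γ).zeroIso.symm ≪≫
    homologyPositivePartIso chainsFunctor_d_one_zero 0

/-- The first equivariant homology group of `G` is `G / [G, G]_Γ`. -/
noncomputable def gammaAbIso : gammaAb Γ ≅ equivariantHomology Γ 1 :=
  (stdChains_isAcyclicResolution Γ).zeroIso.symm ≪≫
    homologyPositivePartIso stdChainsFunctor_d_one_zero 0

/-- The map `β₁` is the projection `G / [G, G] ⟶ G / [G, G]_Γ`, read directly from homology in
degree one without derived functors. The short exact sequence and the surjectivity of `β₁` follow
from it. -/
lemma abProjection_gammaAbIso :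
    abProjection Γ ≫ (gammaAbIso Γ).hom = (ordinaryAbIso Γ).hom ≫ beta Γ 1 := by
  have e1 := (chains_isAcyclicResolution Γ).zeroIso_hom_naturality
    (stdChains_isAcyclicResolution Γ) (positivePartMap (betaNat Γ)) (abProjection Γ)
    barAug_abProjection
  have e2 := homologyPositivePartIso_hom_naturality chainsFunctor_d_one_zero
    stdChainsFunctor_d_one_zero (betaNat Γ) 0
  have e1' : (chains_isAcyclicResolution Γ).zeroIso.inv ≫
      homologyCompMap (positivePartMap (betaNat Γ)) 0 =
      abProjection Γ ≫ (stdChains_isAcyclicResolution Γ).zeroIso.inv := by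
    rw [Iso.inv_comp_eq, ← Category.assoc, Iso.eq_comp_inv]
    exact e1
  refine (Category.assoc _ _ _).symm.trans ((congrArg (· ≫ _) e1'.symm).trans ?_)
  exact (Category.assoc _ _ _).trans
    ((congrArg (_ ≫ ·) e2).trans (Category.assoc _ _ _).symm)

end GammaGrp

lemma AddCommGrpCat.exact_of_iso {X Y Z X' Y' Z' : AddCommGrpCat.{u}} {f : X ⟶ Y} {g : Y ⟶ Z}
    {f' : X' ⟶ Y'} {g' : Y' ⟶ Z'} (h : Function.Exact f g) (a : X ≅ X') (b : Y ≅ Y') (c : Z ≅ Z')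
    (hf : f ≫ b.hom = a.hom ≫ f') (hg : g ≫ c.hom = b.hom ≫ g') : Function.Exact f' g' :=
  Function.Exact.of_ladder_addEquiv_of_exact (f₁₂ := f.hom) (f₂₃ := g.hom) (g₁₂ := f'.hom)
    (g₂₃ := g'.hom) (e₁ := a.addCommGroupIsoToAddEquiv) (e₂ := b.addCommGroupIsoToAddEquiv)
    (e₃ := c.addCommGroupIsoToAddEquiv)
    (congrArg AddCommGrpCat.Hom.hom hf.symm) (congrArg AddCommGrpCat.Hom.hom hg.symm) h

open CotripleResolution IsAcyclicResolution

theorem theorem10 (Γ : Type u) [Group Γ] :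
    (∀ n : ℕ, Nonempty
      (cotripleDerived (freeCotriple Γ) (gammaAb Γ) n ≅ equivariantHomology Γ (n + 1))) ∧
    (∃ j : gammaDiffQuotient Γ ⟶ integralHomology Γ 1, ∀ G : GammaGrp Γ,
      Function.Injective (j.app G) ∧
      Function.Exact (j.app G) ((beta Γ 1).app G) ∧
      Function.Surjective ((beta Γ 1).app G)) ∧
    (∃ (ι : ∀ n : ℕ, cotripleDerived (freeCotriple Γ) (TGamma Γ) n ⟶ integralHomology Γ (n + 1))
       (δ : ∀ n : ℕ, equivariantHomology Γ (n + 2) ⟶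
          cotripleDerived (freeCotriple Γ) (TGamma Γ) n),
      ∀ G : GammaGrp Γ,
        (∀ n : ℕ, Function.Exact ((beta Γ (n + 2)).app G) ((δ n).app G)) ∧
        (∀ n : ℕ, Function.Exact ((δ n).app G) ((ι n).app G)) ∧
        (∀ n : ℕ, Function.Exact ((ι n).app G) ((beta Γ (n + 1)).app G)) ∧
        Function.Surjective ((beta Γ 1).app G)) := by
  have surj (G : GammaGrp Γ) : Function.Surjective ((beta Γ 1).app G) := by
    have e := congrArg (fun f => f.app G) (abProjection_gammaAbIso Γ)
    have : Epi ((abProjection Γ).app G) :=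
      (AddCommGrpCat.epi_iff_surjective _).2 (abProjection_surjective G)
    rw [NatTrans.comp_app, NatTrans.comp_app] at e
    have : Epi ((ordinaryAbIso Γ).hom.app G ≫ (beta Γ 1).app G) := by
      rw [← e]
      infer_instance
    exact (AddCommGrpCat.epi_iff_surjective _).1 (epi_of_epi ((ordinaryAbIso Γ).hom.app G) _)
  have e (G : GammaGrp Γ) (n : ℕ) :=
    congrArg (fun f => f.app G) (altOrdinaryIso_hom_beta (Γ := Γ) n)
  -- The maps `ι` and `δ` are those of the homology sequence of `altSequence`, conjugated by the
  -- natural identifications. The `n`-th derived functor of `TΓ` maps to homology in degree `n + 1`.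
  refine ⟨fun n => ⟨derivedIsoAlt _ _ n ≪≫ altGammaIso Γ n⟩,
    ⟨gammaDiffInclusion Γ ≫ (ordinaryAbIso Γ).hom, fun G => ⟨?_, ?_, surj G⟩⟩,
    ⟨fun n => (derivedIsoAlt _ _ n).hom ≫
      homologyCompMap (altChainsMap _ (tGammaInclusion Γ)) n ≫ (altOrdinaryIso Γ n).hom,
    fun n => (altGammaIso Γ (n + 1)).inv ≫ altConnecting Γ n ≫ (derivedIsoAlt _ _ n).inv,
    fun G => ⟨fun n => ?_, fun n => ?_, fun n => ?_, surj G⟩⟩⟩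
  · have : Mono ((gammaDiffInclusion Γ).app G) :=
      (AddCommGrpCat.mono_iff_injective _).2 (subgroupToAb_injective _)
    refine (AddCommGrpCat.mono_iff_injective _).1 ?_
    rw [NatTrans.comp_app]
    infer_instance
  · exact AddCommGrpCat.exact_of_iso (f := (gammaDiffInclusion Γ).app G)
      (subgroupToAb_exact _ (gammaDiff_sup G)) (Iso.refl _)
      ((ordinaryAbIso Γ).app G) ((gammaAbIso Γ).app G) (Category.id_comp _).symm
      (congrArg (fun f => f.app G) (abProjection_gammaAbIso Γ))
  -- The three remaining goals are exactness at the quotient, sub and middle term of the homology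
  -- sequence. Squares with `β` commute by `altOrdinaryIso_hom_beta`, those with `ι` or `δ` by
  -- construction.
  · refine AddCommGrpCat.exact_of_iso ((ShortComplex.ab_exact_iff_function_exact _).1
      ((altSequence_shortExact Γ G).homology_exact₃ (n + 1) n rfl))
      ((altOrdinaryIso Γ (n + 1)).app G) ((altGammaIso Γ (n + 1)).app G)
      ((derivedIsoAlt _ _ n).symm.app G) (e G (n + 1)).symm ?_
    exact (((altGammaIso Γ (n + 1)).app G).hom_inv_id_assoc _).symm
  · refine AddCommGrpCat.exact_of_iso ((ShortComplex.ab_exact_iff_function_exact _).1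
      ((altSequence_shortExact Γ G).homology_exact₁ (n + 1) n rfl))
      ((altGammaIso Γ (n + 1)).app G) ((derivedIsoAlt _ _ n).symm.app G)
      ((altOrdinaryIso Γ n).app G) ?_ ?_
    · exact (((altGammaIso Γ (n + 1)).app G).hom_inv_id_assoc _).symm
    · exact (((derivedIsoAlt _ _ n).app G).inv_hom_id_assoc _).symm
  · refine AddCommGrpCat.exact_of_iso ((ShortComplex.ab_exact_iff_function_exact _).1
      ((altSequence_shortExact Γ G).homology_exact₂ n))
      ((derivedIsoAlt _ _ n).symm.app G) ((altOrdinaryIso Γ n).app G)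
      ((altGammaIso Γ n).app G) ?_ (e G n).symm
    exact (((derivedIsoAlt _ _ n).app G).inv_hom_id_assoc _).symm
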